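/- **Proposition (Meixner weight and its constrained equilibrium measure).** Let $q\in(0,1)$, $u>q^{-1/2}$, $1<\nu<u\,q^{1/2}$ and $\beta=q^{-1/2}u^{-1}$. Then $\beta\in(0,1)$. For an integer $N\ge 1$ put $\alpha=(\nu-1)N$ and $$w_N(x)=\frac{\Gamma(\alpha+x-1)}{\Gamma(\alpha)\Gamma(x)}\,\beta^{x-1}\quad(x\in\mathbb Z_{>0}),\qquad W_N(x)=\tfrac1N\,w_N(Nx)\quad (x\in\tfrac1N\mathbb Z_{>0}),$$ and let $$V(x)=x\log\frac{x}{\beta(\nu+x-1)}+(\nu-1)\log\frac{\nu-1}{\nu+x-1}\quad(x>0),\qquad V(0)=0.$$ **(1) Weight.** There are an open set $U\subset\mathbb C$ containing $(0,\infty)$, real constants $C_N$ and functions $E_N$ ($N\ge1$), $E^{(0)}$ analytic on $U$, with $E_N$ real on $(0,\infty)$, such that $$W_N(x)=e^{-NV(x)-2C_N+E_N(x)}\qquad\text{for all }N\ge1,\ x\in\tfrac1N\mathbb Z_{>0},$$ and: * $V$ is continuous on $[0,\infty)$, extends analytically to $U$, this extension is bounded on $U\cap\{|z|<r\}$ for some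 $r>0$, and $\liminf_{x\to+\infty}V(x)/x>0$; * $E_N=E^{(0)}+O(N^{-1})$ as $N\to\infty$, uniformly on compact subsets of $U$; * for every $\delta>0$ there is $c>0$ with $\sup_{N\ge1}\ \sup_{z\in U,\ \delta\le|z|\le R}\bigl(|E_N(z)|+|E_N'(z)|\bigr)\le cR$ for all $R\ge\delta$ (a supremum over the empty set being $0$); and there is $c>0$ with $|E_N(z)|+|z||E_N'(z)|\le c\,(1+|\log|z||)$ for all $N\ge1$ and all $z\in U$ with $0<|z|\le1$. **(2) Equilibrium measure.** There is a unique Borel probability measure $\mu_V$ minimizing $$I[\mu]=\iint\log\frac1{|x-y|}\,d\mu(x)\,d\mu(y)+\int V\,d\mu=\iint\Bigl(\log\frac1{|x-y|}+\frac{V(x)+V(y)}2\Bigr)d\mu(x)\,d\mu(y)\in(-\infty,+\infty]$$ (the last expression being the definition when the two terms of the first are not both finite) over all Borel probability measures $\mu$ on $[0,\infty)$ with $\mu([s,t])\le t-s$ for all $0\le s<t$. With $$\mathsf a=\frac{(1-\sqrt{\nu\beta})^2}{1-\beta},\qquad \mathsf b=\frac{(1+\sqrt{\nu\beta})^2}{1-\beta},\qquad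 0<\mathsf a<\mathsf b,$$ the measure $\mu_V$ has a density $\rho$ with values in $[0,1]$ that is continuous on $(0,\infty)$, and: * (support) $\operatorname{supp}\mu_V=[0,\mathsf b]$; * (saturated region and band) $\mu_V$ is Lebesgue measure on $[0,\mathsf a]$, and $0<\rho<1$ on $(\mathsf a,\mathsf b)$; * (regular endpoints) there are $\mathsf c_0,\mathsf c_1>0$ with $1-\rho(x)=\frac{\mathsf c_0}{\pi}(x-\mathsf a)^{1/2}(1+O(x-\mathsf a))$ as $x\searrow\mathsf a$ and $\rho(x)=\frac{\mathsf c_1}{\pi}(\mathsf b-x)^{1/2}(1+O(\mathsf b-x))$ as $x\nearrow\mathsf b$; * (strict Euler–Lagrange conditions) for every $x>0$ the function $y\mapsto\log\frac1{|x-y|}$ is $\mu_V$-integrable, and for some $\ell\in\mathbb R$ the quantity $\int\log\frac1{|x-y|}\,d\mu_V(y)+\frac12V(x)+\ell$ is $<0$ for $0<x<\mathsf a$, $=0$ for $\mathsf a\le x\le\mathsf b$, and $>0$ for $x>\mathsf b$. **(3) Constant.** The constant $\mathsf c_V:=\mathsf c_0^{2/3}$ equals $\mathsf c^{-1}$, where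 $$\mathsf c=\frac{\beta^{1/2}\nu^{-1/6}}{1-\beta}\Bigl((1-\sqrt{\nu\beta})\bigl(\sqrt{\nu/\beta}-1\bigr)\Bigr)^{2/3}.$$ -/

import Mathlib

open Set Filter Topology MeasureTheory Asymptotics

noncomputable section

namespace Meixner

/-! ### Weights on the positive integers and their rescaling -/

/-- The Meixner weight with strength `s > 0` and shape `t ∈ (0,1)`:
`w(x) = Γ(s + x - 1) / (Γ(s) Γ(x)) * t ^ (x - 1)`; it is used at positive integers `x`. -/
def meixnerWeight (s t x : ℝ) : ℝ :=
  Real.Gamma (s + x - 1) / (Real.Gamma s * Real.Gamma x) * t ^ (x - 1)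

/-- The lattice `(1/N) ℤ_{>0}`. -/
def lattice (N : ℕ) : Set ℝ := {x | ∃ k : ℕ, 0 < k ∧ x = (k : ℝ) / N}

/-- The rescaled weight `W_N(x) = (1/N) w(N x)`. -/
def rescaledWeight (N : ℕ) (w : ℝ → ℝ) (x : ℝ) : ℝ := 1 / (N : ℝ) * w (N * x)

/-- The assumption on a family of weights `w N` (`N` is the number of particles) with external
field `V`: on the lattice `(1/N) ℤ_{>0}`,
`W_N(x) = exp (- N V(x) - 2 C_N + E_N(x))`, where, for an open `U ⊆ ℂ` containing `(0,∞)`,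
`V` has an analytic extension `Vc` to `U`, and the correction terms `E N` are analytic on `U`,
real on `(0,∞)`, converge to an analytic `E₀` and are uniformly bounded as stated. -/
structure WeightAssumptionWith (w : ℕ → ℝ → ℝ) (V : ℝ → ℝ)
    (U : Set ℂ) (Vc : ℂ → ℂ) (E : ℕ → ℂ → ℂ) (E₀ : ℂ → ℂ) (C : ℕ → ℝ) : Prop where
  isOpen_U : IsOpen U
  pos_mem_U : ∀ x : ℝ, 0 < x → (x : ℂ) ∈ U
  decomposition : ∀ N : ℕ, 0 < N → ∀ x ∈ lattice N,
    rescaledWeight N (w N) x = Real.exp (-(N * V x) - 2 * C N + (E N (x : ℂ)).re)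
  -- the external field
  V_continuousOn : ContinuousOn V (Ici 0)
  Vc_analytic : AnalyticOnNhd ℂ Vc U
  Vc_eq : ∀ x : ℝ, 0 < x → Vc (x : ℂ) = (V x : ℂ)
  V_bounded_at_zero : ∃ r > (0 : ℝ), ∃ M : ℝ, ∀ z ∈ U, ‖z‖ < r → ‖Vc z‖ ≤ M
  V_growth : 0 < liminf (fun x : ℝ => ((V x / x : ℝ) : EReal)) atTop
  -- the correction term
  E_analytic : ∀ N : ℕ, 0 < N → AnalyticOnNhd ℂ (E N) U
  E_real : ∀ N : ℕ, 0 < N → ∀ x : ℝ, 0 < x → (E N (x : ℂ)).im = 0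
  E₀_analytic : AnalyticOnNhd ℂ E₀ U
  E_convergence : ∀ K : Set ℂ, IsCompact K → K ⊆ U →
    ∃ M : ℝ, ∀ᶠ N : ℕ in atTop, ∀ z ∈ K, ‖E N z - E₀ z‖ ≤ M / N
  E_bound : ∀ δ > (0 : ℝ), ∃ c > (0 : ℝ), ∀ N : ℕ, 0 < N → ∀ R : ℝ, ∀ z ∈ U,
    δ ≤ ‖z‖ → ‖z‖ ≤ R → ‖E N z‖ + ‖deriv (E N) z‖ ≤ c * R
  E_bound_at_zero : ∃ c > (0 : ℝ), ∀ N : ℕ, 0 < N → ∀ z ∈ U, 0 < ‖z‖ → ‖z‖ ≤ 1 →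
    ‖E N z‖ + ‖z‖ * ‖deriv (E N) z‖ ≤ c * (1 + |Real.log ‖z‖|)

/-- The weights `w N` satisfy the weight assumption with external field `V`. -/
def WeightAssumption (w : ℕ → ℝ → ℝ) (V : ℝ → ℝ) : Prop :=
  ∃ (U : Set ℂ) (Vc : ℂ → ℂ) (E : ℕ → ℂ → ℂ) (E₀ : ℂ → ℂ) (C : ℕ → ℝ),
    WeightAssumptionWith w V U Vc E E₀ C

/-! ### The constrained equilibrium measure -/

/-- Borel probability measures on `[0,∞)` obeying the upper constraint `μ [a,b] ≤ b - a`. -/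
structure IsAdmissible (μ : Measure ℝ) : Prop where
  isProbabilityMeasure : IsProbabilityMeasure μ
  nonneg : μ (Iio 0) = 0
  upper_constraint : ∀ a b : ℝ, 0 ≤ a → a < b → μ (Icc a b) ≤ ENNReal.ofReal (b - a)

/-- The integrand of the weighted energy, symmetrised: `log (1/|x-y|) + (V(x) + V(y))/2`. -/
def energyKernel (V : ℝ → ℝ) (x y : ℝ) : ℝ := Real.log (1 / |x - y|) + (V x + V y) / 2

/-- The energy `I[μ] = ∬ log (1/|x-y|) dμ(x) dμ(y) + ∫ V dμ` of a probability measure, as an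
extended real number. It is written as one double integral (positive part minus negative part),
so that it has a value also when `∬ log (1/|x-y|) = -∞` and `∫ V = +∞`; for `V` of at least linear
growth the kernel is bounded below, and the negative part is finite. An admissible measure has no
atoms, so the diagonal is null. -/
def energy (V : ℝ → ℝ) (μ : Measure ℝ) : EReal :=
  ((∫⁻ p : ℝ × ℝ, ENNReal.ofReal (energyKernel V p.1 p.2) ∂(μ.prod μ) : ENNReal) : EReal) -
    ((∫⁻ p : ℝ × ℝ, ENNReal.ofReal (-energyKernel V p.1 p.2) ∂(μ.prod μ) : ENNReal) : EReal)

/-- `μ` minimises the energy in the external field `V` under the upper constraint. -/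
def IsEnergyMinimizer (V : ℝ → ℝ) (μ : Measure ℝ) : Prop :=
  IsAdmissible μ ∧ ∀ μ' : Measure ℝ, IsAdmissible μ' → energy V μ ≤ energy V μ'

/-- `μ` is the constrained equilibrium measure in the external field `V`: the unique minimiser. -/
def IsConstrainedEquilibrium (V : ℝ → ℝ) (μ : Measure ℝ) : Prop :=
  IsEnergyMinimizer V μ ∧ ∀ μ' : Measure ℝ, IsEnergyMinimizer V μ' → μ' = μ

/-- The logarithmic potential `∫ log (1/|x-y|) dμ(y)`. -/
def logPotential (μ : Measure ℝ) (x : ℝ) : ℝ := ∫ y, Real.log (1 / |x - y|) ∂μ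

/-- The regularity assumption on the equilibrium measure `μ` of `V`, with density `ρ`, saturated
region `[0,a]`, band `[a,b]`, and `c₀` the constant of the square-root vanishing of `1 - ρ` at `a`:
`1 - ρ(x) = (c₀/π) (x-a)^{1/2} (1 + O(x-a))` as `x ↘ a`. -/
structure EquilibriumAssumption (V : ℝ → ℝ) (μ : Measure ℝ) (ρ : ℝ → ℝ) (a b c₀ : ℝ) : Prop where
  a_pos : 0 < a
  a_lt_b : a < b
  density_measurable : Measurable ρ
  density_mem : ∀ x, ρ x ∈ Icc (0 : ℝ) 1
  density_continuous : ContinuousOn ρ (Ioi 0)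
  density : μ = volume.withDensity (fun x => ENNReal.ofReal (ρ x))
  support_eq : μ.support = Icc 0 b
  saturated : μ.restrict (Icc 0 a) = volume.restrict (Icc 0 a)
  band : ∀ x ∈ Ioo a b, 0 < ρ x ∧ ρ x < 1
  right_edge : ∃ c₁ > (0 : ℝ),
    (fun x => ρ x - c₁ / Real.pi * √(b - x)) =O[𝓝[<] b] fun x => √(b - x) * (b - x)
  c₀_pos : 0 < c₀
  left_edge :
    (fun x => 1 - ρ x - c₀ / Real.pi * √(x - a)) =O[𝓝[>] a] fun x => √(x - a) * (x - a)
  potential_integrable : ∀ x > (0 : ℝ), Integrable (fun y => Real.log (1 / |x - y|)) μ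
  euler_lagrange : ∃ l : ℝ,
    (∀ x, 0 < x → x < a → logPotential μ x + V x / 2 + l < 0) ∧
    (∀ x, a ≤ x → x ≤ b → logPotential μ x + V x / 2 + l = 0) ∧
    (∀ x, b < x → 0 < logPotential μ x + V x / 2 + l)

/-- The external field of the Meixner ensemble (`0 log 0 = 0` at `x = 0`). -/
def meixnerField (ν β x : ℝ) : ℝ :=
  x * Real.log (x / (β * (ν + x - 1))) + (ν - 1) * Real.log ((ν - 1) / (ν + x - 1))

/-- The scaling constant
`β^{1/2} ν^{-1/6} / (1-β) * ((1 - √(νβ)) (√(ν/β) - 1))^{2/3}` of the height fluctuations. -/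
def scalingConstant (ν β : ℝ) : ℝ :=
  β ^ (1 / 2 : ℝ) * ν ^ (-(1 / 6) : ℝ) / (1 - β) *
    ((1 - √(ν * β)) * (√(ν / β) - 1)) ^ (2 / 3 : ℝ)

end Meixner

end

/-! Write `p = ν - 1`, so that the gamma functions have arguments `pN + k - 1` and `k`.

Weight. The Gudermann series `stirlingMu` gives an explicit solution `stirlingF` of `F (x + 1) = x F
x`. Only values at integer shifts occur, so `Γ / stirlingF` is constant along them and is absorbed
in `C_N`; Stirling's limit is not needed. The logarithms of `stirlingF` give `-NV` and the
corrections `stirlingMu`, which are of order `1/N` away from the origin and logarithmic near it. One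
factor, `(pN + k - 1) / N`, remains. Its obvious interpolation `z + p - 1/N` may vanish near `0`
when `pN ≤ 2`; for these finitely many `N` a multiple of `sin (πNz) / (πNz)` is added, which is zero
on the lattice and keeps the real part positive on a thin strip.

Minimality. Admissible measures are dominated by Lebesgue measure. The kernel `log (1/|x-y|)` is, up
to constants, a limit of averages over `r` and `u` of `1[x ∈ (u-r,u)] 1[y ∈ (u-r,u)]`, so the energy
of a difference of two probability measures is a limit of squared norms: it is nonnegative and
vanishes only for equal measures. Hence the Euler–Lagrange conditions imply that a measure is the
unique minimiser (`isConstrainedEquilibrium_of_eulerLagrange`).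

The measure. It is the mixture over masses `s ∈ (0,1)` of arcsine laws on bands with centre `A(s) =
bandCenter` and half-width `h(s) = bandHalf`. The key identity (`radicand_eq`) is `h(s)² - (x -
A(s))² = R(x)² - (s - c(x))²`, with `c = dualCenter` and `R = dualHalf`: for fixed `x`, the masses
whose band contains `x` form the interval `[c - R, c + R]`. Integrating in `s` gives the density
`1/2 + arcsin ((1-c)/R)/π`, which lies in `[0,1]` automatically; `x` is saturated, in the band, or
in the void according to the position of `1` relative to this interval.

Euler–Lagrange. The potential of one arcsine law is `log 2 - log h` minus the Green function of its
band, which vanishes on the band. An explicit antiderivative shows that the Green functions of the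
masses below `c - R` integrate to `V/2` up to a constant (`integral_bandGreen`). So `U + V/2 + ℓ =
-∫_{c-R}^1` of the Green function, and all three sign conditions can be read off. The square roots
at the endpoints and the constant `c₀ = √(b-a) / R(a)` come from `R² - (1-c)² = (x-a)(b-x)`. -/

namespace Meixner

/-! ### The Gudermann series of the Stirling correction -/

/-- The general term `(w + 1/2) log (1 + 1/w) - 1` of the Gudermann series. -/
noncomputable def gudermann (w : ℂ) : ℂ := (w + 1 / 2) * (Complex.log (w + 1) - Complex.log w) - 1

theorem norm_log_le_of_re_pos {w : ℂ} (hw : 0 < w.re) :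
    ‖Complex.log w‖ ≤ |Real.log ‖w‖| + 2 := by
  have h := Complex.norm_le_abs_re_add_abs_im (Complex.log w)
  rw [Complex.log_re, Complex.log_im] at h
  have h2 : |w.arg| < Real.pi / 2 := Complex.abs_arg_lt_pi_div_two_iff.2 (Or.inl hw)
  have := Real.pi_lt_d2
  linarith

/-- Both `w` and `1 + w⁻¹` lie in the right half-plane, so their arguments add up to less than `π`
in absolute value and the principal branch is additive. -/
theorem log_add_one_sub_log {w : ℂ} (hw : 0 < w.re) :
    Complex.log (w + 1) - Complex.log w = Complex.log (1 + w⁻¹) := by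
  have hw0 : w ≠ 0 := by rintro rfl; simp at hw
  have h1 : 0 < (1 + w⁻¹).re := by
    have : 0 < (w⁻¹).re := by rw [Complex.inv_re]; have := Complex.normSq_pos.2 hw0; positivity
    simp only [Complex.add_re, Complex.one_re]; linarith
  have a1 : |w.arg| < Real.pi / 2 := Complex.abs_arg_lt_pi_div_two_iff.2 (Or.inl hw)
  have a2 : |(1 + w⁻¹).arg| < Real.pi / 2 := Complex.abs_arg_lt_pi_div_two_iff.2 (Or.inl h1)
  have h10 : 1 + w⁻¹ ≠ 0 := by intro h; rw [h] at h1; simp at h1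
  have := Complex.log_mul hw0 h10
    ⟨by have := abs_lt.1 a1; have := abs_lt.1 a2; linarith,
      by have := abs_lt.1 a1; have := abs_lt.1 a2; linarith⟩
  rw [mul_add, mul_inv_cancel₀ hw0, mul_one] at this
  rw [this]; ring

theorem norm_gudermann_le_crude {w : ℂ} (hw : 0 < w.re) (h2 : ‖w‖ ≤ 2) :
    ‖gudermann w‖ ≤ 14 + 3 * |Real.log ‖w‖| := by
  have h1 : 0 < (w + 1).re := by simp only [Complex.add_re, Complex.one_re]; linarith
  have ha := norm_log_le_of_re_pos hw
  have hb := norm_log_le_of_re_pos h1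
  have hn1 : 1 ≤ ‖w + 1‖ := by
    have := Complex.re_le_norm (w + 1)
    simp only [Complex.add_re, Complex.one_re] at this; linarith
  have hn2 : ‖w + 1‖ ≤ 3 := by
    have := norm_add_le w 1; rw [norm_one] at this; linarith
  have hl : |Real.log ‖w + 1‖| ≤ 1.2 := by
    rw [abs_of_nonneg (Real.log_nonneg hn1)]
    calc Real.log ‖w + 1‖ ≤ Real.log 3 := Real.log_le_log (by linarith) hn2
      _ ≤ 1.2 := by
        have : Real.log 3 = Real.log 2 + Real.log (3 / 2) := by
          rw [← Real.log_mul (by norm_num) (by norm_num)]; norm_num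
        have h3 := Real.log_le_sub_one_of_pos (show (0 : ℝ) < 3 / 2 by norm_num)
        have := Real.log_two_lt_d9
        linarith
  have hd : ‖Complex.log (w + 1) - Complex.log w‖ ≤ 5.2 + |Real.log ‖w‖| := by
    have := norm_sub_le (Complex.log (w + 1)) (Complex.log w); linarith
  have hw2 : ‖w + 1 / 2‖ ≤ 2.5 := by
    have := norm_add_le w (1 / 2); norm_num at this ⊢; linarith
  have : ‖gudermann w‖ ≤ 2.5 * (5.2 + |Real.log ‖w‖|) + 1 := by
    unfold gudermann
    refine (norm_sub_le _ _).trans ?_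
    rw [norm_one, norm_mul]
    gcongr
  have := abs_nonneg (Real.log ‖w‖)
  linarith

/-- Inserting `log (1 + 1/w) = 1/w - 1/(2w²) + O(w⁻³)`, the shift `1/2` makes the `1/w` terms
cancel, leaving `-1/(4w²)` and a remainder of the same order. -/
theorem norm_gudermann_le_of_two_le {w : ℂ} (hw : 0 < w.re) (h2 : 2 ≤ ‖w‖) :
    ‖gudermann w‖ ≤ 2 / ‖w‖ ^ 2 := by
  have hw0 : w ≠ 0 := by rintro rfl; simp at hw
  have hn : ‖w⁻¹‖ ≤ 1 / 2 := by
    rw [norm_inv, one_div]; exact inv_anti₀ (by norm_num) h2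
  have hT := Complex.norm_log_sub_logTaylor_le 2 (z := w⁻¹) (by linarith)
  have hTe : Complex.logTaylor (2 + 1) w⁻¹ = w⁻¹ - w⁻¹ ^ 2 / 2 := by
    simp [Complex.logTaylor_succ, Complex.logTaylor_zero]; ring
  rw [hTe] at hT
  set r := Complex.log (1 + w⁻¹) - (w⁻¹ - w⁻¹ ^ 2 / 2) with hr
  have hr3 : ‖r‖ ≤ 2 / 3 * ‖w⁻¹‖ ^ 3 := by
    refine hT.trans ?_
    have : (1 - ‖w⁻¹‖)⁻¹ ≤ 2 := by
      rw [inv_le_comm₀ (by linarith) (by norm_num)]; linarith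
    have h3 : 0 ≤ ‖w⁻¹‖ ^ 3 := by positivity
    have h4 := mul_le_mul_of_nonneg_left this h3
    push_cast
    norm_num only
    linarith
  have hg : gudermann w = -(w⁻¹ ^ 2 / 4) + (w + 1 / 2) * r := by
    unfold gudermann
    rw [log_add_one_sub_log hw, show Complex.log (1 + w⁻¹) = r + (w⁻¹ - w⁻¹ ^ 2 / 2) by rw [hr]; ring]
    field_simp; ring
  have hwp : 0 < ‖w‖ := norm_pos_iff.2 hw0
  have e : ‖w‖ * ‖w⁻¹‖ = 1 := by rw [← norm_mul, mul_inv_cancel₀ hw0, norm_one]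
  have h5 : ‖w + 1 / 2‖ ≤ ‖w‖ + 1 / 2 := by
    have := norm_add_le w (1 / 2); norm_num at this ⊢; linarith
  have : ‖gudermann w‖ ≤ ‖w⁻¹‖ ^ 2 / 4 + (‖w‖ + 1 / 2) * (2 / 3 * ‖w⁻¹‖ ^ 3) := by
    rw [hg]
    refine (norm_add_le _ _).trans ?_
    rw [norm_neg, norm_div, norm_pow, norm_mul]
    norm_num at *
    gcongr
  have e2 : (2 : ℝ) / ‖w‖ ^ 2 = 2 * ‖w⁻¹‖ ^ 2 := by rw [norm_inv]; field_simp
  have e3 : (‖w‖ + 1 / 2) * (2 / 3 * ‖w⁻¹‖ ^ 3)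
      = 2 / 3 * ‖w⁻¹‖ ^ 2 * (‖w‖ * ‖w⁻¹‖ + ‖w⁻¹‖ / 2) := by ring
  rw [e3, e] at this
  rw [e2]
  have h6 : 0 ≤ ‖w⁻¹‖ ^ 2 := by positivity
  nlinarith

/-- For `1 ≤ ‖w‖ ≤ 2` the crude bound is at most `17`, and `17 · 4 ≤ 72`. -/
theorem norm_gudermann_le {w : ℂ} (hw : 0 < w.re) (h1 : 1 ≤ ‖w‖) :
    ‖gudermann w‖ ≤ 72 / ‖w‖ ^ 2 := by
  rcases le_total 2 ‖w‖ with h2 | h2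
  · exact (norm_gudermann_le_of_two_le hw h2).trans (by gcongr; norm_num)
  · refine (norm_gudermann_le_crude hw h2).trans ?_
    have : |Real.log ‖w‖| ≤ 1 := by
      rw [abs_of_nonneg (Real.log_nonneg h1)]
      have := Real.log_le_sub_one_of_pos (show 0 < ‖w‖ by linarith); linarith
    rw [le_div_iff₀ (by positivity)]
    nlinarith

theorem re_add_natCast_pos {w : ℂ} (hw : 0 < w.re) (n : ℕ) : 0 < (w + n).re := by
  simp only [Complex.add_re, Complex.natCast_re]; positivity

theorem norm_add_natCast_ge {w : ℂ} (hw : 0 < w.re) (n : ℕ) : ‖w‖ + n ≤ 2 * ‖w + n‖ := by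
  have h1 := Complex.re_le_norm (w + n)
  simp only [Complex.add_re, Complex.natCast_re] at h1
  have h2 : ‖w‖ ≤ ‖w + n‖ := by
    rw [Complex.norm_def, Complex.norm_def]
    apply Real.sqrt_le_sqrt
    rw [Complex.normSq_apply, Complex.normSq_apply]
    simp only [Complex.add_re, Complex.natCast_re, Complex.add_im, Complex.natCast_im, add_zero]
    have : (0 : ℝ) ≤ n := by positivity
    nlinarith
  linarith

theorem hasSum_telescope_inv {r : ℝ} (hr : 0 < r) :
    HasSum (fun n : ℕ => 1 / (r + n) - 1 / (r + (n + 1 : ℕ))) (1 / r) := by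
  have h : Tendsto (fun n : ℕ => 1 / (r + n)) atTop (𝓝 0) := by
    have : Tendsto (fun n : ℕ => r + (n : ℝ)) atTop atTop :=
      tendsto_atTop_add_const_left _ _ tendsto_natCast_atTop_atTop
    simpa [Function.comp_def] using tendsto_inv_atTop_zero.comp this
  rw [hasSum_iff_tendsto_nat_of_nonneg]
  · simp_rw [Finset.sum_range_sub' (fun n : ℕ => 1 / (r + (n : ℝ)))]
    simpa using (tendsto_const_nhds (x := 1 / r)).sub h
  · intro n
    rw [sub_nonneg]
    apply one_div_le_one_div_of_le (by positivity)
    push_cast; linarith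

/-- A telescoping majorant, so that summation gives decay `1/‖w‖`. The constant is `72 · 4 · 2`: a
factor `4` from `‖w‖ + n ≤ 2 ‖w + n‖` and a factor `2` from `‖w‖ + n + 1 ≤ 2 (‖w‖ + n)`. -/
theorem norm_gudermann_add_le {w : ℂ} (hw : 0 < w.re) (h1 : 1 ≤ ‖w‖) (n : ℕ) :
    ‖gudermann (w + n)‖ ≤ 576 * (1 / (‖w‖ + n) - 1 / (‖w‖ + (n + 1 : ℕ))) := by
  have h2 := norm_add_natCast_ge hw n
  have hre := re_add_natCast_pos hw n
  have hn : (0 : ℝ) ≤ n := by positivity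
  have h3 : 1 ≤ ‖w + n‖ := by
    have : ‖w‖ ≤ ‖w + n‖ := by
      rw [Complex.norm_def, Complex.norm_def]
      apply Real.sqrt_le_sqrt
      rw [Complex.normSq_apply, Complex.normSq_apply]
      simp only [Complex.add_re, Complex.natCast_re, Complex.add_im, Complex.natCast_im, add_zero]
      nlinarith
    linarith
  refine (norm_gudermann_le hre h3).trans ?_
  have e : 1 / (‖w‖ + n) - 1 / (‖w‖ + (n + 1 : ℕ)) = 1 / ((‖w‖ + n) * (‖w‖ + n + 1)) := by
    push_cast; field_simp; ring
  rw [e, mul_one_div, div_le_div_iff₀ (by positivity) (by positivity)]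
  nlinarith

/-- The correction `μ(w)` in Stirling's formula `Γ(w) ~ √(2π) exp ((w - 1/2) log w - w + μ(w))`. -/
noncomputable def stirlingMu (w : ℂ) : ℂ := ∑' n : ℕ, gudermann (w + n)

theorem summable_gudermann {w : ℂ} (hw : 0 < w.re) :
    Summable (fun n : ℕ => gudermann (w + n)) := by
  rw [← summable_nat_add_iff 1]
  have hw1 : 0 < (w + 1).re := by simp only [Complex.add_re, Complex.one_re]; linarith
  have h1 : 1 ≤ ‖w + 1‖ := by
    have := Complex.re_le_norm (w + 1)
    simp only [Complex.add_re, Complex.one_re] at this; linarith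
  refine Summable.of_norm_bounded
    (((hasSum_telescope_inv (r := ‖w + 1‖) (by linarith)).mul_left 576).summable) fun n => ?_
  have := norm_gudermann_add_le hw1 h1 n
  rwa [show w + 1 + (n : ℂ) = w + (n + 1 : ℕ) by push_cast; ring] at this

theorem stirlingMu_eq_add {w : ℂ} (hw : 0 < w.re) :
    stirlingMu w = gudermann w + stirlingMu (w + 1) := by
  unfold stirlingMu
  rw [(summable_gudermann hw).tsum_eq_zero_add]
  simp only [Nat.cast_zero, add_zero]
  congr 1
  refine tsum_congr fun n => ?_
  congr 1; push_cast; ring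

theorem norm_stirlingMu_le {w : ℂ} (hw : 0 < w.re) (h1 : 1 ≤ ‖w‖) :
    ‖stirlingMu w‖ ≤ 576 / ‖w‖ := by
  have := tsum_of_norm_bounded ((hasSum_telescope_inv (r := ‖w‖) (by linarith)).mul_left 576)
    (norm_gudermann_add_le hw h1)
  rwa [mul_one_div] at this

/-- Near `0` only the first term of the series is singular; the rest is `stirlingMu (w + 1)`,
bounded by `576`, and `590 = 576 + 14`. -/
theorem norm_stirlingMu_le_log {w : ℂ} (hw : 0 < w.re) :
    ‖stirlingMu w‖ ≤ 590 * (1 + max 0 (-Real.log ‖w‖)) := by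
  rcases le_total 1 ‖w‖ with h | h
  · refine (norm_stirlingMu_le hw h).trans ?_
    have : 576 / ‖w‖ ≤ 576 := div_le_self (by norm_num) h
    have := le_max_left 0 (-Real.log ‖w‖)
    linarith
  · rw [stirlingMu_eq_add hw]
    have hw1 : 0 < (w + 1).re := by simp only [Complex.add_re, Complex.one_re]; linarith
    have h1 : 1 ≤ ‖w + 1‖ := by
      have := Complex.re_le_norm (w + 1)
      simp only [Complex.add_re, Complex.one_re] at this; linarith
    have ha := norm_stirlingMu_le hw1 h1
    have hb := norm_gudermann_le_crude hw (by linarith)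
    have : 576 / ‖w + 1‖ ≤ 576 := div_le_self (by norm_num) h1
    have hl : Real.log ‖w‖ ≤ 0 := Real.log_nonpos (norm_nonneg _) h
    rw [abs_of_nonpos hl] at hb
    have := le_max_right 0 (-Real.log ‖w‖)
    have := le_max_left 0 (-Real.log ‖w‖)
    have := norm_add_le (gudermann w) (stirlingMu (w + 1))
    linarith

theorem differentiableOn_gudermann : DifferentiableOn ℂ gudermann {w | 0 < w.re} := by
  intro w hw
  have hw' : 0 < w.re := hw
  have h1 : w ∈ Complex.slitPlane := Or.inl hw'
  have h2 : w + 1 ∈ Complex.slitPlane := Or.inl (by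
    simp only [Complex.add_re, Complex.one_re]; linarith)
  apply DifferentiableAt.differentiableWithinAt
  unfold gudermann
  have := (differentiableAt_id (𝕜 := ℂ) (x := w)).clog h1
  have := ((differentiableAt_id (𝕜 := ℂ) (x := w)).add_const 1).clog h2
  simp only [id] at *
  fun_prop

theorem isOpen_re_pos : IsOpen {w : ℂ | 0 < w.re} :=
  isOpen_lt continuous_const Complex.continuous_re

theorem differentiableOn_stirlingMu : DifferentiableOn ℂ stirlingMu {w | 0 < w.re} := by
  -- The term `n = 0` is split off because it is unbounded at `0`; the shifted series has a majorant
  -- uniform on the half-plane.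
  have hS : DifferentiableOn ℂ (fun w => ∑' n : ℕ, gudermann (w + 1 + n)) {w | 0 < w.re} := by
    refine Complex.differentiableOn_tsum_of_summable_norm
      (((hasSum_telescope_inv (r := 1) one_pos).mul_left 576).summable) (fun n => ?_)
      isOpen_re_pos ?_
    · refine differentiableOn_gudermann.comp (by fun_prop) fun w (hw : 0 < w.re) => ?_
      change 0 < (w + 1 + n).re
      simp only [Complex.add_re, Complex.one_re, Complex.natCast_re]; positivity
    · intro n w (hw : 0 < w.re)
      have hw1 : 0 < (w + 1 + n).re := by
        simp only [Complex.add_re, Complex.one_re, Complex.natCast_re]; positivity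
      have hn : (0 : ℝ) ≤ n := by positivity
      have h1 : 1 + (n : ℝ) ≤ ‖w + 1 + n‖ := by
        have := Complex.re_le_norm (w + 1 + n)
        simp only [Complex.add_re, Complex.one_re, Complex.natCast_re] at this; linarith
      refine (norm_gudermann_le hw1 (by linarith)).trans ?_
      have e : 1 / (1 + (n : ℝ)) - 1 / (1 + (n + 1 : ℕ)) = 1 / ((1 + n) * (1 + n + 1)) := by
        push_cast; field_simp; ring
      rw [e, mul_one_div, div_le_div_iff₀ (by nlinarith) (by positivity)]
      nlinarith
  refine (differentiableOn_gudermann.add hS).congr fun w (hw : 0 < w.re) => ?_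
  simpa [stirlingMu] using stirlingMu_eq_add hw

/-- Cauchy's estimate on the disc of radius `‖w‖ / 2`, which stays in the right half-plane because
`w` is in the sector. The radius costs a factor `2`, and the change of `log ‖z‖` by at most `log 2`
on the circle another one. -/
theorem norm_deriv_stirlingMu_le {w : ℂ} (hw : |w.im| < w.re) :
    ‖w‖ * ‖deriv stirlingMu w‖ ≤ 2360 * (1 + max 0 (-Real.log ‖w‖)) := by
  have hre : 0 < w.re := (abs_nonneg _).trans_lt hw
  have hw0 : w ≠ 0 := by rintro rfl; simp at hre
  have hn : 0 < ‖w‖ := norm_pos_iff.2 hw0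
  have hsq : ‖w‖ ^ 2 < 2 * w.re ^ 2 := by
    rw [← Complex.normSq_eq_norm_sq, Complex.normSq_apply]
    have := sq_lt_sq' (by linarith [abs_nonneg w.im]) hw
    rw [sq_abs] at this; nlinarith
  have hre2 : ‖w‖ / 2 < w.re := by nlinarith
  have hball : ∀ z ∈ Metric.closedBall w (‖w‖ / 2), 0 < z.re := by
    intro z hz
    rw [Metric.mem_closedBall, dist_eq_norm] at hz
    have := Complex.abs_re_le_norm (z - w)
    rw [Complex.sub_re] at this
    have := neg_abs_le (z.re - w.re)
    linarith
  have hlog2 := Real.log_two_lt_d9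
  have hmax := le_max_left 0 (-Real.log ‖w‖)
  have hmax' := le_max_right 0 (-Real.log ‖w‖)
  have := Complex.norm_deriv_le_of_forall_mem_sphere_norm_le (c := w) (R := ‖w‖ / 2)
    (C := 590 * (2 * (1 + max 0 (-Real.log ‖w‖)))) (f := stirlingMu)
    (by positivity)
    (by
      apply DifferentiableOn.diffContOnCl
      refine differentiableOn_stirlingMu.mono ?_
      exact (Metric.closure_ball_subset_closedBall).trans hball)
    (by
      intro z hz
      have hz' := hball z (Metric.sphere_subset_closedBall hz)
      refine (norm_stirlingMu_le_log hz').trans ?_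
      rw [mem_sphere_iff_norm] at hz
      have hzn : ‖w‖ / 2 ≤ ‖z‖ := by
        have := norm_sub_norm_le w z
        rw [norm_sub_rev, hz] at this; linarith
      have hlog : Real.log (‖w‖ / 2) ≤ Real.log ‖z‖ := Real.log_le_log (by positivity) hzn
      rw [Real.log_div hn.ne' (by norm_num)] at hlog
      have : max 0 (-Real.log ‖z‖) ≤ 1 + max 0 (-Real.log ‖w‖) := by
        apply max_le <;> linarith
      linarith)
  calc ‖w‖ * ‖deriv stirlingMu w‖
      ≤ ‖w‖ * (590 * (2 * (1 + max 0 (-Real.log ‖w‖))) / (‖w‖ / 2)) := by gcongr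
    _ = _ := by field_simp; ring

theorem stirlingMu_real {x : ℝ} (hx : 0 < x) : (stirlingMu x).im = 0 := by
  unfold stirlingMu
  rw [Complex.im_tsum (summable_gudermann (by simpa using hx))]
  convert tsum_zero with n
  unfold gudermann
  have h1 : Complex.log ((x : ℂ) + n + 1) = ((Real.log (x + n + 1) : ℝ) : ℂ) := by
    rw [Complex.ofReal_log (by positivity)]; push_cast; rfl
  have h2 : Complex.log ((x : ℂ) + n) = ((Real.log (x + n) : ℝ) : ℂ) := by
    rw [Complex.ofReal_log (by positivity)]; push_cast; rfl
  rw [h1, h2]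
  have : ((x : ℂ) + n + 1 / 2) * (((Real.log (x + n + 1) : ℝ) : ℂ) - ((Real.log (x + n) : ℝ) : ℂ)) - 1
      = (((x + n + 1 / 2) * (Real.log (x + n + 1) - Real.log (x + n)) - 1 : ℝ) : ℂ) := by
    push_cast; rfl
  rw [this, Complex.ofReal_im]

theorem stirlingMu_re_sub {x : ℝ} (hx : 0 < x) :
    (stirlingMu x).re = (x + 1 / 2) * (Real.log (x + 1) - Real.log x) - 1
      + (stirlingMu ((x + 1 : ℝ) : ℂ)).re := by
  rw [stirlingMu_eq_add (by simpa using hx), Complex.add_re]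
  congr 1
  · unfold gudermann
    have h1 : Complex.log ((x : ℂ) + 1) = ((Real.log (x + 1) : ℝ) : ℂ) := by
      rw [Complex.ofReal_log (by positivity)]; push_cast; rfl
    rw [h1, ← Complex.ofReal_log hx.le]
    have : ((x : ℂ) + 1 / 2) * (((Real.log (x + 1) : ℝ) : ℂ) - ((Real.log x : ℝ) : ℂ)) - 1
      = (((x + 1 / 2) * (Real.log (x + 1) - Real.log x) - 1 : ℝ) : ℂ) := by
      push_cast; rfl
    rw [this, Complex.ofReal_re]
  · push_cast; rfl

/-- Stirling's main term with its correction: a positive solution of `F (x + 1) = x F x`. -/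
noncomputable def stirlingF (x : ℝ) : ℝ :=
  Real.exp ((x - 1 / 2) * Real.log x - x + (stirlingMu x).re)

theorem stirlingF_pos (x : ℝ) : 0 < stirlingF x := Real.exp_pos _

theorem stirlingF_add_one {x : ℝ} (hx : 0 < x) : stirlingF (x + 1) = x * stirlingF x := by
  unfold stirlingF
  nth_rewrite 5 [← Real.exp_log hx]
  rw [← Real.exp_add, stirlingMu_re_sub hx]
  congr 1
  ring

/-- `Γ` and `stirlingF` obey the same recursion, so their ratio is unchanged by integer shifts. This
exact identity replaces Stirling's formula, whose constant would only enter `C_N`. -/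
theorem Gamma_add_natCast_div_stirlingF {x : ℝ} (hx : 0 < x) (k : ℕ) :
    Real.Gamma (x + k) = Real.Gamma x / stirlingF x * stirlingF (x + k) := by
  induction k with
  | zero => have := (stirlingF_pos x).ne'; simp; field_simp
  | succ k ih =>
    have hk : 0 < x + k := by positivity
    push_cast
    rw [← add_assoc, Real.Gamma_add_one hk.ne', stirlingF_add_one hk, ih]
    ring

/-! ### The entire function `sin (πz) / (πz)` -/

/-- The entire function `sin (πz) / (πz)`. -/
noncomputable def csinc (z : ℂ) : ℂ := dslope Complex.sin 0 (Real.pi * z)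

theorem differentiable_csinc : Differentiable ℂ csinc := by
  have h : DifferentiableOn ℂ (dslope Complex.sin 0) univ :=
    (Complex.differentiableOn_dslope univ_mem).2 Complex.differentiable_sin.differentiableOn
  exact (differentiableOn_univ.1 h).comp (differentiable_id.const_mul (Real.pi : ℂ))

theorem csinc_of_ne {z : ℂ} (hz : z ≠ 0) :
    csinc z = Complex.sin (Real.pi * z) / (Real.pi * z) := by
  have : (Real.pi : ℂ) * z ≠ 0 := mul_ne_zero (by exact_mod_cast Real.pi_ne_zero) hz
  rw [csinc, dslope_of_ne _ this, slope_def_field]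
  simp

theorem csinc_natCast {k : ℕ} (hk : 0 < k) : csinc k = 0 := by
  rw [csinc_of_ne (by exact_mod_cast hk.ne'), mul_comm, Complex.sin_nat_mul_pi, zero_div]

theorem csinc_ofReal {x : ℝ} (hx : x ≠ 0) :
    csinc x = ((Real.sin (Real.pi * x) / (Real.pi * x) : ℝ) : ℂ) := by
  rw [csinc_of_ne (by exact_mod_cast hx)]
  push_cast; rfl

/-- On `[0,1/2]` this follows from the cubic lower bound of the sine; both sides are symmetric under
`x ↦ 1 - x`. -/
theorem sin_pi_mul_ge {x : ℝ} (h0 : 0 ≤ x) (h1 : x ≤ 1) :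
    Real.pi * x * (1 - x) ≤ Real.sin (Real.pi * x) := by
  have key : ∀ y : ℝ, 0 ≤ y → y ≤ 1 / 2 → Real.pi * y * (1 - y) ≤ Real.sin (Real.pi * y) := by
    intro y hy0 hy1
    have hpi := Real.pi_pos
    refine le_trans ?_ (Real.sin_ge_sub_cube (mul_nonneg hpi.le hy0))
    have h10 : Real.pi ^ 2 * y ≤ 6 := by
      have := Real.pi_lt_d2
      nlinarith
    have : 0 ≤ Real.pi * y * y * (6 - Real.pi ^ 2 * y) := by
      apply mul_nonneg (by positivity); linarith
    nlinarith
  rcases le_total x (1 / 2) with h | h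
  · exact key x h0 h
  · have := key (1 - x) (by linarith) (by linarith)
    rw [show Real.pi * (1 - x) = Real.pi - Real.pi * x by ring, Real.sin_pi_sub] at this
    linarith

/-- With `x` in the role of `N z`, this makes the corrected interpolation of `(pN + k - 1) / N` at
least `p` on the positive axis, for every `N ≥ 1`. -/
theorem re_sub_one_add_csinc_nonneg {x : ℝ} (hx : 0 < x) : 0 ≤ x - 1 + (csinc x).re := by
  rw [csinc_ofReal hx.ne', Complex.ofReal_re]
  have hpi := Real.pi_pos
  rcases le_total x 1 with h | h
  · have : 1 - x ≤ Real.sin (Real.pi * x) / (Real.pi * x) := by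
      rw [le_div_iff₀ (by positivity)]
      linarith [sin_pi_mul_ge hx.le h]
    linarith
  · have h1 : |Real.sin (Real.pi * x)| ≤ Real.pi * (x - 1) := by
      rw [show Real.sin (Real.pi * x) = -Real.sin (Real.pi * (x - 1)) by
        rw [show Real.pi * (x - 1) = Real.pi * x - Real.pi by ring, Real.sin_sub_pi]; ring, abs_neg]
      have h2 : 0 ≤ Real.pi * (x - 1) := mul_nonneg hpi.le (by linarith)
      have := Real.abs_sin_le_abs (x := Real.pi * (x - 1))
      rwa [abs_of_nonneg h2] at this
    have : -(x - 1) ≤ Real.sin (Real.pi * x) / (Real.pi * x) := by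
      rw [le_div_iff₀ (by positivity)]
      have := neg_abs_le (Real.sin (Real.pi * x))
      nlinarith [mul_nonneg hpi.le (mul_nonneg (sub_nonneg.2 h) (sub_nonneg.2 h))]
    linarith

theorem exists_norm_csinc_le :
    ∃ M > 0, ∀ z : ℂ, |z.im| ≤ 1 → ‖csinc z‖ ≤ M ∧ ‖deriv csinc z‖ ≤ M := by
  obtain ⟨K, hK⟩ := (isCompact_closedBall (0 : ℂ) 1).exists_bound_of_continuousOn
    differentiable_csinc.continuous.continuousOn
  -- The strip is wider than needed for the values, so that unit circles around points with `|Im z|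
  -- ≤ 1` fit inside and Cauchy's estimate bounds the derivative.
  have hb : ∀ z : ℂ, |z.im| ≤ 2 → ‖csinc z‖ ≤ max K (Real.exp (2 * Real.pi)) := by
    intro z hz
    rcases le_total ‖z‖ 1 with h | h
    · exact (hK z (by simpa using h)).trans (le_max_left _ _)
    · refine le_trans ?_ (le_max_right _ _)
      have hz0 : z ≠ 0 := norm_pos_iff.1 (by linarith)
      have hpi := Real.pi_gt_three
      rw [csinc_of_ne hz0, norm_div, norm_mul, Complex.norm_real, Real.norm_of_nonneg Real.pi_pos.le]
      have hs : ‖Complex.sin (Real.pi * z)‖ ≤ Real.exp (2 * Real.pi) := by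
        rw [Complex.sin, norm_div, norm_mul, Complex.norm_I, mul_one]
        have e1 : ‖Complex.exp (-(Real.pi * z) * Complex.I)‖ ≤ Real.exp (2 * Real.pi) := by
          rw [Complex.norm_exp, Real.exp_le_exp]
          simp
          nlinarith [abs_le.1 hz]
        have e2 : ‖Complex.exp (Real.pi * z * Complex.I)‖ ≤ Real.exp (2 * Real.pi) := by
          rw [Complex.norm_exp, Real.exp_le_exp]
          simp
          nlinarith [abs_le.1 hz]
        have := norm_sub_le (Complex.exp (-(Real.pi * z) * Complex.I))
          (Complex.exp (Real.pi * z * Complex.I))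
        rw [Complex.norm_ofNat]
        linarith
      rw [div_le_iff₀ (by positivity)]
      have : 1 ≤ Real.pi * ‖z‖ := by nlinarith
      nlinarith [Real.exp_pos (2 * Real.pi)]
  refine ⟨max K (Real.exp (2 * Real.pi)), lt_max_of_lt_right (Real.exp_pos _), fun z hz =>
    ⟨hb z (by linarith), ?_⟩⟩
  have := Complex.norm_deriv_le_of_forall_mem_sphere_norm_le (c := z) (R := 1)
    (C := max K (Real.exp (2 * Real.pi))) one_pos
    (differentiable_csinc.diffContOnCl) (fun w hw => hb w (by
      rw [mem_sphere_iff_norm] at hw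
      have := Complex.abs_im_le_norm (w - z)
      rw [Complex.sub_im] at this
      have := abs_sub_abs_le_abs_sub w.im z.im
      linarith))
  simpa using this

theorem norm_log_le_of_le_re {d : ℝ} (hd : 0 < d) {w : ℂ} (hw : d ≤ w.re) :
    ‖Complex.log w‖ ≤ ‖w‖ + 1 / d + 2 := by
  have h1 := norm_log_le_of_re_pos (hd.trans_le hw)
  have h2 : d ≤ ‖w‖ := hw.trans (Complex.re_le_norm w)
  have h3 : |Real.log ‖w‖| ≤ ‖w‖ + 1 / d := by
    have a := Real.log_le_sub_one_of_pos (hd.trans_le h2)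
    have b := Real.log_le_sub_one_of_pos (one_div_pos.2 hd)
    rw [one_div, Real.log_inv, ← one_div] at b
    have c := Real.log_le_log hd h2
    have := one_div_pos.2 hd
    have := norm_nonneg w
    rw [abs_le]; constructor <;> linarith
  linarith

/-! ### The Meixner weight -/

/-- The correction function interpolating `(s + k - 1) / N` at `k / N`, where `s = p N`. -/
noncomputable def shiftFactor (p : ℝ) (N : ℕ) (z : ℂ) : ℂ :=
  z + p - 1 / N + (if 2 < p * N then 0 else csinc (N * z) / N)

/-- The domain `{|Im z| < Re z, |Im z| < ε}`. -/
def sectorStrip (ε : ℝ) : Set ℂ := {z | |z.im| < z.re ∧ |z.im| < ε}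

theorem isOpen_sectorStrip (ε : ℝ) : IsOpen (sectorStrip ε) := by
  have h1 : IsOpen {z : ℂ | |z.im| < z.re} :=
    isOpen_lt Complex.continuous_im.abs Complex.continuous_re
  have h2 : IsOpen {z : ℂ | |z.im| < ε} := isOpen_lt Complex.continuous_im.abs continuous_const
  exact h1.inter h2

theorem re_pos_of_mem_sectorStrip {ε : ℝ} {z : ℂ} (hz : z ∈ sectorStrip ε) : 0 < z.re :=
  (abs_nonneg _).trans_lt hz.1

/-- For `pN > 2` the loss `1/N` is below `p/2`. For `pN ≤ 2` the sinc term compensates it, but only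
close to the real axis on the scale `1/N`; since `N` is then bounded, one strip serves all `N`. -/
theorem exists_shiftFactor_bounds {p : ℝ} (hp : 0 < p) :
    ∃ ε > 0, ∃ M > 0, ∀ N : ℕ, 0 < N → ∀ z ∈ sectorStrip ε,
      p / 2 ≤ (shiftFactor p N z).re ∧ ‖shiftFactor p N z‖ ≤ ‖z‖ + M ∧
      ‖deriv (shiftFactor p N) z‖ ≤ M := by
  obtain ⟨M, hM, hcs⟩ := exists_norm_csinc_le
  -- When `pN ≤ 2`, this width gives `N |Im z| ≤ min 1 (p / (2M))`: the first bound keeps `N z` in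
  -- the strip where `csinc` is controlled, the second makes its deviation from the real axis at
  -- most `p/2`.
  refine ⟨p / 2 * min 1 (p / (2 * M)), by positivity, p + 2 + M, by positivity,
    fun N hN z hz => ?_⟩
  have hN' : (0 : ℝ) < N := by exact_mod_cast hN
  have hN1 : (1 : ℝ) ≤ N := by exact_mod_cast hN
  have hNi : 1 / (N : ℝ) ≤ 1 := by rw [div_le_one hN']; exact hN1
  have hre := re_pos_of_mem_sectorStrip hz
  have hpn : ‖(p : ℂ)‖ = p := by rw [Complex.norm_real, Real.norm_of_nonneg hp.le]
  have hNn : ‖(1 / N : ℂ)‖ = 1 / N := by simp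
  have hNre : (1 / N : ℂ).re = 1 / N := by
    rw [show (1 / N : ℂ) = ((1 / N : ℝ) : ℂ) by push_cast; rfl, Complex.ofReal_re]
  have hb : ‖z + p - 1 / N‖ ≤ ‖z‖ + p + 1 := by
    have h1 := norm_sub_le (z + p) (1 / N : ℂ)
    have h2 := norm_add_le z (p : ℂ)
    rw [hpn] at h2; rw [hNn] at h1
    linarith
  by_cases h : 2 < p * N
  · have hf : shiftFactor p N = fun z : ℂ => z + p - 1 / N := by
      funext z; simp [shiftFactor, h]
    rw [hf]
    refine ⟨?_, by simp only; linarith, ?_⟩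
    · simp only [Complex.sub_re, Complex.add_re, Complex.ofReal_re, hNre]
      have : 1 / (N : ℝ) ≤ p / 2 := by rw [div_le_div_iff₀ hN' two_pos]; linarith
      linarith
    · have : HasDerivAt (fun z : ℂ => z + p - 1 / N) 1 z :=
        ((hasDerivAt_id z).add_const _).sub_const _
      rw [this.deriv, norm_one]; linarith
  · have hf : shiftFactor p N = fun z : ℂ => z + p - 1 / N + csinc (N * z) / N := by
      funext z; simp [shiftFactor, h]
    rw [hf]
    push Not at h
    have him : |((N : ℂ) * z).im| ≤ min 1 (p / (2 * M)) := by
      have e : ((N : ℂ) * z).im = N * z.im := by simp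
      rw [e, abs_mul, abs_of_pos hN']
      have h0 : 0 < min 1 (p / (2 * M)) := by positivity
      have := hz.2
      calc N * |z.im| ≤ N * (p / 2 * min 1 (p / (2 * M))) := by gcongr
        _ = (p * N) / 2 * min 1 (p / (2 * M)) := by ring
        _ ≤ 1 * min 1 (p / (2 * M)) := by gcongr; linarith
        _ = _ := one_mul _
    have him1 := him.trans (min_le_left _ _)
    have hc := hcs _ him1
    refine ⟨?_, ?_, ?_⟩
    · have hx : 0 < N * z.re := by positivity
      have h0 := re_sub_one_add_csinc_nonneg hx
      have hdist : ‖csinc (N * z) - csinc ((N * z.re : ℝ) : ℂ)‖ ≤ M * (p / (2 * M)) := by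
        have hconv : Convex ℝ {w : ℂ | |w.im| ≤ 1} := by
          have : {w : ℂ | |w.im| ≤ 1} = Complex.imLm ⁻¹' (Icc (-1) 1) := by
            ext w; simp [abs_le]
          rw [this]; exact (convex_Icc _ _).linear_preimage _
        refine (hconv.norm_image_sub_le_of_norm_deriv_le (𝕜 := ℂ)
          (fun w _ => differentiable_csinc w) (fun w hw => (hcs w hw).2)
          (show |((N * z.re : ℝ) : ℂ).im| ≤ 1 by rw [Complex.ofReal_im]; norm_num) him1).trans ?_
        have e : (N : ℂ) * z - ((N * z.re : ℝ) : ℂ) = ((N : ℂ) * z).im * Complex.I := by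
          apply Complex.ext <;> simp
        rw [e, norm_mul, Complex.norm_I, mul_one, Complex.norm_real, Real.norm_eq_abs]
        gcongr
        exact him.trans (min_le_right _ _)
      rw [show M * (p / (2 * M)) = p / 2 by field_simp] at hdist
      have hr := (Complex.abs_re_le_norm _).trans hdist
      rw [Complex.sub_re] at hr
      have hr' := (abs_le.1 hr).1
      have e2 : (csinc (N * z) / (N : ℂ)).re = (csinc (N * z)).re / N := by
        rw [show (N : ℂ) = ((N : ℝ) : ℂ) by simp, Complex.div_ofReal_re]
      simp only [Complex.sub_re, Complex.add_re, Complex.ofReal_re, hNre, e2]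
      have e3 : z.re + p - 1 / N + (csinc (N * z)).re / N
        = p + (N * z.re - 1 + (csinc (N * z)).re) / N := by field_simp; ring
      rw [e3]
      have : -(p / 2) ≤ (N * z.re - 1 + (csinc (N * z)).re) / N := by
        rw [le_div_iff₀ hN']
        nlinarith
      linarith
    · have h1 := norm_add_le (z + p - 1 / N) (csinc (N * z) / (N : ℂ))
      have h2 : ‖csinc (N * z) / (N : ℂ)‖ ≤ M := by
        rw [norm_div, Complex.norm_natCast]
        exact (div_le_self (norm_nonneg _) hN1).trans hc.1
      simp only; linarith
    · have hd : HasDerivAt (fun z : ℂ => z + p - 1 / N + csinc (N * z) / N)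
          (1 + deriv csinc (N * z) * (N * 1) / N) z :=
        (((hasDerivAt_id z).add_const _).sub_const _).add
          ((((differentiable_csinc _).hasDerivAt).comp z ((hasDerivAt_id z).const_mul (N : ℂ))).div_const _)
      have hNc : (N : ℂ) ≠ 0 := by exact_mod_cast hN.ne'
      rw [hd.deriv, mul_one, mul_div_cancel_right₀ _ hNc]
      have := norm_add_le 1 (deriv csinc (N * z))
      rw [norm_one] at this
      linarith [hc.2]

theorem differentiable_shiftFactor (p : ℝ) (N : ℕ) : Differentiable ℂ (shiftFactor p N) := by
  unfold shiftFactor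
  have := differentiable_csinc
  split_ifs <;> fun_prop

/-- The sinc term vanishes at positive integers, so the modification is invisible to the weight. -/
theorem shiftFactor_lattice {p : ℝ} {N k : ℕ} (hN : 0 < N) (hk : 0 < k) :
    shiftFactor p N (((k : ℝ) / N : ℝ) : ℂ) = (((p * N + k - 1) / N : ℝ) : ℂ) := by
  have hNc : (N : ℂ) ≠ 0 := by exact_mod_cast hN.ne'
  have e : (N : ℂ) * (((k : ℝ) / N : ℝ) : ℂ) = k := by push_cast; field_simp
  rw [shiftFactor, e, csinc_natCast hk]
  simp only [zero_div, ite_self, add_zero]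
  push_cast; field_simp; ring

theorem shiftFactor_im {p : ℝ} {N : ℕ} (hN : 0 < N) {x : ℝ} (hx : 0 < x) :
    (shiftFactor p N x).im = 0 := by
  have hN' : (N : ℝ) ≠ 0 := by exact_mod_cast hN.ne'
  have e : (N : ℂ) * (x : ℂ) = ((N * x : ℝ) : ℂ) := by push_cast; rfl
  have hc := csinc_ofReal (x := N * x) (mul_ne_zero hN' hx.ne')
  rw [shiftFactor, e, hc]
  have : (x : ℂ) + p - 1 / N + (if 2 < p * N then 0 else
      ((Real.sin (Real.pi * (N * x)) / (Real.pi * (N * x)) : ℝ) : ℂ) / N)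
      = ((x + p - 1 / N + (if 2 < p * N then 0 else
      (Real.sin (Real.pi * (N * x)) / (Real.pi * (N * x))) / N) : ℝ) : ℂ) := by
    split_ifs <;> push_cast <;> rfl
  rw [this, Complex.ofReal_im]

/-- The correction terms of the Meixner weight. -/
noncomputable def meixnerE (p : ℝ) (N : ℕ) (z : ℂ) : ℂ :=
  1 / 2 * Complex.log z - 1 / 2 * Complex.log (z + p) + stirlingMu (N * (z + p))
    - stirlingMu (N * z) - Complex.log (shiftFactor p N z)

/-- The limit of the correction terms of the Meixner weight. -/
noncomputable def meixnerE₀ (p : ℝ) (z : ℂ) : ℂ :=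
  1 / 2 * Complex.log z - 1 / 2 * Complex.log (z + p) - Complex.log (z + p)

/-- The analytic extension of the external field. -/
noncomputable def meixnerVc (p β : ℝ) (z : ℂ) : ℂ :=
  z * (Complex.log z - Real.log β - Complex.log (z + p))
    + p * (Real.log p - Complex.log (z + p))

/-! ### The external field and its growth at infinity. -/

theorem meixnerField_eq {p β x : ℝ} (hp : 0 < p) (hβ : 0 < β) (hx : 0 ≤ x) :
    meixnerField (p + 1) β x
      = x * Real.log x - x * (Real.log β + Real.log (x + p))
        + p * (Real.log p - Real.log (x + p)) := by
  have e : p + 1 + x - 1 = x + p := by ring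
  have e' : p + 1 - 1 = p := by ring
  have hxp : 0 < x + p := by positivity
  rw [meixnerField, e, e', Real.log_div hp.ne' hxp.ne']
  rcases hx.eq_or_lt with rfl | hx
  · simp
  · rw [Real.log_div hx.ne' (by positivity), Real.log_mul hβ.ne' hxp.ne']
    ring

theorem continuousOn_meixnerField {p β : ℝ} (hp : 0 < p) (hβ : 0 < β) :
    ContinuousOn (meixnerField (p + 1) β) (Ici 0) := by
  have h : ContinuousOn (fun x => x * Real.log x - x * (Real.log β + Real.log (x + p))
        + p * (Real.log p - Real.log (x + p))) (Ici 0) := by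
    have h1 := Real.continuous_mul_log.continuousOn (s := Ici 0)
    have h2 : ContinuousOn (fun x : ℝ => Real.log (x + p)) (Ici 0) :=
      ContinuousOn.log (by fun_prop) fun x (hx : 0 ≤ x) => by positivity
    fun_prop
  exact h.congr fun x hx => meixnerField_eq hp hβ hx

theorem tendsto_meixnerField_div {p β : ℝ} (hp : 0 < p) (hβ : 0 < β) :
    Tendsto (fun x => meixnerField (p + 1) β x / x) atTop (𝓝 (-Real.log β)) := by
  have h0 : Tendsto (fun x : ℝ => x / (x + p)) atTop (𝓝 1) := by
    have h : Tendsto (fun x : ℝ => 1 - p * (x + p)⁻¹) atTop (𝓝 (1 - p * 0)) :=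
      tendsto_const_nhds.sub ((tendsto_inv_atTop_zero.comp
        (tendsto_atTop_add_const_right _ p tendsto_id)).const_mul p)
    rw [mul_zero, sub_zero] at h
    refine h.congr' ?_
    filter_upwards [eventually_gt_atTop 0] with x hx
    field_simp; ring
  have h1 : Tendsto (fun x : ℝ => Real.log (x / (x + p))) atTop (𝓝 0) := by
    simpa using h0.log one_ne_zero
  have h2 : Tendsto (fun x : ℝ => p * (Real.log p / x)) atTop (𝓝 0) := by
    simpa using (tendsto_const_nhds.div_atTop tendsto_id).const_mul p
  have h3 : Tendsto (fun x : ℝ => p * (Real.log (x + p) / (x + p) * ((x / (x + p))⁻¹))) atTop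
      (𝓝 0) := by
    have a : Tendsto (fun x : ℝ => Real.log (x + p) / (x + p)) atTop (𝓝 0) := by
      have := Real.isLittleO_log_id_atTop.tendsto_div_nhds_zero
      exact this.comp (tendsto_atTop_add_const_right _ p tendsto_id)
    simpa using (a.mul (h0.inv₀ one_ne_zero)).const_mul p
  have h4 := ((h1.sub_const (Real.log β)).add h2).sub h3
  rw [zero_sub, add_zero, sub_zero] at h4
  refine h4.congr' ?_
  filter_upwards [eventually_gt_atTop 0] with x hx
  have hxp : 0 < x + p := by positivity
  rw [meixnerField_eq hp hβ hx.le, Real.log_div hx.ne' hxp.ne']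
  field_simp
  ring

/-! ### Analyticity and uniform bounds of the field and the correction terms. -/

theorem abs_im_lt_re_mul {N : ℕ} (hN : 0 < N) {z : ℂ} (hz : |z.im| < z.re) :
    |((N : ℂ) * z).im| < ((N : ℂ) * z).re := by
  have hN' : (0 : ℝ) < N := by exact_mod_cast hN
  have e1 : ((N : ℂ) * z).im = N * z.im := by simp
  have e2 : ((N : ℂ) * z).re = N * z.re := by simp
  rw [e1, e2, abs_mul, abs_of_pos hN']
  gcongr

theorem abs_im_lt_re_add {p : ℝ} (hp : 0 < p) {z : ℂ} (hz : |z.im| < z.re) :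
    |(z + p).im| < (z + p).re := by
  simp; linarith

theorem le_norm_add {p : ℝ} (hp : 0 < p) {z : ℂ} (hz : 0 < z.re) :
    p ≤ ‖z + p‖ ∧ ‖z‖ ≤ ‖z + p‖ := by
  constructor
  · have := Complex.re_le_norm (z + p)
    simp at this; linarith
  · rw [Complex.norm_def, Complex.norm_def]
    apply Real.sqrt_le_sqrt
    rw [Complex.normSq_apply, Complex.normSq_apply]
    simp
    nlinarith

theorem hasDerivAt_meixnerE {p : ℝ} (hp : 0 < p) {N : ℕ} (hN : 0 < N) {z : ℂ}
    (hz : |z.im| < z.re) (hD : 0 < (shiftFactor p N z).re) :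
    HasDerivAt (meixnerE p N)
      (1 / 2 * (1 / z) - 1 / 2 * (1 / (z + p)) + deriv stirlingMu (N * (z + p)) * N
        - deriv stirlingMu (N * z) * N - deriv (shiftFactor p N) z / shiftFactor p N z) z := by
  have hre : 0 < z.re := (abs_nonneg _).trans_lt hz
  have hzp := abs_im_lt_re_add hp hz
  have h1 := abs_im_lt_re_mul hN hz
  have h2 := abs_im_lt_re_mul hN hzp
  have hpos : ∀ {w : ℂ}, |w.im| < w.re → 0 < w.re := fun h => (abs_nonneg _).trans_lt h
  have hid := hasDerivAt_id z
  have hmu : ∀ {w : ℂ}, 0 < w.re → HasDerivAt stirlingMu (deriv stirlingMu w) w := fun {w} hw =>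
    (differentiableOn_stirlingMu.differentiableAt (isOpen_re_pos.mem_nhds hw)).hasDerivAt
  have a1 := (hid.clog (Or.inl hre)).const_mul (1 / 2 : ℂ)
  have a2 := ((hid.add_const (p : ℂ)).clog (Or.inl (hpos hzp))).const_mul (1 / 2 : ℂ)
  have a3 := (hmu (hpos h2)).comp z ((hid.add_const (p : ℂ)).const_mul (N : ℂ))
  have a4 := (hmu (hpos h1)).comp z (hid.const_mul (N : ℂ))
  have a5 := ((differentiable_shiftFactor p N z).hasDerivAt).clog (Or.inl hD)
  have := (((a1.sub a2).add a3).sub a4).sub a5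
  simp only [mul_one] at this
  exact this

theorem analyticOnNhd_meixnerVc {p β ε : ℝ} (hp : 0 < p) :
    AnalyticOnNhd ℂ (meixnerVc p β) (sectorStrip ε) := by
  refine DifferentiableOn.analyticOnNhd (fun z hz => ?_) (isOpen_sectorStrip ε)
  have hre := re_pos_of_mem_sectorStrip hz
  have h1 : z ∈ Complex.slitPlane := Or.inl hre
  have h2 : z + p ∈ Complex.slitPlane := Or.inl (by simp; linarith)
  unfold meixnerVc
  apply DifferentiableAt.differentiableWithinAt
  have := (differentiableAt_id (𝕜 := ℂ) (x := z)).clog h1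
  have := ((differentiableAt_id (𝕜 := ℂ) (x := z)).add_const (p : ℂ)).clog h2
  simp only [id] at *
  fun_prop

theorem analyticOnNhd_meixnerE₀ {p ε : ℝ} (hp : 0 < p) :
    AnalyticOnNhd ℂ (meixnerE₀ p) (sectorStrip ε) := by
  refine DifferentiableOn.analyticOnNhd (fun z hz => ?_) (isOpen_sectorStrip ε)
  have hre := re_pos_of_mem_sectorStrip hz
  have h1 : z ∈ Complex.slitPlane := Or.inl hre
  have h2 : z + p ∈ Complex.slitPlane := Or.inl (by simp; linarith)
  unfold meixnerE₀
  apply DifferentiableAt.differentiableWithinAt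
  have := (differentiableAt_id (𝕜 := ℂ) (x := z)).clog h1
  have := ((differentiableAt_id (𝕜 := ℂ) (x := z)).add_const (p : ℂ)).clog h2
  simp only [id] at *
  fun_prop

theorem meixnerVc_ofReal {p β x : ℝ} (hp : 0 < p) (hβ : 0 < β) (hx : 0 < x) :
    meixnerVc p β x = (meixnerField (p + 1) β x : ℂ) := by
  rw [meixnerField_eq hp hβ hx.le, meixnerVc, ← Complex.ofReal_add, ← Complex.ofReal_log hx.le,
    ← Complex.ofReal_log (by positivity)]
  push_cast; ring

theorem norm_meixnerVc_le {p β : ℝ} (hp : 0 < p) {z : ℂ} (hz : 0 < z.re) (h1 : ‖z‖ < 1) :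
    ‖meixnerVc p β z‖ ≤ 3 + |Real.log β| + (1 + p) * (3 + p + 1 / p) + p * |Real.log p| := by
  have h0 : 0 < ‖z‖ := norm_pos_iff.2 (by rintro rfl; simp at hz)
  have a1 : ‖z * Complex.log z‖ ≤ 3 := by
    rw [norm_mul]
    have := norm_log_le_of_re_pos hz
    have h := (Real.abs_log_mul_self_lt ‖z‖ h0 h1.le).le
    rw [abs_mul, abs_of_pos h0] at h
    nlinarith
  have a2 : ‖Complex.log (z + p)‖ ≤ 3 + p + 1 / p := by
    have := norm_log_le_of_le_re hp (w := z + p) (by simp; linarith)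
    have h2 := norm_add_le z (p : ℂ)
    rw [Complex.norm_real, Real.norm_of_nonneg hp.le] at h2
    linarith
  have e : meixnerVc p β z = z * Complex.log z - z * (Real.log β : ℝ)
      - (z + p) * Complex.log (z + p) + p * (Real.log p : ℝ) := by
    unfold meixnerVc; ring
  rw [e]
  have b2 : ‖z * (Real.log β : ℝ)‖ ≤ |Real.log β| := by
    rw [norm_mul, Complex.norm_real, Real.norm_eq_abs]
    nlinarith [abs_nonneg (Real.log β)]
  have b3 : ‖(z + p) * Complex.log (z + p)‖ ≤ (1 + p) * (3 + p + 1 / p) := by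
    rw [norm_mul]
    have h2 := norm_add_le z (p : ℂ)
    rw [Complex.norm_real, Real.norm_of_nonneg hp.le] at h2
    gcongr; linarith
  have b4 : ‖(p : ℂ) * (Real.log p : ℝ)‖ = p * |Real.log p| := by
    rw [norm_mul, Complex.norm_real, Complex.norm_real, Real.norm_of_nonneg hp.le,
      Real.norm_eq_abs]
  have := norm_add_le (z * Complex.log z - z * (Real.log β : ℝ)
      - (z + p) * Complex.log (z + p)) (p * (Real.log p : ℝ))
  have := norm_sub_le (z * Complex.log z - z * (Real.log β : ℝ)) ((z + p) * Complex.log (z + p))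
  have := norm_sub_le (z * Complex.log z) (z * (Real.log β : ℝ))
  linarith

/-- A single bound covers both regimes: away from `0` the term `‖z‖` dominates, near `0` the
logarithm. The factor `N` from the chain rule is absorbed by the scale-invariant form `‖w‖ * ‖deriv
stirlingMu w‖` of the derivative estimate. -/
theorem exists_meixnerE_bound {p ε M : ℝ} (hp : 0 < p) (hM : 0 < M)
    (hD : ∀ N : ℕ, 0 < N → ∀ z ∈ sectorStrip ε,
      p / 2 ≤ (shiftFactor p N z).re ∧ ‖shiftFactor p N z‖ ≤ ‖z‖ + M ∧
      ‖deriv (shiftFactor p N) z‖ ≤ M) :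
    ∃ K > 0, ∀ N : ℕ, 0 < N → ∀ z ∈ sectorStrip ε,
      ‖meixnerE p N z‖ ≤ K * (1 + |Real.log ‖z‖| + ‖z‖) ∧
      ‖z‖ * ‖deriv (meixnerE p N) z‖ ≤ K * (1 + |Real.log ‖z‖| + ‖z‖) := by
  refine ⟨5000 * (1 + |Real.log p|) + p + 1 / p + 2 / p + M + M * (2 / p), by positivity,
    fun N hN z hz => ?_⟩
  obtain ⟨d1, d2, d3⟩ := hD N hN z hz
  have hN1 : (1 : ℝ) ≤ N := by exact_mod_cast hN
  have hre := re_pos_of_mem_sectorStrip hz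
  have hz0 : z ≠ 0 := by rintro rfl; simp at hre
  have hn : 0 < ‖z‖ := norm_pos_iff.2 hz0
  have hzp := abs_im_lt_re_add hp hz.1
  have h1 := abs_im_lt_re_mul hN hz.1
  have h2 := abs_im_lt_re_mul hN hzp
  have hpos : ∀ {w : ℂ}, |w.im| < w.re → 0 < w.re := fun h => (abs_nonneg _).trans_lt h
  obtain ⟨n1, n2⟩ := le_norm_add hp hre
  set l := |Real.log ‖z‖| with hl
  have l0 : 0 ≤ l := abs_nonneg _
  have lp0 : 0 ≤ |Real.log p| := abs_nonneg _
  have m1 : max 0 (-Real.log ‖(N : ℂ) * z‖) ≤ l := by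
    apply max_le l0
    have : Real.log ‖z‖ ≤ Real.log ‖(N : ℂ) * z‖ := by
      apply Real.log_le_log hn
      rw [norm_mul, Complex.norm_natCast]; nlinarith
    have := neg_abs_le (Real.log ‖z‖)
    linarith
  have m2 : max 0 (-Real.log ‖(N : ℂ) * (z + p)‖) ≤ |Real.log p| := by
    apply max_le lp0
    have : Real.log p ≤ Real.log ‖(N : ℂ) * (z + p)‖ := by
      apply Real.log_le_log hp
      rw [norm_mul, Complex.norm_natCast]; nlinarith
    have := neg_abs_le (Real.log p)
    linarith
  have ip : 0 < 1 / p := by positivity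
  have e2p : 2 / p = 1 / (p / 2) := by field_simp
  have e2p' : 1 / p ≤ 2 / p := by gcongr; norm_num
  have hMp : 0 < M * (2 / p) := by positivity
  constructor
  · have b1 : ‖1 / 2 * Complex.log z‖ ≤ l + 2 := by
      rw [norm_mul]; norm_num
      have := norm_log_le_of_re_pos hre
      have := norm_nonneg (Complex.log z)
      linarith
    have b2 : ‖1 / 2 * Complex.log (z + p)‖ ≤ ‖z‖ + p + 1 / p + 2 := by
      have := norm_log_le_of_le_re hp (w := z + p) (by simp; linarith)
      have h2 := norm_add_le z (p : ℂ)
      rw [Complex.norm_real, Real.norm_of_nonneg hp.le] at h2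
      have := norm_nonneg (Complex.log (z + p))
      rw [norm_mul, show ‖(1 / 2 : ℂ)‖ = 1 / 2 by norm_num]
      linarith
    have b3 := norm_stirlingMu_le_log (hpos h1)
    have b4 := norm_stirlingMu_le_log (hpos h2)
    have b5 := norm_log_le_of_le_re (half_pos hp) d1
    rw [← e2p] at b5
    have t1 := norm_sub_le (1 / 2 * Complex.log z - 1 / 2 * Complex.log (z + p)
      + stirlingMu (N * (z + p)) - stirlingMu (N * z)) (Complex.log (shiftFactor p N z))
    have t2 := norm_sub_le (1 / 2 * Complex.log z - 1 / 2 * Complex.log (z + p)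
      + stirlingMu (N * (z + p))) (stirlingMu (N * z))
    have t3 := norm_add_le (1 / 2 * Complex.log z - 1 / 2 * Complex.log (z + p))
      (stirlingMu (N * (z + p)))
    have t4 := norm_sub_le (1 / 2 * Complex.log z) (1 / 2 * Complex.log (z + p))
    have tot : ‖meixnerE p N z‖ ≤ 591 * l + 590 * |Real.log p| + 2 * ‖z‖ + 1190 + p + 1 / p
        + 2 / p + M := by
      unfold meixnerE; linarith
    refine tot.trans ?_
    have : 0 ≤ (p + 1 / p + 2 / p + M + M * (2 / p)) * (l + ‖z‖) := by positivity
    have : 0 ≤ |Real.log p| * (l + ‖z‖) := by positivity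
    nlinarith
  · rw [(hasDerivAt_meixnerE hp hN hz.1 (by linarith)).deriv]
    have b1 : ‖z‖ * ‖1 / 2 * (1 / z)‖ ≤ 1 := by
      rw [norm_mul, norm_div, norm_one]; norm_num; field_simp; norm_num
    have b2 : ‖z‖ * ‖1 / 2 * (1 / (z + p))‖ ≤ 1 := by
      rw [norm_mul, show ‖(1 / 2 : ℂ)‖ = 1 / 2 by norm_num]
      have : ‖z‖ * ‖1 / (z + p)‖ ≤ 1 := by
        rw [norm_div, norm_one, mul_one_div, div_le_one (by linarith)]; exact n2
      linarith
    have b3 : ‖z‖ * ‖deriv stirlingMu (N * (z + p)) * N‖ ≤ 2360 * (1 + |Real.log p|) := by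
      have := norm_deriv_stirlingMu_le h2
      calc ‖z‖ * ‖deriv stirlingMu (N * (z + p)) * N‖
          ≤ ‖z + p‖ * ‖deriv stirlingMu (N * (z + p)) * N‖ := by gcongr
        _ = ‖(N : ℂ) * (z + p)‖ * ‖deriv stirlingMu (N * (z + p))‖ := by
          rw [norm_mul, norm_mul]; ring
        _ ≤ _ := this.trans (by gcongr)
    have b4 : ‖z‖ * ‖deriv stirlingMu (N * z) * N‖ ≤ 2360 * (1 + l) := by
      have := norm_deriv_stirlingMu_le h1
      calc ‖z‖ * ‖deriv stirlingMu (N * z) * N‖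
          = ‖(N : ℂ) * z‖ * ‖deriv stirlingMu (N * z)‖ := by
            rw [norm_mul, norm_mul]; ring
        _ ≤ _ := this.trans (by gcongr)
    have b5 : ‖z‖ * ‖deriv (shiftFactor p N) z / shiftFactor p N z‖ ≤ ‖z‖ * (M * (2 / p)) := by
      gcongr
      rw [norm_div]
      have : p / 2 ≤ ‖shiftFactor p N z‖ := d1.trans (Complex.re_le_norm _)
      rw [div_le_iff₀ (by linarith)]
      have e : M * (2 / p) * (p / 2) = M := by field_simp
      calc _ ≤ M := d3
        _ = M * (2 / p) * (p / 2) := e.symm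
        _ ≤ _ := by gcongr
    set A := 1 / 2 * (1 / z)
    set B := 1 / 2 * (1 / (z + p))
    set C := deriv stirlingMu (N * (z + p)) * N
    set D := deriv stirlingMu (N * z) * N
    set F := deriv (shiftFactor p N) z / shiftFactor p N z
    have t : ‖A - B + C - D - F‖ ≤ ‖A‖ + ‖B‖ + ‖C‖ + ‖D‖ + ‖F‖ := by
      have := norm_sub_le (A - B + C - D) F
      have := norm_sub_le (A - B + C) D
      have := norm_add_le (A - B) C
      have := norm_sub_le A B
      linarith
    have t' := mul_le_mul_of_nonneg_left t hn.le
    have tot : ‖z‖ * ‖A - B + C - D - F‖ ≤ 2 + 2360 * (1 + |Real.log p|) + 2360 * (1 + l)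
        + ‖z‖ * (M * (2 / p)) := by linarith
    refine tot.trans ?_
    have h8 : 0 ≤ (p + 1 / p + 2 / p + M) * (1 + l + ‖z‖) := by positivity
    have h9 : 0 ≤ (M * (2 / p)) * (1 + l) := by positivity
    have h10 : 0 ≤ |Real.log p| * (l + ‖z‖) := by positivity
    nlinarith

theorem meixnerE_im {p : ℝ} (hp : 0 < p) {N : ℕ} (hN : 0 < N) {x : ℝ} (hx : 0 < x)
    (hD : 0 < (shiftFactor p N x).re) : (meixnerE p N x).im = 0 := by
  have hN' : (0 : ℝ) < N := by exact_mod_cast hN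
  have e0 : shiftFactor p N x = (((shiftFactor p N x).re : ℝ) : ℂ) :=
    Complex.ext rfl (by rw [shiftFactor_im hN hx, Complex.ofReal_im])
  have e1 : (N : ℂ) * (x + p) = ((N * (x + p) : ℝ) : ℂ) := by push_cast; rfl
  have e2 : (N : ℂ) * x = ((N * x : ℝ) : ℂ) := by push_cast; rfl
  have m1 := stirlingMu_real (x := N * (x + p)) (by positivity)
  have m2 := stirlingMu_real (x := N * x) (by positivity)
  rw [meixnerE, e0, e1, e2, ← Complex.ofReal_add, ← Complex.ofReal_log hx.le,
    ← Complex.ofReal_log (by positivity), ← Complex.ofReal_log hD.le]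
  have c : (1 / 2 : ℂ) = ((1 / 2 : ℝ) : ℂ) := by push_cast; rfl
  rw [c, ← Complex.ofReal_mul, ← Complex.ofReal_mul]
  simp only [Complex.sub_im, Complex.add_im, Complex.ofReal_im, m1, m2]
  norm_num

/-! ### The exact decomposition on the lattice and the convergence of the corrections. -/

theorem meixnerE_lattice_re {p : ℝ} (hp : 0 < p) {N k : ℕ} (hN : 0 < N) (hk : 0 < k) :
    (meixnerE p N ((k / N : ℝ) : ℂ)).re = 1 / 2 * Real.log (k / N)
      - 1 / 2 * Real.log (k / N + p) + (stirlingMu ((p * N + k : ℝ) : ℂ)).re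
      - (stirlingMu ((k : ℝ) : ℂ)).re - Real.log ((p * N + k - 1) / N) := by
  have hN' : (0 : ℝ) < N := by exact_mod_cast hN
  have hk' : (1 : ℝ) ≤ k := by exact_mod_cast hk
  have hx : (0 : ℝ) < k / N := by positivity
  have hD : (0 : ℝ) ≤ (p * N + k - 1) / N := by
    have : 0 < p * N := by positivity
    apply div_nonneg _ hN'.le; linarith
  have hNc : (N : ℂ) ≠ 0 := by exact_mod_cast hN.ne'
  have e1 : (N : ℂ) * (((k / N : ℝ) : ℂ) + p) = ((p * N + k : ℝ) : ℂ) := by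
    push_cast; field_simp; ring
  have e2 : (N : ℂ) * ((k / N : ℝ) : ℂ) = ((k : ℝ) : ℂ) := by push_cast; field_simp
  rw [meixnerE, shiftFactor_lattice hN hk, e1, e2, ← Complex.ofReal_add,
    ← Complex.ofReal_log hx.le, ← Complex.ofReal_log (by positivity), ← Complex.ofReal_log hD]
  have c : (1 / 2 : ℂ) = ((1 / 2 : ℝ) : ℂ) := by push_cast; rfl
  rw [c, ← Complex.ofReal_mul, ← Complex.ofReal_mul]
  simp only [Complex.sub_re, Complex.add_re, Complex.ofReal_re]

theorem exists_decomposition {p β : ℝ} (hp : 0 < p) (hβ : 0 < β) {N : ℕ} (hN : 0 < N) :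
    ∃ C : ℝ, ∀ x ∈ lattice N, rescaledWeight N (meixnerWeight (p * N) β) x
      = Real.exp (-(N * meixnerField (p + 1) β x) - 2 * C + (meixnerE p N (x : ℂ)).re) := by
  have hN' : (0 : ℝ) < N := by exact_mod_cast hN
  have hs : 0 < p * N := by positivity
  -- `K` collects the factors independent of the lattice point, among them the two periodic ratios
  -- `Γ / stirlingF`, based at `p N` and at `1`.
  set K : ℝ := 1 / N * (Real.Gamma (p * N) / stirlingF (p * N))
    / (Real.Gamma 1 / stirlingF 1 * Real.Gamma (p * N) * β) with hK
  have hK0 : 0 < K := by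
    have := Real.Gamma_pos_of_pos hs
    have := stirlingF_pos (p * N)
    have := stirlingF_pos 1
    have := Real.Gamma_pos_of_pos one_pos
    positivity
  -- The summands besides `log K` come from rescaling `p N + k = N (x + p)` and `k = N x` in the
  -- Stirling exponents, from the division by `N` in the shift factor, and from the term `p log p`
  -- in the field.
  refine ⟨-(Real.log K + N * p * Real.log N - N * p - Real.log N + N * p * Real.log p) / 2, ?_⟩
  rintro x ⟨k, hk, rfl⟩
  have hk' : (1 : ℝ) ≤ k := by exact_mod_cast hk
  have hk0 : (0 : ℝ) < k := by linarith
  have hx : (0 : ℝ) < k / N := by positivity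
  have hm : 0 < p * N + k - 1 := by linarith
  have hY : 0 < p * N + k := by linarith
  have hxp : (0 : ℝ) < k / N + p := by positivity
  rw [meixnerE_lattice_re hp hN hk, meixnerField_eq hp hβ hx.le]
  have g1 : Real.Gamma (p * N + k - 1) = Real.Gamma (p * N) / stirlingF (p * N)
      * stirlingF (p * N + k) / (p * N + k - 1) := by
    rw [← Gamma_add_natCast_div_stirlingF hs, eq_div_iff hm.ne', mul_comm,
      ← Real.Gamma_add_one hm.ne']
    congr 1; ring
  have g2 : Real.Gamma k = Real.Gamma 1 / stirlingF 1 * stirlingF k := by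
    have := Gamma_add_natCast_div_stirlingF one_pos (k - 1)
    rwa [Nat.cast_sub hk, Nat.cast_one, add_sub_cancel] at this
  have hb : β ^ ((k : ℝ) - 1) = Real.exp (k * Real.log β) / β := by
    rw [Real.rpow_sub_one hβ.ne', Real.rpow_def_of_pos hβ, mul_comm]
  have eW : rescaledWeight N (meixnerWeight (p * N) β) (k / N)
      = K * (stirlingF (p * N + k) / stirlingF k * Real.exp (k * Real.log β)
        / (p * N + k - 1)) := by
    have h1 := (Real.Gamma_pos_of_pos hs).ne'
    have h2 := (stirlingF_pos (p * N)).ne'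
    have h3 := (stirlingF_pos 1).ne'
    have h4 := (stirlingF_pos k).ne'
    have h5 := hm.ne'
    rw [rescaledWeight, mul_div_cancel₀ _ hN'.ne', meixnerWeight, g1, g2, hb, hK, Real.Gamma_one]
    field_simp
  have lY : Real.log (p * N + k) = Real.log N + Real.log (k / N + p) := by
    rw [← Real.log_mul hN'.ne' hxp.ne']; congr 1; field_simp; ring
  have lx : Real.log (k / N) = Real.log k - Real.log N := Real.log_div hk0.ne' hN'.ne'
  have lm : Real.log ((p * N + k - 1) / N) = Real.log (p * N + k - 1) - Real.log N :=
    Real.log_div hm.ne' hN'.ne'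
  have em : (p * N + k - 1) = Real.exp (Real.log (p * N + k - 1)) := (Real.exp_log hm).symm
  have eK : K = Real.exp (Real.log K) := (Real.exp_log hK0).symm
  have ekN : (N : ℝ) * (k / N) = k := by field_simp
  rw [eW, stirlingF, stirlingF]
  conv_lhs => rw [eK, em]
  rw [← Real.exp_sub, ← Real.exp_add, ← Real.exp_sub, ← Real.exp_add, lY, lx, lm]
  congr 1
  field_simp
  ring

/-- Once `p N > 2` the sinc term is absent. The error consists of two Stirling corrections at
distances at least `pN` and `rN` from `0`, and the increment of the logarithm over a step `1/N` in
the half-plane `Re ≥ p/2`. -/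
theorem meixnerE_sub_le {p ε : ℝ} (hp : 0 < p) {r : ℝ} (hr : 0 < r) {N : ℕ}
    (h1 : 2 < p * N) (h2 : 1 ≤ N * r) {z : ℂ} (hz : z ∈ sectorStrip ε) (hzr : r ≤ ‖z‖) :
    ‖meixnerE p N z - meixnerE₀ p z‖ ≤ (576 / p + 576 / r + 2 / p) / N := by
  have hN' : (0 : ℝ) < N := by
    rcases Nat.eq_zero_or_pos N with rfl | h
    · simp at h1; linarith
    · exact_mod_cast h
  have hN : 0 < N := by exact_mod_cast hN'
  have hre := re_pos_of_mem_sectorStrip hz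
  have hpos : ∀ {w : ℂ}, |w.im| < w.re → 0 < w.re := fun h => (abs_nonneg _).trans_lt h
  have k1 := hpos (abs_im_lt_re_mul hN hz.1)
  have k2 := hpos (abs_im_lt_re_mul hN (abs_im_lt_re_add hp hz.1))
  obtain ⟨n1, -⟩ := le_norm_add hp hre
  have e : meixnerE p N z - meixnerE₀ p z = stirlingMu (N * (z + p)) - stirlingMu (N * z)
      - (Complex.log (z + p - 1 / N) - Complex.log (z + p)) := by
    simp only [meixnerE, meixnerE₀, shiftFactor, if_pos h1, add_zero]; ring
  have b1 : ‖stirlingMu (N * (z + p))‖ ≤ 576 / p / N := by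
    have hn : p * N ≤ ‖(N : ℂ) * (z + p)‖ := by
      rw [norm_mul, Complex.norm_natCast, mul_comm]; gcongr
    refine (norm_stirlingMu_le k2 (by linarith)).trans ?_
    rw [div_div]; gcongr
  have b2 : ‖stirlingMu (N * z)‖ ≤ 576 / r / N := by
    have hn : r * N ≤ ‖(N : ℂ) * z‖ := by
      rw [norm_mul, Complex.norm_natCast, mul_comm]; gcongr
    refine (norm_stirlingMu_le k1 (by linarith)).trans ?_
    rw [div_div]; gcongr
  have b3 : ‖Complex.log (z + p - 1 / N) - Complex.log (z + p)‖ ≤ 2 / p / N := by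
    have hconv : Convex ℝ {w : ℂ | p / 2 ≤ w.re} := by
      have : {w : ℂ | p / 2 ≤ w.re} = Complex.reLm ⁻¹' (Ici (p / 2)) := by ext w; simp
      rw [this]; exact (convex_Ici _).linear_preimage _
    have hNre : (1 / N : ℂ).re = 1 / N := by
      rw [show (1 / N : ℂ) = ((1 / N : ℝ) : ℂ) by push_cast; rfl, Complex.ofReal_re]
    have hNp : 1 / (N : ℝ) ≤ p / 2 := by rw [div_le_div_iff₀ hN' two_pos]; linarith
    have hm1 : z + p - 1 / N ∈ {w : ℂ | p / 2 ≤ w.re} := by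
      change p / 2 ≤ (z + p - 1 / N).re
      rw [Complex.sub_re, hNre, Complex.add_re, Complex.ofReal_re]; linarith
    have hm2 : z + p ∈ {w : ℂ | p / 2 ≤ w.re} := by
      change p / 2 ≤ (z + p).re
      rw [Complex.add_re, Complex.ofReal_re]; linarith
    have := hconv.norm_image_sub_le_of_norm_hasDerivWithin_le (𝕜 := ℂ) (f := Complex.log)
      (f' := fun w => w⁻¹) (C := 2 / p)
      (fun w (hw : p / 2 ≤ w.re) => (Complex.hasDerivAt_log (Or.inl
        ((half_pos hp).trans_le hw))).hasDerivWithinAt)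
      (fun w (hw : p / 2 ≤ w.re) => by
        have := hw.trans (Complex.re_le_norm w)
        rw [norm_inv, show 2 / p = (p / 2)⁻¹ by field_simp]
        exact inv_anti₀ (half_pos hp) this) hm2 hm1
    refine this.trans (le_of_eq ?_)
    rw [show z + (p : ℂ) - 1 / N - (z + p) = -(1 / N) by ring, norm_neg, norm_div, norm_one,
      Complex.norm_natCast, mul_one_div]
  rw [e]
  have t1 := norm_sub_le (stirlingMu (N * (z + p)) - stirlingMu (N * z))
    (Complex.log (z + p - 1 / N) - Complex.log (z + p))
  have t2 := norm_sub_le (stirlingMu (N * (z + p))) (stirlingMu (N * z))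
  rw [add_div, add_div]
  linarith

theorem weightAssumption_meixner {p β : ℝ} (hp : 0 < p) (hβ : 0 < β) (hβ1 : β < 1) :
    WeightAssumption (fun N => meixnerWeight (p * N) β) (meixnerField (p + 1) β) := by
  obtain ⟨ε, hε, M, hM, hD⟩ := exists_shiftFactor_bounds hp
  obtain ⟨K, hK, hE⟩ := exists_meixnerE_bound hp hM hD
  have hC : ∀ N : ℕ, ∃ C : ℝ, 0 < N → ∀ x ∈ lattice N,
      rescaledWeight N (meixnerWeight (p * N) β) x
      = Real.exp (-(N * meixnerField (p + 1) β x) - 2 * C + (meixnerE p N (x : ℂ)).re) := by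
    intro N
    rcases Nat.eq_zero_or_pos N with rfl | hN
    · exact ⟨0, fun h => absurd h (lt_irrefl _)⟩
    · obtain ⟨C, h⟩ := exists_decomposition hp hβ hN
      exact ⟨C, fun _ => h⟩
  choose C hC using hC
  have hpos : ∀ x : ℝ, 0 < x → (x : ℂ) ∈ sectorStrip ε := fun x hx =>
    ⟨by simpa using hx, by simpa using hε⟩
  refine ⟨sectorStrip ε, meixnerVc p β, meixnerE p, meixnerE₀ p, C, ?_⟩
  refine
    { isOpen_U := isOpen_sectorStrip ε
      pos_mem_U := hpos
      decomposition := hC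
      V_continuousOn := continuousOn_meixnerField hp hβ
      Vc_analytic := analyticOnNhd_meixnerVc hp
      Vc_eq := fun x hx => meixnerVc_ofReal hp hβ hx
      V_bounded_at_zero := ⟨1, one_pos, _, fun z hz h1 =>
        norm_meixnerVc_le hp (re_pos_of_mem_sectorStrip hz) h1⟩
      V_growth := ?_
      E_analytic := fun N hN => ?_
      E_real := fun N hN x hx => ?_
      E₀_analytic := analyticOnNhd_meixnerE₀ hp
      E_convergence := fun S hS hSU => ?_
      E_bound := fun δ hδ => ?_
      E_bound_at_zero := ?_ }
  · have h := (continuous_coe_real_ereal.tendsto _).comp (tendsto_meixnerField_div hp hβ)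
    have h' := h.liminf_eq
    simp only [Function.comp_def] at h'
    rw [h']
    exact_mod_cast neg_pos.2 (Real.log_neg hβ hβ1)
  · refine DifferentiableOn.analyticOnNhd (fun z hz => ?_) (isOpen_sectorStrip ε)
    have := (hD N hN z hz).1
    exact (hasDerivAt_meixnerE hp hN hz.1 (by linarith)).differentiableAt.differentiableWithinAt
  · have := (hD N hN x (hpos x hx)).1
    exact meixnerE_im hp hN hx (by linarith)
  -- A compact subset of the domain has positive distance `r` from the origin, where the corrections
  -- are singular.
  · have h0 : (0 : ℂ) ∈ Sᶜ := fun h => by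
      have := re_pos_of_mem_sectorStrip (hSU h); simp at this
    obtain ⟨r, hr, hball⟩ := Metric.isOpen_iff.1 hS.isClosed.isOpen_compl 0 h0
    refine ⟨576 / p + 576 / r + 2 / p, ?_⟩
    have t1 : ∀ᶠ N : ℕ in atTop, 2 < p * N :=
      (tendsto_natCast_atTop_atTop.const_mul_atTop hp).eventually_gt_atTop 2
    have t2 : ∀ᶠ N : ℕ in atTop, 1 ≤ N * r :=
      (tendsto_natCast_atTop_atTop.atTop_mul_const hr).eventually_ge_atTop 1
    filter_upwards [t1, t2] with N h1 h2 z hz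
    refine meixnerE_sub_le hp hr h1 h2 (hSU hz) ?_
    by_contra! hlt
    exact hball (by simpa using hlt) hz
  · have hA : ∀ z : ℂ, δ ≤ ‖z‖ → 1 + |Real.log ‖z‖| + ‖z‖ ≤ (3 + 2 / δ ^ 2 + 1 / δ) * ‖z‖ := by
      intro z hz
      have hz0 : 0 < ‖z‖ := hδ.trans_le hz
      have a := Real.log_le_sub_one_of_pos hz0
      have b := Real.log_le_sub_one_of_pos (one_div_pos.2 hδ)
      rw [one_div, Real.log_inv, ← one_div] at b
      have c := Real.log_le_log hδ hz
      have hd := one_div_pos.2 hδ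
      have hl : |Real.log ‖z‖| ≤ ‖z‖ + 1 / δ := by rw [abs_le]; constructor <;> linarith
      have h1 : 1 ≤ 1 / δ * ‖z‖ := by rw [one_div, inv_mul_eq_div, le_div_iff₀ hδ]; linarith
      have h2 : 1 / δ ≤ 2 / δ ^ 2 * ‖z‖ := by
        rw [div_mul_eq_mul_div, div_le_div_iff₀ hδ (by positivity)]
        nlinarith
      nlinarith
    refine ⟨K * (3 + 2 / δ ^ 2 + 1 / δ) * (1 + 1 / δ), by positivity, ?_⟩
    intro N hN R z hz h1 h2
    have hz0 : 0 < ‖z‖ := hδ.trans_le h1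
    obtain ⟨e1, e2⟩ := hE N hN z hz
    have hB := hA z h1
    set B := 3 + 2 / δ ^ 2 + 1 / δ
    have hB0 : 0 < B := by positivity
    have f1 : ‖meixnerE p N z‖ ≤ K * B * ‖z‖ := by
      rw [mul_assoc]; exact e1.trans (by gcongr)
    have f2 : ‖deriv (meixnerE p N) z‖ ≤ K * B := by
      have : ‖z‖ * ‖deriv (meixnerE p N) z‖ ≤ ‖z‖ * (K * B) := by
        refine e2.trans ?_
        calc _ ≤ K * (B * ‖z‖) := by gcongr
          _ = _ := by ring
      exact le_of_mul_le_mul_left this hz0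
    have f3 : K * B ≤ K * B * (1 / δ) * ‖z‖ := by
      have h1 : 1 ≤ 1 / δ * ‖z‖ := by rw [one_div, inv_mul_eq_div, le_div_iff₀ hδ]; linarith
      rw [mul_assoc]
      exact le_mul_of_one_le_right (by positivity) h1
    calc _ ≤ K * B * ‖z‖ + K * B * (1 / δ) * ‖z‖ := by linarith
      _ = K * B * (1 + 1 / δ) * ‖z‖ := by ring
      _ ≤ _ := by gcongr
  · refine ⟨4 * K, by positivity, fun N hN z hz h0 h1 => ?_⟩
    obtain ⟨e1, e2⟩ := hE N hN z hz
    have := abs_nonneg (Real.log ‖z‖)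
    nlinarith

/-! ### Admissible measures are dominated by Lebesgue measure -/

theorem IsAdmissible.measure_zero {μ : Measure ℝ} (h : IsAdmissible μ) : μ {0} = 0 := by
  refine le_antisymm (ENNReal.le_of_forall_pos_le_add fun ε hε _ => ?_) zero_le
  have h1 := h.upper_constraint 0 ε le_rfl (by exact_mod_cast hε)
  rw [sub_zero, ENNReal.ofReal_coe_nnreal] at h1
  rw [zero_add]
  refine (measure_mono ?_).trans h1
  rintro x rfl
  exact ⟨le_rfl, ε.2⟩

theorem IsAdmissible.measure_Iic_zero {μ : Measure ℝ} (h : IsAdmissible μ) : μ (Iic 0) = 0 := by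
  rw [← Iio_union_right]
  exact measure_union_null h.nonneg h.measure_zero

/-- Half-open intervals generate Lebesgue outer measure by coverings, so the constraint on intervals
passes to all sets; the part on the negative axis is null. -/
theorem IsAdmissible.le_volume {μ : Measure ℝ} (h : IsAdmissible μ) : μ ≤ volume := by
  have key : ∀ a b : ℝ, μ (Ioc a b) ≤ ENNReal.ofReal (b - a) := by
    intro a b
    rcases le_or_gt b (max a 0) with hb | hb
    · rcases le_max_iff.1 hb with hb | hb
      · simp [Ioc_eq_empty (not_lt.2 hb)]
      · rw [measure_mono_null (fun x hx => hx.2.trans hb) h.measure_Iic_zero]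
        exact zero_le
    · have hsub : Ioc a b ⊆ Iio 0 ∪ Icc (max a 0) b := by
        intro x hx
        rcases lt_or_ge x 0 with h0 | h0
        · exact Or.inl h0
        · exact Or.inr ⟨max_le hx.1.le h0, hx.2⟩
      calc μ (Ioc a b) ≤ μ (Iio 0) + μ (Icc (max a 0) b) :=
            (measure_mono hsub).trans (measure_union_le _ _)
        _ ≤ 0 + ENNReal.ofReal (b - max a 0) := by
            gcongr
            · exact h.nonneg.le
            · exact h.upper_constraint _ _ (le_max_right _ _) hb
        _ ≤ _ := by
            rw [zero_add]
            apply ENNReal.ofReal_le_ofReal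
            linarith [le_max_left a 0]
  have h2 : μ.toOuterMeasure ≤ StieltjesFunction.id.outer := by
    rw [StieltjesFunction.outer, OuterMeasure.le_ofFunction]
    intro s
    rw [StieltjesFunction.length_eq]
    refine le_iInf fun a => le_iInf fun b => le_iInf fun hs => ?_
    -- The line has no least element, so the exceptional set `botSet` in the length function is
    -- empty.
    have hs' : s ⊆ Ioc a b := by
      intro x hx
      refine hs ⟨hx, fun hb => ?_⟩
      simp [botSet] at hb
    exact (measure_mono hs').trans (key a b)
  rw [Real.volume_eq_stieltjes_id, Measure.le_iff]
  intro s hs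
  rw [StieltjesFunction.measure]
  exact h2 s

/-! ### Integrability of the logarithmic kernel -/

/-- The singular part of the logarithm. -/
noncomputable def logSing (t : ℝ) : ℝ := (Ioo (-1 : ℝ) 1).indicator Real.log t

theorem integrable_logSing : Integrable logSing := by
  unfold logSing
  rw [integrable_indicator_iff measurableSet_Ioo]
  have := (intervalIntegral.intervalIntegrable_log' (a := -1) (b := 1)).1
  exact this.mono_set Ioo_subset_Ioc_self

theorem measurable_logSing : Measurable logSing :=
  Real.measurable_log.indicator measurableSet_Ioo

/-- The singular part is Lebesgue integrable, hence integrable for every measure dominated by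
Lebesgue measure; the linear part needs only a first moment. -/
theorem abs_log_le_abs_add (t : ℝ) : |Real.log (|t|)| ≤ |t| + |logSing t| := by
  rw [Real.log_abs]
  by_cases h : t ∈ Ioo (-1 : ℝ) 1
  · rw [logSing, indicator_of_mem h]; linarith [abs_nonneg t]
  · have h1 : 1 ≤ |t| := by
      by_contra! hc
      exact h (abs_lt.1 hc)
    rw [logSing, indicator_of_notMem h, abs_zero, add_zero, ← Real.log_abs,
      abs_of_nonneg (Real.log_nonneg h1)]
    linarith [Real.log_le_sub_one_of_pos (show 0 < |t| by linarith)]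

theorem measurable_log_one_div_sub : Measurable fun p : ℝ × ℝ => Real.log (1 / |p.1 - p.2|) :=
  Real.measurable_log.comp
    (measurable_const.div (continuous_abs.measurable.comp (measurable_fst.sub measurable_snd)))

theorem log_one_div_abs (t : ℝ) : Real.log (1 / |t|) = -Real.log |t| := by
  rw [one_div, Real.log_inv]

theorem integrable_log_sub {ν : Measure ℝ} (hν : ν ≤ volume) [IsFiniteMeasure ν]
    (hm : Integrable (fun y => y) ν) (x : ℝ) :
    Integrable (fun y => Real.log (1 / |x - y|)) ν := by
  have h1 : Integrable (fun y => |x - y| + |logSing (x - y)|) ν := by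
    refine ((integrable_const x).sub hm).abs.add ?_
    exact (((integrable_logSing.comp_sub_left x)).abs).mono_measure hν
  refine h1.mono' (measurable_log_one_div_sub.comp
    (measurable_const.prodMk measurable_id)).aestronglyMeasurable (ae_of_all _ fun y => ?_)
  rw [log_one_div_abs, norm_neg, Real.norm_eq_abs]
  exact abs_log_le_abs_add _

theorem integrable_logSing_prod {μ ν : Measure ℝ} [IsFiniteMeasure μ] [IsFiniteMeasure ν]
    (hν : ν ≤ volume) : Integrable (fun p : ℝ × ℝ => logSing (p.1 - p.2)) (μ.prod ν) := by
  refine Integrable.mono_measure ?_ (Measure.prod_mono le_rfl hν)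
  have hmeas : Measurable (fun p : ℝ × ℝ => logSing (p.1 - p.2)) :=
    measurable_logSing.comp (measurable_fst.sub measurable_snd)
  refine ⟨hmeas.aestronglyMeasurable, ?_⟩
  rw [hasFiniteIntegral_iff_enorm, lintegral_prod _ hmeas.enorm.aemeasurable]
  have : ∀ x : ℝ, ∫⁻ y, ‖logSing (x - y)‖ₑ = ∫⁻ y, ‖logSing y‖ₑ := fun x =>
    lintegral_sub_left_eq_self (fun y => ‖logSing y‖ₑ) x
  simp_rw [this]
  rw [lintegral_const]
  exact ENNReal.mul_lt_top integrable_logSing.2 (measure_lt_top _ _)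

theorem integrable_abs_log_prod {μ ν : Measure ℝ} [IsFiniteMeasure μ] [IsFiniteMeasure ν]
    (hν : ν ≤ volume) (h1 : Integrable (fun x => x) μ) (h2 : Integrable (fun x => x) ν) :
    Integrable (fun p : ℝ × ℝ => |Real.log (|p.1 - p.2|)|) (μ.prod ν) := by
  have h : Integrable (fun p : ℝ × ℝ => |p.1 - p.2| + |logSing (p.1 - p.2)|) (μ.prod ν) :=
    ((h1.comp_fst ν).sub (h2.comp_snd μ)).abs.add (integrable_logSing_prod hν).abs
  have hms : Measurable fun p : ℝ × ℝ => |Real.log (|p.1 - p.2|)| :=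
    continuous_abs.measurable.comp (Real.measurable_log.comp
      (continuous_abs.measurable.comp (measurable_fst.sub measurable_snd)))
  refine h.mono' hms.aestronglyMeasurable (ae_of_all _ fun y => ?_)
  rw [Real.norm_eq_abs, abs_abs]
  exact abs_log_le_abs_add _

theorem integrable_log_prod {μ ν : Measure ℝ} [IsFiniteMeasure μ] [IsFiniteMeasure ν]
    (hν : ν ≤ volume) (h1 : Integrable (fun x => x) μ) (h2 : Integrable (fun x => x) ν) :
    Integrable (fun p : ℝ × ℝ => Real.log (1 / |p.1 - p.2|)) (μ.prod ν) := by
  refine (integrable_abs_log_prod hν h1 h2).mono' measurable_log_one_div_sub.aestronglyMeasurable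
    (ae_of_all _ fun p => ?_)
  rw [log_one_div_abs, norm_neg, Real.norm_eq_abs]

/-- Makes the convention `log (1/0) = 0` on the diagonal harmless. -/
theorem ae_prod_ne {μ ν : Measure ℝ} [SFinite μ] [SFinite ν] (hν : ν ≤ volume) :
    ∀ᵐ p ∂(μ.prod ν), p.1 ≠ p.2 := by
  have hm : MeasurableSet {p : ℝ × ℝ | p.1 ≠ p.2} :=
    (measurableSet_eq_fun measurable_fst measurable_snd).compl
  rw [Measure.ae_prod_iff_ae_ae hm]
  refine ae_of_all _ fun x => ?_
  have : ν {x} = 0 := le_antisymm ((hν {x}).trans (by simp)) zero_le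
  rw [ae_iff]
  simpa [eq_comm] using this

/-! ### Positive definiteness of the logarithmic kernel -/

/-- The truncated logarithmic kernel `∫₀ᴿ (1 - |t|/r)₊ dr / r`. -/
noncomputable def truncLog (R t : ℝ) : ℝ :=
  if |t| ≤ R then Real.log (R / |t|) - 1 + |t| / R else 0

/-- The measure `r⁻² dr du` on `(0,R) × ℝ`. -/
noncomputable def scaleMeasure (R : ℝ) : Measure (ℝ × ℝ) :=
  ((volume.restrict (Ioo 0 R)).prod volume).withDensity (fun q => ENNReal.ofReal ((q.1 ^ 2)⁻¹))

instance (R : ℝ) : SFinite (scaleMeasure R) := by unfold scaleMeasure; infer_instance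

/-- `ENNReal.ofReal` turns `r - t` into its positive part, so the integral starts at `r = t`; an
antiderivative of `1/r - t/r²` is `log r + t/r`. -/
theorem lintegral_truncLog {R t : ℝ} (hR : 0 < R) (ht : 0 < t) :
    ∫⁻ r in Ioo 0 R, ENNReal.ofReal ((r ^ 2)⁻¹) * ENNReal.ofReal (r - t)
      = ENNReal.ofReal (truncLog R t) := by
  rw [truncLog, abs_of_pos ht]
  split_ifs with h
  · have e1 : ∫⁻ r in Ioo 0 R, ENNReal.ofReal ((r ^ 2)⁻¹) * ENNReal.ofReal (r - t)
        = ∫⁻ r in Ioc t R, ENNReal.ofReal (1 / r - t / r ^ 2) := by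
      rw [← restrict_Ioo_eq_restrict_Ioc, ← lintegral_indicator measurableSet_Ioo,
        ← lintegral_indicator measurableSet_Ioo]
      refine lintegral_congr fun r => ?_
      by_cases h1 : r ∈ Ioo t R
      · have h2 : r ∈ Ioo 0 R := ⟨ht.trans h1.1, h1.2⟩
        have hr : 0 < r := h2.1
        rw [indicator_of_mem h1, indicator_of_mem h2, ← ENNReal.ofReal_mul (by positivity)]
        congr 1; field_simp
      · rw [indicator_of_notMem h1]
        by_cases h2 : r ∈ Ioo 0 R
        · rw [indicator_of_mem h2]
          have : r - t ≤ 0 := by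
            by_contra! hc
            exact h1 ⟨by linarith, h2.2⟩
          rw [ENNReal.ofReal_of_nonpos this, mul_zero]
        · rw [indicator_of_notMem h2]
    have hpos : ∀ r ∈ uIcc t R, 0 < r := fun r hr => by
      rw [uIcc_of_le h] at hr; exact ht.trans_le hr.1
    have hint : IntervalIntegrable (fun r : ℝ => 1 / r - t / r ^ 2) volume t R := by
      apply ContinuousOn.intervalIntegrable
      apply ContinuousOn.sub
      · exact continuousOn_const.div continuousOn_id fun r hr => (hpos r hr).ne'
      · exact continuousOn_const.div (continuousOn_id.pow 2) fun r hr =>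
          pow_ne_zero 2 (hpos r hr).ne'
    have e2 : ∫ r in t..R, (1 / r - t / r ^ 2) = Real.log (R / t) - 1 + t / R := by
      rw [intervalIntegral.integral_eq_sub_of_hasDerivAt (f := fun r => Real.log r + t * r⁻¹)
        (fun r hr => ?_) hint]
      · rw [Real.log_div hR.ne' ht.ne']
        field_simp; ring
      · have hr0 := (hpos r hr).ne'
        have := (Real.hasDerivAt_log hr0).add ((hasDerivAt_inv hr0).const_mul t)
        refine (this.congr_deriv ?_)
        field_simp
        ring
    rw [e1, ← e2, intervalIntegral.integral_of_le h, ofReal_integral_eq_lintegral_ofReal]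
    · exact hint.1
    · refine (ae_restrict_iff' measurableSet_Ioc).2 (ae_of_all _ fun r hr => ?_)
      have hr0 : 0 < r := ht.trans hr.1
      have : 1 / r - t / r ^ 2 = (r - t) / r ^ 2 := by field_simp
      rw [Pi.zero_apply]
      simp only [this]
      exact div_nonneg (by linarith [hr.1]) (by positivity)
  · rw [ENNReal.ofReal_zero]
    refine (setLIntegral_congr_fun measurableSet_Ioo (g := fun _ => 0) fun r hr => ?_).trans
      (by simp)
    have : r - t ≤ 0 := by have := hr.2; push Not at h; linarith
    simp only
    rw [ENNReal.ofReal_of_nonpos this, mul_zero]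

theorem truncLog_abs (R t : ℝ) : truncLog R |t| = truncLog R t := by
  simp [truncLog]

theorem truncLog_nonneg {R t : ℝ} (hR : 0 < R) (ht : t ≠ 0) : 0 ≤ truncLog R t := by
  have ht' := abs_pos.2 ht
  rw [truncLog]
  split_ifs with h
  · have := Real.one_sub_inv_le_log_of_pos (show 0 < R / |t| by positivity)
    rw [inv_div] at this
    linarith
  · exact le_rfl

/-- The quadruples `((r,u),(x,y))` with `x, y ∈ (u - r, u)`. -/
def windowSet : Set ((ℝ × ℝ) × (ℝ × ℝ)) :=
  {w | (w.1.2 - w.1.1 < w.2.1 ∧ w.2.1 < w.1.2) ∧ (w.1.2 - w.1.1 < w.2.2 ∧ w.2.2 < w.1.2)}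

theorem measurableSet_windowSet : MeasurableSet windowSet := by
  have hr : Measurable fun w : (ℝ × ℝ) × (ℝ × ℝ) => w.1.2 - w.1.1 := by fun_prop
  have hu : Measurable fun w : (ℝ × ℝ) × (ℝ × ℝ) => w.1.2 := by fun_prop
  have hx : Measurable fun w : (ℝ × ℝ) × (ℝ × ℝ) => w.2.1 := by fun_prop
  have hy : Measurable fun w : (ℝ × ℝ) × (ℝ × ℝ) => w.2.2 := by fun_prop
  exact ((measurableSet_lt hr hx).inter (measurableSet_lt hx hu)).inter
    ((measurableSet_lt hr hy).inter (measurableSet_lt hy hu))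

/-- The `u` for which `(u - r, u)` contains both points form an interval of length `(r - |x - y|)₊`.
-/
theorem scaleMeasure_window {R x y : ℝ} (hR : 0 < R) (hxy : x ≠ y) :
    scaleMeasure R ((fun q => (q, (x, y))) ⁻¹' windowSet) = ENNReal.ofReal (truncLog R (x - y)) := by
  have hS : MeasurableSet ((fun q : ℝ × ℝ => (q, (x, y))) ⁻¹' windowSet) :=
    measurableSet_windowSet.preimage (by fun_prop)
  rw [scaleMeasure, withDensity_apply _ hS, ← lintegral_indicator hS,
    lintegral_prod _ (by
      refine Measurable.aemeasurable (Measurable.indicator ?_ hS); fun_prop),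
    ← truncLog_abs, ← lintegral_truncLog hR (abs_pos.2 (sub_ne_zero.2 hxy))]
  refine lintegral_congr fun r => ?_
  have e : ∀ u : ℝ, ((fun q : ℝ × ℝ => (q, (x, y))) ⁻¹' windowSet).indicator
      (fun q : ℝ × ℝ => ENNReal.ofReal ((q.1 ^ 2)⁻¹)) (r, u)
      = (Ioo (max x y) (min (x + r) (y + r))).indicator
        (fun _ => ENNReal.ofReal ((r ^ 2)⁻¹)) u := by
    intro u
    have : (r, u) ∈ ((fun q : ℝ × ℝ => (q, (x, y))) ⁻¹' windowSet) ↔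
        u ∈ Ioo (max x y) (min (x + r) (y + r)) := by
      simp only [windowSet, mem_preimage, mem_Ioo, max_lt_iff, lt_min_iff]
      change (u - r < x ∧ x < u) ∧ (u - r < y ∧ y < u) ↔ _
      constructor
      · rintro ⟨⟨a, b⟩, c, d⟩
        exact ⟨⟨b, d⟩, by linarith, by linarith⟩
      · rintro ⟨⟨a, b⟩, c, d⟩
        exact ⟨⟨by linarith, a⟩, by linarith, b⟩
    by_cases h : u ∈ Ioo (max x y) (min (x + r) (y + r))
    · rw [indicator_of_mem h, indicator_of_mem (this.2 h)]
    · rw [indicator_of_notMem h, indicator_of_notMem (fun h' => h (this.1 h'))]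
  simp_rw [e]
  rw [lintegral_indicator measurableSet_Ioo, setLIntegral_const, Real.volume_Ioo]
  congr 2
  rw [min_add_add_right]
  rcases le_total x y with h | h
  · rw [min_eq_left h, max_eq_right h, abs_of_nonpos (by linarith)]; ring
  · rw [min_eq_right h, max_eq_left h, abs_of_nonneg (by linarith)]; ring

/-- The mass of the window `(u - r, u)`. -/
noncomputable def windowMass (μ : Measure ℝ) (q : ℝ × ℝ) : ℝ := μ.real (Ioo (q.2 - q.1) q.2)

/-- Both sides are the mass of `windowSet`, computed by Tonelli in the two orders. This writes the
truncated energy as an inner product of window masses. -/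
theorem lintegral_window {μ ν : Measure ℝ} [IsFiniteMeasure μ] [IsFiniteMeasure ν]
    (hν : ν ≤ volume) {R : ℝ} (hR : 0 < R) :
    ∫⁻ q, ENNReal.ofReal (windowMass μ q * windowMass ν q) ∂(scaleMeasure R)
      = ∫⁻ p, ENNReal.ofReal (truncLog R (p.1 - p.2)) ∂(μ.prod ν) := by
  have h1 := Measure.prod_apply (μ := scaleMeasure R) (ν := μ.prod ν) measurableSet_windowSet
  have h2 := Measure.prod_apply_symm (μ := scaleMeasure R) (ν := μ.prod ν) measurableSet_windowSet
  have e1 : ∀ q : ℝ × ℝ, (μ.prod ν) (Prod.mk q ⁻¹' windowSet)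
      = ENNReal.ofReal (windowMass μ q * windowMass ν q) := by
    intro q
    have : Prod.mk q ⁻¹' windowSet = Ioo (q.2 - q.1) q.2 ×ˢ Ioo (q.2 - q.1) q.2 := by
      ext p
      rfl
    rw [this, Measure.prod_prod, windowMass, windowMass, ENNReal.ofReal_mul measureReal_nonneg,
      ofReal_measureReal, ofReal_measureReal]
  simp_rw [e1] at h1
  rw [← h1, h2]
  refine lintegral_congr_ae ?_
  filter_upwards [ae_prod_ne (μ := μ) hν] with p hp
  exact scaleMeasure_window hR hp

theorem measurable_truncLog (R : ℝ) : Measurable (truncLog R) := by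
  have habs : Measurable fun t : ℝ => |t| := continuous_abs.measurable
  exact Measurable.ite (measurableSet_le habs measurable_const)
    (((Real.measurable_log.comp (measurable_const.div habs)).sub measurable_const).add
      (habs.div measurable_const)) measurable_const

theorem abs_truncLog_le {R : ℝ} (hR : 0 < R) (t : ℝ) :
    |truncLog R t| ≤ |Real.log R| + 1 + |Real.log (|t|)| := by
  have h1 := abs_nonneg (Real.log R)
  have h2 := abs_nonneg (Real.log (|t|))
  rcases eq_or_ne t 0 with rfl | ht
  · rw [truncLog, abs_zero, if_pos hR.le]; simp
  rw [abs_of_nonneg (truncLog_nonneg hR ht), truncLog]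
  split_ifs with h
  · rw [Real.log_div hR.ne' (abs_ne_zero.2 ht)]
    have : |t| / R ≤ 1 := (div_le_one hR).2 h
    linarith [le_abs_self (Real.log R), neg_abs_le (Real.log (|t|))]
  · positivity

theorem integrable_truncLog {μ ν : Measure ℝ} [IsFiniteMeasure μ] [IsFiniteMeasure ν]
    (hν : ν ≤ volume) (h1 : Integrable (fun x => x) μ) (h2 : Integrable (fun x => x) ν)
    {R : ℝ} (hR : 0 < R) :
    Integrable (fun p : ℝ × ℝ => truncLog R (p.1 - p.2)) (μ.prod ν) :=
  ((integrable_const (|Real.log R| + 1)).add (integrable_abs_log_prod hν h1 h2)).mono'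
    ((measurable_truncLog R).comp (measurable_fst.sub measurable_snd)).aestronglyMeasurable
    (ae_of_all _ fun _ => abs_truncLog_le hR _)

theorem measurable_windowMass (μ : Measure ℝ) [SFinite μ] : Measurable (windowMass μ) := by
  have hS : MeasurableSet {w : (ℝ × ℝ) × ℝ | w.1.2 - w.1.1 < w.2 ∧ w.2 < w.1.2} := by
    have h1 : Measurable fun w : (ℝ × ℝ) × ℝ => w.1.2 - w.1.1 := by fun_prop
    have h2 : Measurable fun w : (ℝ × ℝ) × ℝ => w.1.2 := by fun_prop
    exact (measurableSet_lt h1 measurable_snd).inter (measurableSet_lt measurable_snd h2)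
  exact (measurable_measure_prodMk_left (ν := μ) hS).ennreal_toReal

theorem windowMass_nonneg (μ : Measure ℝ) (q : ℝ × ℝ) : 0 ≤ windowMass μ q := measureReal_nonneg

theorem integrable_windowMass_mul {μ ν : Measure ℝ} [IsFiniteMeasure μ] [IsFiniteMeasure ν]
    (hν : ν ≤ volume) (h1 : Integrable (fun x => x) μ) (h2 : Integrable (fun x => x) ν)
    {R : ℝ} (hR : 0 < R) :
    Integrable (fun q => windowMass μ q * windowMass ν q) (scaleMeasure R) ∧
    ∫ q, windowMass μ q * windowMass ν q ∂(scaleMeasure R)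
      = ∫ p, truncLog R (p.1 - p.2) ∂(μ.prod ν) := by
  have hm : Measurable (fun q => windowMass μ q * windowMass ν q) :=
    (measurable_windowMass μ).mul (measurable_windowMass ν)
  have h0 : 0 ≤ᵐ[scaleMeasure R] fun q => windowMass μ q * windowMass ν q :=
    ae_of_all _ fun q => mul_nonneg (windowMass_nonneg _ _) (windowMass_nonneg _ _)
  have ht := integrable_truncLog hν h1 h2 hR
  have ht0 : 0 ≤ᵐ[μ.prod ν] fun p => truncLog R (p.1 - p.2) := by
    filter_upwards [ae_prod_ne (μ := μ) hν] with p hp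
    exact truncLog_nonneg hR (sub_ne_zero.2 hp)
  have hL := lintegral_window (μ := μ) hν hR
  constructor
  · refine ⟨hm.aestronglyMeasurable, ?_⟩
    rw [hasFiniteIntegral_iff_ofReal h0, hL, ← hasFiniteIntegral_iff_ofReal ht0]
    exact ht.2
  · rw [integral_eq_lintegral_of_nonneg_ae h0 hm.aestronglyMeasurable, hL,
      integral_eq_lintegral_of_nonneg_ae ht0 ht.1]

/-! ### Removal of the truncation: the logarithmic energy of a difference of measures. -/

/-- The mutual logarithmic energy. -/
noncomputable def logEnergy (μ ν : Measure ℝ) : ℝ :=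
  ∫ p, Real.log (1 / |p.1 - p.2|) ∂(μ.prod ν)

/-- For `|t| ≤ R` the truncated kernel is `log (1/|t|) + (log R - 1) + |t|/R`. The divergent
constant cancels in the combination `μμ - 2 μν + νν` because both masses are `1`. -/
theorem tendsto_truncLog {μ ν : Measure ℝ} [IsProbabilityMeasure μ] [IsProbabilityMeasure ν]
    (hν : ν ≤ volume) (h1 : Integrable (fun x => x) μ) (h2 : Integrable (fun x => x) ν) :
    Tendsto (fun n : ℕ => ∫ p, truncLog (n + 1) (p.1 - p.2) ∂(μ.prod ν)
      - (Real.log (n + 1) - 1)) atTop (𝓝 (logEnergy μ ν)) := by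
  have e : ∀ n : ℕ, ∫ p, truncLog (n + 1) (p.1 - p.2) ∂(μ.prod ν) - (Real.log (n + 1) - 1)
      = ∫ p, (truncLog (n + 1) (p.1 - p.2) - (Real.log (n + 1) - 1)) ∂(μ.prod ν) := by
    intro n
    rw [integral_sub (integrable_truncLog hν h1 h2 (by positivity)) (integrable_const _)]
    simp
  simp_rw [e]
  refine tendsto_integral_of_dominated_convergence
    (fun p : ℝ × ℝ => 1 + |Real.log (|p.1 - p.2|)|) (fun n => ?_)
    ((integrable_const _).add (integrable_abs_log_prod hν h1 h2)) (fun n => ?_) ?_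
  · exact ((integrable_truncLog hν h1 h2 (by positivity)).sub
      (integrable_const _)).aestronglyMeasurable
  · filter_upwards [ae_prod_ne (μ := μ) hν] with p hp
    have ht := abs_pos.2 (sub_ne_zero.2 hp)
    set t := |p.1 - p.2|
    have hn : (0 : ℝ) < n + 1 := by positivity
    have hn1 : (1 : ℝ) ≤ n + 1 := by linarith [(Nat.cast_nonneg n : (0 : ℝ) ≤ n)]
    rw [← truncLog_abs, Real.norm_eq_abs, truncLog, abs_abs]
    split_ifs with h
    · rw [Real.log_div hn.ne' ht.ne']
      have a1 : t / (n + 1) ≤ 1 := (div_le_one hn).2 h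
      have a2 : 0 ≤ t / (n + 1) := by positivity
      have := le_abs_self (Real.log t)
      have := neg_abs_le (Real.log t)
      rw [abs_le]; constructor <;> linarith
    · have a0 := Real.log_nonneg hn1
      have a1 := Real.log_le_log hn (not_le.1 h).le
      have := le_abs_self (Real.log t)
      rw [abs_le]; constructor <;> linarith
  · filter_upwards [ae_prod_ne (μ := μ) hν] with p hp
    have ht := abs_pos.2 (sub_ne_zero.2 hp)
    simp_rw [← truncLog_abs _ (p.1 - p.2)]
    set t := |p.1 - p.2|
    have hlim : Tendsto (fun n : ℕ => -Real.log t + t / ((n : ℝ) + 1)) atTop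
        (𝓝 (-Real.log t + 0)) :=
      tendsto_const_nhds.add (tendsto_const_nhds.div_atTop
        (tendsto_atTop_add_const_right _ _ tendsto_natCast_atTop_atTop))
    rw [log_one_div_abs]
    rw [add_zero] at hlim
    refine hlim.congr' ?_
    filter_upwards [tendsto_natCast_atTop_atTop.eventually_ge_atTop t] with n hn
    have hn' : (0 : ℝ) < n + 1 := by positivity
    rw [truncLog, abs_of_pos ht, if_pos (by linarith), Real.log_div hn'.ne' ht.ne']
    ring

/-- The squared `L²` distance of the window masses at scales below `R`. -/
noncomputable def windowDist (μ ν : Measure ℝ) (R : ℝ) : ℝ :=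
  ∫ q, (windowMass μ q - windowMass ν q) ^ 2 ∂(scaleMeasure R)

theorem integrable_windowDist {μ ν : Measure ℝ} [IsProbabilityMeasure μ] [IsProbabilityMeasure ν]
    (hμ : μ ≤ volume) (hν : ν ≤ volume) (h1 : Integrable (fun x => x) μ)
    (h2 : Integrable (fun x => x) ν)
    {R : ℝ} (hR : 0 < R) :
    Integrable (fun q => (windowMass μ q - windowMass ν q) ^ 2) (scaleMeasure R) := by
  have a := (integrable_windowMass_mul hμ h1 h1 hR).1
  have b := (integrable_windowMass_mul hν h1 h2 hR).1
  have c := (integrable_windowMass_mul hν h2 h2 hR).1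
  convert! (a.sub (b.const_mul 2)).add c using 1
  funext q
  simp only [Pi.add_apply, Pi.sub_apply]; ring

theorem windowDist_eq {μ ν : Measure ℝ} [IsProbabilityMeasure μ] [IsProbabilityMeasure ν]
    (hμ : μ ≤ volume) (hν : ν ≤ volume) (h1 : Integrable (fun x => x) μ)
    (h2 : Integrable (fun x => x) ν)
    {R : ℝ} (hR : 0 < R) :
    windowDist μ ν R = ∫ p, truncLog R (p.1 - p.2) ∂(μ.prod μ)
      - 2 * ∫ p, truncLog R (p.1 - p.2) ∂(μ.prod ν)
      + ∫ p, truncLog R (p.1 - p.2) ∂(ν.prod ν) := by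
  obtain ⟨a, a'⟩ := integrable_windowMass_mul hμ h1 h1 hR
  obtain ⟨b, b'⟩ := integrable_windowMass_mul hν h1 h2 hR
  obtain ⟨c, c'⟩ := integrable_windowMass_mul hν h2 h2 hR
  rw [← a', ← b', ← c', ← integral_const_mul, ← integral_sub a (b.const_mul 2)]
  refine Eq.trans ?_ (integral_add (a.sub (b.const_mul 2)) c)
  refine integral_congr_ae (ae_of_all _ fun q => ?_)
  simp only; ring

theorem tendsto_windowDist {μ ν : Measure ℝ} [IsProbabilityMeasure μ] [IsProbabilityMeasure ν]
    (hμ : μ ≤ volume) (hν : ν ≤ volume) (h1 : Integrable (fun x => x) μ)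
    (h2 : Integrable (fun x => x) ν) :
    Tendsto (fun n : ℕ => windowDist μ ν (n + 1)) atTop
      (𝓝 (logEnergy μ μ - 2 * logEnergy μ ν + logEnergy ν ν)) := by
  have a := tendsto_truncLog hμ h1 h1
  have b := tendsto_truncLog hν h1 h2
  have c := tendsto_truncLog hν h2 h2
  refine ((a.sub (b.const_mul 2)).add c).congr fun n => ?_
  rw [windowDist_eq hμ hν h1 h2 (by positivity)]
  ring

/-- The integrand is a square and the domain of scales grows with `R`, so every truncation lies
below the limit; hence energy zero forces each truncated distance to vanish. -/
theorem windowDist_le_logEnergy {μ ν : Measure ℝ} [IsProbabilityMeasure μ] [IsProbabilityMeasure ν]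
    (hμ : μ ≤ volume) (hν : ν ≤ volume) (h1 : Integrable (fun x => x) μ)
    (h2 : Integrable (fun x => x) ν)
    (n : ℕ) :
    windowDist μ ν (n + 1) ≤ logEnergy μ μ - 2 * logEnergy μ ν + logEnergy ν ν := by
  refine Monotone.ge_of_tendsto (f := fun n : ℕ => windowDist μ ν (n + 1)) (fun m k hmk => ?_)
    (tendsto_windowDist hμ hν h1 h2) n
  refine integral_mono_measure ?_ (ae_of_all _ fun q => sq_nonneg _)
    (integrable_windowDist hμ hν h1 h2 (by positivity))
  have hprod : (volume.restrict (Ioo 0 ((m : ℝ) + 1))).prod (volume : Measure ℝ)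
      ≤ (volume.restrict (Ioo 0 ((k : ℝ) + 1))).prod volume := by
    refine Measure.prod_mono (Measure.restrict_mono (Ioo_subset_Ioo_right ?_) le_rfl) le_rfl
    gcongr
  refine Measure.le_iff.2 fun s hs => ?_
  rw [scaleMeasure, scaleMeasure, withDensity_apply _ hs, withDensity_apply _ hs]
  exact lintegral_mono' (Measure.restrict_mono le_rfl hprod) le_rfl

theorem logEnergy_nonneg {μ ν : Measure ℝ} [IsProbabilityMeasure μ] [IsProbabilityMeasure ν]
    (hμ : μ ≤ volume) (hν : ν ≤ volume) (h1 : Integrable (fun x => x) μ)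
    (h2 : Integrable (fun x => x) ν) :
    0 ≤ logEnergy μ μ - 2 * logEnergy μ ν + logEnergy ν ν :=
  (integral_nonneg fun _ => sq_nonneg _).trans (windowDist_le_logEnergy hμ hν h1 h2 0)

theorem lipschitz_cdf {μ : Measure ℝ} [IsFiniteMeasure μ] (hμ : μ ≤ volume) :
    LipschitzWith 1 (fun x => μ.real (Iic x)) := by
  refine LipschitzWith.of_le_add fun x y => ?_
  have h1 : μ.real (Iic x) ≤ μ.real (Iic y ∪ Ioc y x) := measureReal_mono (fun z hz => by
    rcases le_or_gt z y with h | h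
    · exact Or.inl h
    · exact Or.inr ⟨h, hz⟩)
  have h2 := measureReal_union_le (μ := μ) (Iic y) (Ioc y x)
  have h3 : μ.real (Ioc y x) ≤ dist x y := by
    have : μ (Ioc y x) ≤ ENNReal.ofReal (x - y) := (hμ _).trans (by rw [Real.volume_Ioc])
    have := ENNReal.toReal_mono ENNReal.ofReal_ne_top this
    refine this.trans ?_
    rw [ENNReal.toReal_ofReal', Real.dist_eq]
    exact max_le (le_abs_self _) (abs_nonneg _)
  linarith

theorem windowMass_eq {μ : Measure ℝ} [IsFiniteMeasure μ] (hμ : μ ≤ volume) {q : ℝ × ℝ}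
    (hq : 0 < q.1) : windowMass μ q = μ.real (Iic q.2) - μ.real (Iic (q.2 - q.1)) := by
  have hat : ∀ x, μ {x} = 0 := fun x => le_antisymm ((hμ {x}).trans (by simp)) zero_le
  have e : Iic q.2 = Iic (q.2 - q.1) ∪ Ioc (q.2 - q.1) q.2 := by
    rw [Iic_union_Ioc_eq_Iic]; linarith
  have e2 : μ.real (Ioc (q.2 - q.1) q.2) = μ.real (Ioo (q.2 - q.1) q.2) := by
    rw [measureReal_def, measureReal_def]
    congr 1
    rw [← Ioo_union_right (by linarith : q.2 - q.1 < q.2)]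
    refine le_antisymm ((measure_union_le _ _).trans (by rw [hat, add_zero])) (measure_mono subset_union_left)
  rw [e, measureReal_union _ measurableSet_Ioc, e2, windowMass]
  · ring
  · exact Iic_disjoint_Ioc le_rfl

/-- Almost all windows have equal masses. Domination by Lebesgue measure makes the distribution
functions continuous, so this holds for all windows: an exceptional one would give an open, hence
non-null, set of them. -/
theorem eq_of_windowDist_eq_zero {μ ν : Measure ℝ} [IsProbabilityMeasure μ]
    [IsProbabilityMeasure ν] (hμ : μ ≤ volume) (hν : ν ≤ volume)
    (h1 : Integrable (fun x => x) μ) (h2 : Integrable (fun x => x) ν)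
    (h : ∀ n : ℕ, windowDist μ ν (n + 1) = 0) : μ = ν := by
  set D : ℝ → ℝ := fun x => μ.real (Iic x) - ν.real (Iic x) with hD
  have hDc : Continuous D := (lipschitz_cdf hμ).continuous.sub (lipschitz_cdf hν).continuous
  have key : ∀ r > 0, ∀ u, D u = D (u - r) := by
    intro r hr u
    obtain ⟨n, hn⟩ := exists_nat_gt r
    have hR : (0 : ℝ) < n + 1 := by positivity
    by_contra hne
    have hz := (integral_eq_zero_iff_of_nonneg (fun q => sq_nonneg _)
      (integrable_windowDist hμ hν h1 h2 hR)).1 (h n)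
    have hz' : ∀ᵐ q ∂((volume.restrict (Ioo 0 ((n : ℝ) + 1))).prod volume),
        q.1 ∈ Ioo 0 ((n : ℝ) + 1) → windowMass μ q = windowMass ν q := by
      have hmeas : Measurable (fun q : ℝ × ℝ => ENNReal.ofReal ((q.1 ^ 2)⁻¹)) := by fun_prop
      have := (ae_withDensity_iff hmeas).1 hz
      filter_upwards [this] with q hq hq0
      have := hq (by
        rw [ne_eq, ENNReal.ofReal_eq_zero, not_le]
        have := hq0.1
        positivity)
      simpa [sub_eq_zero] using this
    rw [show (volume.restrict (Ioo 0 ((n : ℝ) + 1))).prod (volume : Measure ℝ)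
        = (volume : Measure (ℝ × ℝ)).restrict (Ioo 0 ((n : ℝ) + 1) ×ˢ univ) by
      rw [Measure.volume_eq_prod, ← Measure.prod_restrict, Measure.restrict_univ],
      ae_restrict_iff' (measurableSet_Ioo.prod MeasurableSet.univ)] at hz'
    set O : Set (ℝ × ℝ) := (Ioo 0 ((n : ℝ) + 1) ×ˢ univ) ∩ {q | D q.2 ≠ D (q.2 - q.1)} with hO
    have hOo : IsOpen O := (isOpen_Ioo.prod isOpen_univ).inter
      (isOpen_ne_fun (hDc.comp continuous_snd) (hDc.comp (continuous_snd.sub continuous_fst)))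
    have hOn : O.Nonempty := ⟨(r, u), ⟨⟨hr, by linarith⟩, trivial⟩, hne⟩
    have hpos := hOo.measure_pos (volume : Measure (ℝ × ℝ)) hOn
    have hnull : (volume : Measure (ℝ × ℝ)) O = 0 := by
      refine measure_mono_null ?_ (ae_iff.1 hz')
      rintro q ⟨hq1, hq2⟩
      intro hcon
      have hw := hcon hq1 hq1.1
      have hq0 : 0 < q.1 := hq1.1.1
      rw [windowMass_eq hμ hq0, windowMass_eq hν hq0] at hw
      apply hq2
      simp only [hD]; linarith
    exact hpos.ne' hnull
  refine Measure.ext_of_Ioc μ ν fun a b hab => ?_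
  have := key (b - a) (by linarith) b
  have e : ∀ (ρ : Measure ℝ) [IsProbabilityMeasure ρ],
      ρ (Ioc a b) = ENNReal.ofReal (ρ.real (Iic b) - ρ.real (Iic a)) := by
    intro ρ _
    have e1 : Iic b = Iic a ∪ Ioc a b := by rw [Iic_union_Ioc_eq_Iic hab.le]
    rw [e1, measureReal_union (Iic_disjoint_Ioc le_rfl)
      measurableSet_Ioc, add_sub_cancel_left, ofReal_measureReal]
  rw [e μ, e ν]
  congr 1
  simp only [hD, sub_sub_cancel] at this
  linarith

theorem eq_of_logEnergy_eq_zero {μ ν : Measure ℝ} [IsProbabilityMeasure μ]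
    [IsProbabilityMeasure ν] (hμ : μ ≤ volume) (hν : ν ≤ volume)
    (h1 : Integrable (fun x => x) μ) (h2 : Integrable (fun x => x) ν)
    (h : logEnergy μ μ - 2 * logEnergy μ ν + logEnergy ν ν ≤ 0) : μ = ν :=
  eq_of_windowDist_eq_zero hμ hν h1 h2 fun n =>
    le_antisymm ((windowDist_le_logEnergy hμ hν h1 h2 n).trans h)
      (integral_nonneg fun _ => sq_nonneg _)

/-! ### The Euler–Lagrange conditions characterise the constrained equilibrium measure -/

/-- External fields that are continuous on `[0,∞)` and of exactly linear growth. -/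
structure LinearField (V : ℝ → ℝ) : Prop where
  continuousOn : ContinuousOn V (Ici 0)
  lower : ∃ c > (0 : ℝ), ∃ C : ℝ, ∀ x, 0 ≤ x → c * x - C ≤ V x
  upper : ∃ K : ℝ, ∀ x, 0 ≤ x → |V x| ≤ K * (1 + x)

/-- The linear growth of `V` beats the logarithm: half of the available slope `c/2` is spent on `log
|x - y|`, leaving `c/4`. -/
theorem LinearField.exists_kernel_lower {V : ℝ → ℝ} (hV : LinearField V) :
    ∃ c > (0 : ℝ), ∃ C : ℝ, ∀ x y, 0 ≤ x → 0 ≤ y → c * (x + y) - C ≤ energyKernel V x y := by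
  obtain ⟨c, hc, C, h⟩ := hV.lower
  refine ⟨c / 4, by positivity, C + |1 + Real.log (c / 4)|, fun x y hx hy => ?_⟩
  have h1 := h x hx
  have h2 := h y hy
  have hlog : -(c / 4 * (x + y)) - |1 + Real.log (c / 4)| ≤ Real.log (1 / |x - y|) := by
    rw [log_one_div_abs]
    have ht : |x - y| ≤ x + y := by rw [abs_le]; constructor <;> linarith
    rcases (abs_nonneg (x - y)).eq_or_lt with h0 | h0
    · rw [← h0, Real.log_zero]
      have : 0 ≤ c / 4 * (x + y) := by positivity
      linarith [abs_nonneg (1 + Real.log (c / 4))]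
    · have := Real.log_le_sub_one_of_pos (show 0 < c / 4 * |x - y| by positivity)
      rw [Real.log_mul (by positivity) h0.ne'] at this
      have h3 : c / 4 * |x - y| ≤ c / 4 * (x + y) := by gcongr
      linarith [neg_abs_le (1 + Real.log (c / 4))]
  unfold energyKernel
  linarith

theorem IsAdmissible.ae_pos {μ : Measure ℝ} (h : IsAdmissible μ) : ∀ᵐ x ∂μ, 0 < x := by
  rw [ae_iff]
  refine measure_mono_null (fun x hx => ?_) h.measure_Iic_zero
  exact not_lt.1 hx

theorem IsAdmissible.ae_pos_prod {μ : Measure ℝ} (h : IsAdmissible μ) :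
    ∀ᵐ p ∂(μ.prod μ), 0 < p.1 ∧ 0 < p.2 := by
  have := h.isProbabilityMeasure
  exact (Measure.quasiMeasurePreserving_fst.ae h.ae_pos).and
    (Measure.quasiMeasurePreserving_snd.ae h.ae_pos)

theorem LinearField.aestronglyMeasurable {V : ℝ → ℝ} (hV : LinearField V) {μ : Measure ℝ}
    (h : IsAdmissible μ) : AEStronglyMeasurable V μ := by
  have h1 := hV.continuousOn.aestronglyMeasurable (μ := μ) measurableSet_Ici
  rwa [Measure.restrict_eq_self_of_ae_mem] at h1
  filter_upwards [h.ae_pos] with x hx using hx.le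

theorem LinearField.integrable {V : ℝ → ℝ} (hV : LinearField V) {μ : Measure ℝ}
    (h : IsAdmissible μ) (hm : Integrable (fun x => x) μ) : Integrable V μ := by
  have := h.isProbabilityMeasure
  obtain ⟨K, hK⟩ := hV.upper
  refine (((integrable_const (1 : ℝ)).add hm).const_mul K).mono' (hV.aestronglyMeasurable h) ?_
  filter_upwards [h.ae_pos] with x hx using hK x hx.le

theorem LinearField.energy_eq {V : ℝ → ℝ} (hV : LinearField V) {μ : Measure ℝ}
    (h : IsAdmissible μ) (hm : Integrable (fun x => x) μ) :
    energy V μ = ((logEnergy μ μ + ∫ x, V x ∂μ : ℝ) : EReal) := by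
  have := h.isProbabilityMeasure
  have hVi := hV.integrable h hm
  have i1 := integrable_log_prod h.le_volume hm hm
  have i2 : Integrable (fun p : ℝ × ℝ => (V p.1 + V p.2) / 2) (μ.prod μ) :=
    ((hVi.comp_fst μ).add (hVi.comp_snd μ)).div_const 2
  have hi : Integrable (fun p : ℝ × ℝ => energyKernel V p.1 p.2) (μ.prod μ) := i1.add i2
  have e : ∫ p, energyKernel V p.1 p.2 ∂(μ.prod μ) = logEnergy μ μ + ∫ x, V x ∂μ := by
    rw [show (fun p : ℝ × ℝ => energyKernel V p.1 p.2)
      = fun p => Real.log (1 / |p.1 - p.2|) + (V p.1 + V p.2) / 2 from rfl,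
      integral_add i1 i2, integral_div, integral_add (hVi.comp_fst μ) (hVi.comp_snd μ),
      integral_fun_fst, integral_fun_snd, logEnergy]
    simp
  rw [← e, integral_eq_lintegral_pos_part_sub_lintegral_neg_part hi, energy, EReal.coe_sub,
    EReal.coe_ennreal_toReal, EReal.coe_ennreal_toReal]
  · have := hi.neg.lintegral_lt_top
    exact this.ne
  · exact hi.lintegral_lt_top.ne

theorem LinearField.energy_eq_top {V : ℝ → ℝ} (hV : LinearField V) {μ : Measure ℝ}
    (h : IsAdmissible μ) (hm : ¬ Integrable (fun x => x) μ) : energy V μ = ⊤ := by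
  have := h.isProbabilityMeasure
  obtain ⟨c, hc, C, hlow⟩ := hV.exists_kernel_lower
  have hneg : ∫⁻ p : ℝ × ℝ, ENNReal.ofReal (-energyKernel V p.1 p.2) ∂(μ.prod μ) ≠ ⊤ := by
    have : ∫⁻ p : ℝ × ℝ, ENNReal.ofReal (-energyKernel V p.1 p.2) ∂(μ.prod μ)
        ≤ ∫⁻ _ : ℝ × ℝ, ENNReal.ofReal C ∂(μ.prod μ) := by
      refine lintegral_mono_ae ?_
      filter_upwards [h.ae_pos_prod] with p hp
      apply ENNReal.ofReal_le_ofReal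
      have := hlow p.1 p.2 hp.1.le hp.2.le
      have : 0 ≤ c * (p.1 + p.2) := mul_nonneg hc.le (add_nonneg hp.1.le hp.2.le)
      linarith
    refine ne_top_of_le_ne_top ?_ this
    simp
  have hpos : ∫⁻ p : ℝ × ℝ, ENNReal.ofReal (energyKernel V p.1 p.2) ∂(μ.prod μ) = ⊤ := by
    by_contra hne
    apply hm
    have h1 : ∫⁻ p : ℝ × ℝ, ENNReal.ofReal (c * p.1) ∂(μ.prod μ)
        ≤ ∫⁻ p : ℝ × ℝ, (ENNReal.ofReal (energyKernel V p.1 p.2) + ENNReal.ofReal C)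
          ∂(μ.prod μ) := by
      refine lintegral_mono_ae ?_
      filter_upwards [h.ae_pos_prod] with p hp
      refine le_trans (ENNReal.ofReal_le_ofReal ?_) ENNReal.ofReal_add_le
      have := hlow p.1 p.2 hp.1.le hp.2.le
      have : 0 ≤ c * p.2 := mul_nonneg hc.le hp.2.le
      linarith
    rw [lintegral_add_right _ measurable_const, lintegral_prod _ (by fun_prop)] at h1
    simp only [lintegral_const, measure_univ, mul_one] at h1
    have h2 : Integrable (fun x => c * x) μ := by
      refine ⟨by fun_prop, ?_⟩
      rw [hasFiniteIntegral_iff_ofReal]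
      · exact h1.trans_lt (ENNReal.add_lt_top.2 ⟨lt_top_iff_ne_top.2 hne, ENNReal.ofReal_lt_top⟩)
      · filter_upwards [h.ae_pos] with x hx using mul_nonneg hc.le hx.le
    convert h2.const_mul c⁻¹ using 2
    field_simp
  rw [energy, hpos]
  lift (∫⁻ p : ℝ × ℝ, ENNReal.ofReal (-energyKernel V p.1 p.2) ∂(μ.prod μ)) to NNReal using hneg
    with n
  exact EReal.top_sub_coe n

/-- Where `Φ` is negative, `μ` already carries the maximal mass allowed; elsewhere it lives on the
zero set of `Φ`, while a competitor can only pay a nonnegative amount. -/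
theorem integral_le_of_eulerLagrange {Φ : ℝ → ℝ} {μ μ' : Measure ℝ} {a b : ℝ}
    (hμ : IsAdmissible μ) (hμ' : IsAdmissible μ') (hb : μ (Ioi b) = 0)
    (sat : μ.restrict (Icc 0 a) = volume.restrict (Icc 0 a))
    (hi : Integrable Φ μ) (hi' : Integrable Φ μ')
    (h1 : ∀ x, 0 < x → x < a → Φ x < 0) (h2 : ∀ x, a ≤ x → x ≤ b → Φ x = 0)
    (h3 : ∀ x, b < x → 0 < Φ x) (hab : a < b) : ∫ x, Φ x ∂μ ≤ ∫ x, Φ x ∂μ' := by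
  have e1 : ∫ x, Φ x ∂μ = ∫ x in Icc 0 a, Φ x ∂μ := by
    rw [← integral_indicator measurableSet_Icc]
    refine integral_congr_ae ?_
    have hb' : ∀ᵐ x ∂μ, x ≤ b := by
      rw [ae_iff]; simpa [Ioi, not_le] using! hb
    filter_upwards [hμ.ae_pos, hb'] with x hx hxb
    rcases le_or_gt x a with h | h
    · rw [indicator_of_mem (show x ∈ Icc 0 a from ⟨hx.le, h⟩)]
    · rw [indicator_of_notMem (fun h' => not_le.2 h h'.2), h2 x h.le hxb]
  have e2 : ∫ x in Icc 0 a, Φ x ∂μ' ≤ ∫ x, Φ x ∂μ' := by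
    rw [← integral_indicator measurableSet_Icc]
    refine integral_mono_ae (hi'.indicator measurableSet_Icc) hi' ?_
    filter_upwards [hμ'.ae_pos] with x hx
    rcases le_or_gt x a with h | h
    · rw [indicator_of_mem (show x ∈ Icc 0 a from ⟨hx.le, h⟩)]
    · rw [indicator_of_notMem (fun h' => not_le.2 h h'.2)]
      rcases le_or_gt x b with h' | h'
      · exact (h2 x h.le h').ge
      · exact (h3 x h').le
  have e3 : ∫ x in Icc 0 a, -Φ x ∂μ' ≤ ∫ x in Icc 0 a, -Φ x ∂μ := by
    refine integral_mono_measure ?_ ?_ hi.neg.integrableOn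
    · rw [sat]; exact Measure.restrict_mono le_rfl hμ'.le_volume
    · have := ae_restrict_of_ae (s := Icc 0 a) hμ.ae_pos
      filter_upwards [this, ae_restrict_mem measurableSet_Icc] with x hx hxa
      rw [Pi.zero_apply, neg_nonneg]
      rcases hxa.2.eq_or_lt with h | h
      · exact (h2 x h.ge (h.le.trans hab.le)).le
      · exact (h1 x hx h).le
  rw [integral_neg, integral_neg] at e3
  linarith

theorem isConstrainedEquilibrium_of_eulerLagrange {V : ℝ → ℝ} (hV : LinearField V)
    {μ : Measure ℝ} {a b l : ℝ} (hμ : IsAdmissible μ) (hb : μ (Ioi b) = 0) (hab : a < b)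
    (sat : μ.restrict (Icc 0 a) = volume.restrict (Icc 0 a))
    (h1 : ∀ x, 0 < x → x < a → logPotential μ x + V x / 2 + l < 0)
    (h2 : ∀ x, a ≤ x → x ≤ b → logPotential μ x + V x / 2 + l = 0)
    (h3 : ∀ x, b < x → 0 < logPotential μ x + V x / 2 + l) :
    IsConstrainedEquilibrium V μ := by
  have := hμ.isProbabilityMeasure
  have hm : Integrable (fun x => x) μ := by
    refine (integrable_const b).mono' (by fun_prop) ?_
    have hb' : ∀ᵐ x ∂μ, x ≤ b := by
      rw [ae_iff]; simpa [Ioi, not_le] using! hb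
    filter_upwards [hμ.ae_pos, hb'] with x hx hxb
    rwa [Real.norm_of_nonneg hx.le]
  -- The difference of the two sides is `2 (∫ Φ dμ' - ∫ Φ dμ)` with `Φ = U + V/2 + l`; expanding the
  -- quadratic energy around `μ` leaves exactly the energy of `μ' - μ`.
  have key : ∀ μ' : Measure ℝ, IsAdmissible μ' → Integrable (fun x => x) μ' →
      logEnergy μ' μ' - 2 * logEnergy μ' μ + logEnergy μ μ
        ≤ (logEnergy μ' μ' + ∫ x, V x ∂μ') - (logEnergy μ μ + ∫ x, V x ∂μ) := by
    intro μ' hμ' hm'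
    have := hμ'.isProbabilityMeasure
    have hP : ∀ ν : Measure ℝ, IsAdmissible ν → Integrable (fun x => x) ν →
        Integrable (logPotential μ) ν ∧ ∫ x, logPotential μ x ∂ν = logEnergy ν μ := by
      intro ν hν hmν
      have := hν.isProbabilityMeasure
      have hi := integrable_log_prod hμ.le_volume hmν hm
      exact ⟨hi.integral_prod_left, (integral_prod _ hi).symm⟩
    have hPhi : ∀ ν : Measure ℝ, IsAdmissible ν → Integrable (fun x => x) ν →
        Integrable (fun x => logPotential μ x + V x / 2 + l) ν ∧
        ∫ x, (logPotential μ x + V x / 2 + l) ∂ν = logEnergy ν μ + (∫ x, V x ∂ν) / 2 + l := by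
      intro ν hν hmν
      have := hν.isProbabilityMeasure
      obtain ⟨a1, a2⟩ := hP ν hν hmν
      have a3 := (hV.integrable hν hmν).div_const 2
      refine ⟨(a1.add a3).add (integrable_const l), ?_⟩
      refine (integral_add (a1.add a3) (integrable_const l)).trans ?_
      refine congrArg₂ (· + ·) ?_ (by simp)
      refine (integral_add a1 a3).trans ?_
      rw [a2, integral_div]
    have hle := integral_le_of_eulerLagrange hμ hμ' hb sat (hPhi μ hμ hm).1 (hPhi μ' hμ' hm').1
      h1 h2 h3 hab
    rw [(hPhi μ hμ hm).2, (hPhi μ' hμ' hm').2] at hle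
    linarith
  have hE := hV.energy_eq hμ hm
  have hmin : IsEnergyMinimizer V μ := by
    refine ⟨hμ, fun μ' hμ' => ?_⟩
    have := hμ'.isProbabilityMeasure
    by_cases hm' : Integrable (fun x => x) μ'
    · rw [hE, hV.energy_eq hμ' hm', EReal.coe_le_coe_iff]
      have := key μ' hμ' hm'
      have := logEnergy_nonneg hμ'.le_volume hμ.le_volume hm' hm
      linarith
    · rw [hV.energy_eq_top hμ' hm']; exact le_top
  refine ⟨hmin, fun μ' hmin' => ?_⟩
  have hμ' := hmin'.1
  have := hμ'.isProbabilityMeasure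
  have hle := hmin'.2 μ hμ
  have hm' : Integrable (fun x => x) μ' := by
    by_contra hcon
    rw [hV.energy_eq_top hμ' hcon, hE] at hle
    exact absurd hle (not_le.2 (EReal.coe_lt_top _))
  rw [hE, hV.energy_eq hμ' hm', EReal.coe_le_coe_iff] at hle
  have := key μ' hμ' hm'
  exact eq_of_logEnergy_eq_zero hμ'.le_volume hμ.le_volume hm' hm (by linarith)

/-! ### The logarithmic potential of the arcsine law -/

/-- `arcosh |t|` for `|t| ≥ 1`, and `0` otherwise. -/
noncomputable def arcoshLog (t : ℝ) : ℝ := Real.log (max 1 |t| + √(t ^ 2 - 1))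

theorem arcoshLog_nonneg (t : ℝ) : 0 ≤ arcoshLog t :=
  Real.log_nonneg (by have := le_max_left 1 |t|; have := Real.sqrt_nonneg (t ^ 2 - 1); linarith)

theorem arcoshLog_of_abs_le {t : ℝ} (h : |t| ≤ 1) : arcoshLog t = 0 := by
  have : t ^ 2 - 1 ≤ 0 := by have := (sq_le_one_iff_abs_le_one t).2 h; linarith
  rw [arcoshLog, max_eq_left h, Real.sqrt_eq_zero_of_nonpos this, add_zero, Real.log_one]

theorem arcoshLog_pos {t : ℝ} (h : 1 < |t|) : 0 < arcoshLog t :=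
  Real.log_pos (by have := le_max_right 1 |t|; have := Real.sqrt_nonneg (t ^ 2 - 1); linarith)

theorem continuous_arcoshLog : Continuous arcoshLog := by
  unfold arcoshLog
  refine Continuous.log (by fun_prop) fun t => ?_
  have := le_max_left 1 |t|
  have := Real.sqrt_nonneg (t ^ 2 - 1)
  linarith

theorem exists_joukowski (t : ℝ) : ∃ w : ℂ, w ≠ 0 ∧ w + w⁻¹ = 2 * t ∧
    ‖w‖ = max 1 |t| + √(t ^ 2 - 1) := by
  suffices h : ∃ w : ℂ, w ^ 2 - 2 * t * w + 1 = 0 ∧ ‖w‖ = max 1 |t| + √(t ^ 2 - 1) by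
    obtain ⟨w, h1, h2⟩ := h
    have h0 : w ≠ 0 := by rintro rfl; simp at h1
    refine ⟨w, h0, ?_, h2⟩
    field_simp
    linear_combination h1
  rcases le_or_gt |t| 1 with h | h
  · have h2 : t ^ 2 ≤ 1 := (sq_le_one_iff_abs_le_one t).2 h
    have hs : √(1 - t ^ 2) ^ 2 = 1 - t ^ 2 := Real.sq_sqrt (by linarith)
    have hs' : ((√(1 - t ^ 2) : ℝ) : ℂ) ^ 2 = 1 - (t : ℂ) ^ 2 := by exact_mod_cast hs
    refine ⟨t + (√(1 - t ^ 2) : ℝ) * Complex.I, ?_, ?_⟩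
    · linear_combination ((√(1 - t ^ 2) : ℝ) : ℂ) ^ 2 * Complex.I_sq - hs'
    · rw [Real.sqrt_eq_zero_of_nonpos (show t ^ 2 - 1 ≤ 0 by linarith), max_eq_left h, add_zero,
        Complex.norm_add_mul_I, hs, add_sub_cancel, Real.sqrt_one]
  · have h2 : 1 < t ^ 2 := (one_lt_sq_iff_one_lt_abs t).2 h
    have hs : √(t ^ 2 - 1) ^ 2 = t ^ 2 - 1 := Real.sq_sqrt (by linarith)
    have hs0 := Real.sqrt_nonneg (t ^ 2 - 1)
    rw [max_eq_right h.le]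
    rcases le_total 0 t with ht | ht
    · refine ⟨((t + √(t ^ 2 - 1) : ℝ) : ℂ), ?_, ?_⟩
      · norm_cast
        linear_combination hs
      · rw [Complex.norm_real, Real.norm_of_nonneg (by positivity), abs_of_nonneg ht]
    · refine ⟨((t - √(t ^ 2 - 1) : ℝ) : ℂ), ?_, ?_⟩
      · norm_cast
        linear_combination hs
      · rw [Complex.norm_real, Real.norm_of_nonpos (by linarith), abs_of_nonpos ht]; ring

/-- The Joukowski substitution factors `t - cos θ` into two linear factors on the unit circle, so
its logarithm has known circle averages. -/
theorem norm_circleMap_sub_mul {t : ℝ} {w : ℂ} (h0 : w ≠ 0) (hw : w + w⁻¹ = 2 * t) (θ : ℝ) :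
    ‖circleMap 0 1 θ - w‖ * ‖circleMap 0 1 θ - w⁻¹‖ = 2 * |t - Real.cos θ| := by
  set e := circleMap 0 1 θ with he
  have hen : ‖e‖ = 1 := by simp [he]
  have he0 : e ≠ 0 := norm_pos_iff.1 (by rw [hen]; exact one_pos)
  have hcos : e + e⁻¹ = 2 * Real.cos θ := by
    rw [he, circleMap]
    simp only [zero_add, Complex.ofReal_one, one_mul]
    rw [← Complex.exp_neg, Complex.ofReal_cos, Complex.two_cos, neg_mul]
  rw [← norm_mul]
  have : (e - w) * (e - w⁻¹) = e * ((-2 * (t - Real.cos θ) : ℝ) : ℂ) := by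
    have h1 : e * e⁻¹ = 1 := mul_inv_cancel₀ he0
    have h2 : w * w⁻¹ = 1 := mul_inv_cancel₀ h0
    push_cast at hcos ⊢
    linear_combination e * hcos - e * hw - h1 + h2
  rw [this, norm_mul, hen, one_mul, Complex.norm_real, Real.norm_eq_abs, abs_mul]
  norm_num

theorem ae_circleMap_ne (w : ℂ) : ∀ᵐ θ : ℝ, circleMap 0 1 θ ≠ w := by
  rw [ae_iff]
  simpa using! ((countable_singleton w).preimage_circleMap 0 one_ne_zero).measure_zero volume

theorem ae_log_abs_sub_cos {t : ℝ} {w : ℂ} (h0 : w ≠ 0) (hw : w + w⁻¹ = 2 * t) :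
    ∀ᵐ θ : ℝ, Real.log |t - Real.cos θ|
      = Real.log ‖circleMap 0 1 θ - w‖ + Real.log ‖circleMap 0 1 θ - w⁻¹‖ - Real.log 2 := by
  filter_upwards [ae_circleMap_ne w, ae_circleMap_ne w⁻¹] with θ h1 h2
  have n1 : ‖circleMap 0 1 θ - w‖ ≠ 0 := norm_ne_zero_iff.2 (sub_ne_zero.2 h1)
  have n2 : ‖circleMap 0 1 θ - w⁻¹‖ ≠ 0 := norm_ne_zero_iff.2 (sub_ne_zero.2 h2)
  have e := norm_circleMap_sub_mul h0 hw θ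
  have n3 : |t - Real.cos θ| ≠ 0 := by
    intro h
    rw [h, mul_zero] at e
    exact (mul_ne_zero n1 n2) e
  rw [← Real.log_mul n1 n2, e, Real.log_mul two_ne_zero n3]
  ring

theorem intervalIntegrable_log_abs_sub_cos (t : ℝ) :
    IntervalIntegrable (fun θ => Real.log |t - Real.cos θ|) volume 0 (2 * Real.pi) := by
  obtain ⟨w, h0, hw, -⟩ := exists_joukowski t
  have h1 : IntervalIntegrable (fun θ => Real.log ‖circleMap 0 1 θ - w‖) volume 0 (2 * Real.pi) :=
    circleIntegrable_log_norm_sub_const (c := 0) (a := w) 1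
  have h2 : IntervalIntegrable (fun θ => Real.log ‖circleMap 0 1 θ - w⁻¹‖) volume 0
      (2 * Real.pi) := circleIntegrable_log_norm_sub_const (c := 0) (a := w⁻¹) 1
  refine ((h1.add h2).sub (intervalIntegrable_const (c := Real.log 2))).congr_ae ?_
  exact ae_restrict_of_ae ((ae_log_abs_sub_cos h0 hw).mono fun θ h => h.symm)

/-- By Jensen's formula the circle average of `log |z - w|` is `log⁺ |w|`; the factor with `w⁻¹`
contributes nothing as `|w| ≥ 1`. -/
theorem integral_log_abs_sub_cos_two_pi (t : ℝ) :
    ∫ θ in (0 : ℝ)..2 * Real.pi, Real.log |t - Real.cos θ|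
      = 2 * Real.pi * (arcoshLog t - Real.log 2) := by
  obtain ⟨w, h0, hw, hn⟩ := exists_joukowski t
  have h1 : IntervalIntegrable (fun θ => Real.log ‖circleMap 0 1 θ - w‖) volume 0 (2 * Real.pi) :=
    circleIntegrable_log_norm_sub_const (c := 0) (a := w) 1
  have h2 : IntervalIntegrable (fun θ => Real.log ‖circleMap 0 1 θ - w⁻¹‖) volume 0
      (2 * Real.pi) := circleIntegrable_log_norm_sub_const (c := 0) (a := w⁻¹) 1
  have a1 := circleAverage_log_norm_sub_const_eq_posLog (a := w)
  have a2 := circleAverage_log_norm_sub_const_eq_posLog (a := w⁻¹)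
  rw [Real.circleAverage_def, smul_eq_mul, inv_mul_eq_iff_eq_mul₀ (by positivity)] at a1 a2
  have hn1 : 1 ≤ ‖w‖ := by
    rw [hn]; have := le_max_left 1 |t|; have := Real.sqrt_nonneg (t ^ 2 - 1); linarith
  rw [Real.posLog_eq_log (by rwa [abs_norm])] at a1
  rw [Real.posLog_eq_zero_iff _ |>.2 (by
    rw [abs_norm, norm_inv]; exact inv_le_one_of_one_le₀ hn1), mul_zero] at a2
  rw [intervalIntegral.integral_congr_ae_restrict
    (ae_restrict_of_ae (ae_log_abs_sub_cos h0 hw)),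
    intervalIntegral.integral_sub (h1.add h2) intervalIntegrable_const,
    intervalIntegral.integral_add h1 h2, a1, a2, hn, arcoshLog]
  simp
  ring

theorem integral_log_abs_sub_cos (t : ℝ) :
    ∫ θ in (0 : ℝ)..Real.pi, Real.log |t - Real.cos θ|
      = Real.pi * (arcoshLog t - Real.log 2) := by
  have hi := intervalIntegrable_log_abs_sub_cos t
  have hpi := Real.pi_pos
  have i1 : IntervalIntegrable (fun θ => Real.log |t - Real.cos θ|) volume 0 Real.pi :=
    hi.mono_set (by
      rw [uIcc_of_le hpi.le, uIcc_of_le (by linarith)]; exact Icc_subset_Icc_right (by linarith))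
  have i2 : IntervalIntegrable (fun θ => Real.log |t - Real.cos θ|) volume Real.pi
      (2 * Real.pi) :=
    hi.mono_set (by
      rw [uIcc_of_le (by linarith), uIcc_of_le (by linarith)]
      exact Icc_subset_Icc_left (by linarith))
  have h1 := intervalIntegral.integral_add_adjacent_intervals i1 i2
  have h2 : ∫ θ in Real.pi..2 * Real.pi, Real.log |t - Real.cos θ|
      = ∫ θ in (0 : ℝ)..Real.pi, Real.log |t - Real.cos θ| := by
    have := intervalIntegral.integral_comp_sub_left (a := (0 : ℝ)) (b := Real.pi)
      (fun θ => Real.log |t - Real.cos θ|) (2 * Real.pi)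
    simp only [Real.cos_two_pi_sub, sub_zero] at this
    rw [this]
    congr 1; ring
  rw [h2, integral_log_abs_sub_cos_two_pi] at h1
  linarith

theorem ae_cos_ne (t : ℝ) : ∀ᵐ θ : ℝ, t - Real.cos θ ≠ 0 := by
  obtain ⟨w, h0, hw, -⟩ := exists_joukowski t
  filter_upwards [ae_circleMap_ne w, ae_circleMap_ne w⁻¹] with θ h1 h2 h
  have e := norm_circleMap_sub_mul h0 hw θ
  rw [h, abs_zero, mul_zero] at e
  exact mul_ne_zero (norm_ne_zero_iff.2 (sub_ne_zero.2 h1)) (norm_ne_zero_iff.2 (sub_ne_zero.2 h2)) e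

theorem integral_log_arcsine {h : ℝ} (hh : 0 < h) (A x : ℝ) :
    ∫ θ in Ioo 0 Real.pi, Real.log (1 / |x - (A + h * Real.cos θ)|)
      = Real.pi * (Real.log 2 - Real.log h - arcoshLog ((x - A) / h)) := by
  have hpi := Real.pi_pos
  have i1 : IntervalIntegrable (fun θ => Real.log |(x - A) / h - Real.cos θ|) volume 0 Real.pi :=
    (intervalIntegrable_log_abs_sub_cos _).mono_set (by
      rw [uIcc_of_le hpi.le, uIcc_of_le (by linarith)]; exact Icc_subset_Icc_right (by linarith))
  have e : ∀ᵐ θ : ℝ, Real.log (1 / |x - (A + h * Real.cos θ)|)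
      = -Real.log h - Real.log |(x - A) / h - Real.cos θ| := by
    filter_upwards [ae_cos_ne ((x - A) / h)] with θ hθ
    rw [log_one_div_abs, show x - (A + h * Real.cos θ) = h * ((x - A) / h - Real.cos θ) by
      field_simp; ring, abs_mul, abs_of_pos hh, Real.log_mul hh.ne' (abs_ne_zero.2 hθ)]
    ring
  rw [← integral_Ioc_eq_integral_Ioo, ← intervalIntegral.integral_of_le hpi.le,
    intervalIntegral.integral_congr_ae_restrict (ae_restrict_of_ae e),
    intervalIntegral.integral_sub intervalIntegrable_const i1, integral_log_abs_sub_cos,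
    intervalIntegral.integral_const]
  simp only [smul_eq_mul, sub_zero]
  ring

/-! ### Arcsine densities -/

/-- Substitution `y = A + h cos θ`. Outside the band the square root of a negative number is `0`
with inverse `0`, so no indicator is needed. -/
theorem lintegral_arcsine_comp {h : ℝ} (hh : 0 < h) (A : ℝ) (F : ℝ → ENNReal) :
    ∫⁻ θ in Ioo 0 Real.pi, F (A + h * Real.cos θ)
      = ∫⁻ y, ENNReal.ofReal ((√(h ^ 2 - (y - A) ^ 2))⁻¹) * F y := by
  have himg : (fun θ => A + h * Real.cos θ) '' Ioo 0 Real.pi = Ioo (A - h) (A + h) := by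
    ext y
    constructor
    · rintro ⟨θ, hθ, rfl⟩
      have h1 : Real.cos θ < 1 := by
        have := Real.cos_lt_cos_of_nonneg_of_le_pi le_rfl hθ.2.le hθ.1
        rwa [Real.cos_zero] at this
      have h2 : -1 < Real.cos θ := by
        have := Real.cos_lt_cos_of_nonneg_of_le_pi hθ.1.le le_rfl hθ.2
        rwa [Real.cos_pi] at this
      constructor <;> simp only <;> nlinarith
    · rintro ⟨h1, h2⟩
      have b1 : -1 < (y - A) / h := by rw [lt_div_iff₀ hh]; linarith
      have b2 : (y - A) / h < 1 := by rw [div_lt_iff₀ hh]; linarith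
      refine ⟨Real.arccos ((y - A) / h), ⟨Real.arccos_pos.2 b2, Real.arccos_lt_pi.2 b1⟩, ?_⟩
      simp only
      rw [Real.cos_arccos b1.le b2.le]
      field_simp; ring
  have hinj : InjOn (fun θ => A + h * Real.cos θ) (Ioo 0 Real.pi) := by
    intro a ha b hb hab
    have : Real.cos a = Real.cos b := by
      simp only at hab
      have : h * Real.cos a = h * Real.cos b := by linarith
      exact mul_left_cancel₀ hh.ne' this
    exact Real.injOn_cos (Ioo_subset_Icc_self ha) (Ioo_subset_Icc_self hb) this
  have hcv := lintegral_image_eq_lintegral_abs_deriv_mul measurableSet_Ioo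
    (f := fun θ => A + h * Real.cos θ) (f' := fun θ => h * -Real.sin θ)
    (fun θ _ => (((Real.hasDerivAt_cos θ).const_mul h).const_add A).hasDerivWithinAt) hinj
    (fun y => ENNReal.ofReal ((√(h ^ 2 - (y - A) ^ 2))⁻¹) * F y)
  rw [himg] at hcv
  have e1 : ∫⁻ y, ENNReal.ofReal ((√(h ^ 2 - (y - A) ^ 2))⁻¹) * F y
      = ∫⁻ y in Ioo (A - h) (A + h), ENNReal.ofReal ((√(h ^ 2 - (y - A) ^ 2))⁻¹) * F y := by
    rw [← lintegral_indicator measurableSet_Ioo]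
    refine lintegral_congr fun y => ?_
    by_cases hy : y ∈ Ioo (A - h) (A + h)
    · rw [indicator_of_mem hy]
    · rw [indicator_of_notMem hy, Real.sqrt_eq_zero_of_nonpos, inv_zero, ENNReal.ofReal_zero,
        zero_mul]
      have : h ≤ |y - A| := by
        by_contra! hc
        obtain ⟨c1, c2⟩ := abs_lt.1 hc
        exact hy ⟨by linarith, by linarith⟩
      have := sq_le_sq' (by linarith) this
      rw [sq_abs] at this
      linarith
  rw [e1, hcv]
  refine setLIntegral_congr_fun measurableSet_Ioo fun θ hθ => ?_
  have hs : 0 < Real.sin θ := Real.sin_pos_of_mem_Ioo hθ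
  have e2 : √(h ^ 2 - (A + h * Real.cos θ - A) ^ 2) = h * Real.sin θ := by
    rw [show h ^ 2 - (A + h * Real.cos θ - A) ^ 2 = (h * Real.sin θ) ^ 2 by
      have := Real.sin_sq_add_cos_sq θ
      linear_combination (-h ^ 2) * this]
    exact Real.sqrt_sq (by positivity)
  rw [e2, ← mul_assoc, ← ENNReal.ofReal_mul (abs_nonneg _), abs_mul, abs_neg, abs_of_pos hh,
    abs_of_pos hs, mul_inv_cancel₀ (by positivity), ENNReal.ofReal_one, one_mul]

/-- `Real.arcsin` is constant beyond `±1` and the integrand is then `0` by convention, so the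
antiderivative is valid on the whole line except at the two points `c ± R`. -/
theorem lintegral_inv_sqrt {R : ℝ} (hR : 0 < R) (c : ℝ) {α γ : ℝ} (hαγ : α ≤ γ) :
    ∫⁻ s in Ioo α γ, ENNReal.ofReal ((√(R ^ 2 - (s - c) ^ 2))⁻¹)
      = ENNReal.ofReal (Real.arcsin ((γ - c) / R) - Real.arcsin ((α - c) / R)) := by
  set f : ℝ → ℝ := fun s => Real.arcsin ((s - c) / R) with hf
  have hcont : Continuous f := Real.continuous_arcsin.comp (by fun_prop)
  have hmono : Monotone f := fun s t hst => Real.monotone_arcsin (by gcongr)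
  have hcount : ({c - R, c + R} : Set ℝ).Countable := (countable_singleton _).insert _
  have hderiv : ∀ s ∉ ({c - R, c + R} : Set ℝ),
      HasDerivAt f ((√(R ^ 2 - (s - c) ^ 2))⁻¹) s := by
    intro s hs
    have h1 : (s - c) / R ≠ -1 := by
      intro h; rw [div_eq_iff hR.ne'] at h
      exact hs (Or.inl (by linarith))
    have h2 : (s - c) / R ≠ 1 := by
      intro h; rw [div_eq_iff hR.ne'] at h
      exact hs (Or.inr (by simp; linarith))
    have := (Real.hasDerivAt_arcsin h1 h2).comp s
      (((hasDerivAt_id s).sub_const c).div_const R)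
    refine this.congr_deriv ?_
    have e : R ^ 2 - (s - c) ^ 2 = R ^ 2 * (1 - ((s - c) / R) ^ 2) := by field_simp
    rw [e, Real.sqrt_mul (by positivity), Real.sqrt_sq hR.le, mul_inv]
    simp only [one_div]
    ring
  -- The integrand is unbounded at `c ± R`; it is integrable as the derivative almost everywhere of
  -- a monotone function.
  have hint : IntervalIntegrable (fun s => (√(R ^ 2 - (s - c) ^ 2))⁻¹) volume α γ := by
    refine ((hmono.monotoneOn _).intervalIntegrable_deriv (a := α) (b := γ)).congr_ae ?_
    refine ae_restrict_of_ae ?_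
    filter_upwards [hcount.ae_notMem volume] with s hs using (hderiv s hs).deriv
  have hFTC := MeasureTheory.integral_eq_of_hasDerivAt_off_countable f
    (fun s => (√(R ^ 2 - (s - c) ^ 2))⁻¹) hcount hcont.continuousOn
    (fun s hs => hderiv s hs.2) hint
  rw [← restrict_Ioo_eq_restrict_Ioc.symm, ← hFTC, intervalIntegral.integral_of_le hαγ,
    ofReal_integral_eq_lintegral_ofReal hint.1 (ae_of_all _ fun s => inv_nonneg.2 (Real.sqrt_nonneg _))]

/-! ### The Meixner equilibrium measure as a mixture of arcsine laws -/

/-- Centre of the band at mass `s`. -/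
noncomputable def bandCenter (p β s : ℝ) : ℝ := (s + β * (s + p)) / (1 - β)

/-- Half-width of the band at mass `s`. -/
noncomputable def bandHalf (p β s : ℝ) : ℝ := 2 * √(s * β * (s + p)) / (1 - β)

/-- Centre of the set of masses whose band contains `x`. -/
noncomputable def dualCenter (p β x : ℝ) : ℝ := (β * p + (1 + β) * x) / (1 - β)

/-- Half-width of the set of masses whose band contains `x`. -/
noncomputable def dualHalf (p β x : ℝ) : ℝ := 2 * √(β * x * (x + p)) / (1 - β)

/-- The density of the equilibrium measure. -/
noncomputable def meixnerDensity (p β x : ℝ) : ℝ :=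
  if 0 < x then 1 / 2 + Real.arcsin ((1 - dualCenter p β x) / dualHalf p β x) / Real.pi else 0

/-- The equilibrium measure. -/
noncomputable def meixnerMeasure (p β : ℝ) : Measure ℝ :=
  volume.withDensity (fun x => ENNReal.ofReal (meixnerDensity p β x))

theorem bandHalf_sq {p β s : ℝ} (hp : 0 < p) (hβ : 0 < β) (hs : 0 ≤ s) :
    bandHalf p β s ^ 2 = 4 * (s * β * (s + p)) / (1 - β) ^ 2 := by
  rw [bandHalf, div_pow, mul_pow, Real.sq_sqrt (by positivity)]; norm_num

theorem dualHalf_sq {p β x : ℝ} (hp : 0 < p) (hβ : 0 < β) (hx : 0 ≤ x) :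
    dualHalf p β x ^ 2 = 4 * (β * x * (x + p)) / (1 - β) ^ 2 := by
  rw [dualHalf, div_pow, mul_pow, Real.sq_sqrt (by positivity)]; norm_num

theorem bandHalf_pos {p β s : ℝ} (hp : 0 < p) (hβ : 0 < β) (hβ1 : β < 1) (hs : 0 < s) :
    0 < bandHalf p β s := by
  have : 0 < 1 - β := by linarith
  unfold bandHalf; positivity

theorem dualHalf_pos {p β x : ℝ} (hp : 0 < p) (hβ : 0 < β) (hβ1 : β < 1) (hx : 0 < x) :
    0 < dualHalf p β x := by
  have : 0 < 1 - β := by linarith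
  unfold dualHalf; positivity

/-- One quadratic polynomial in `(s, x)`, with both squares having coefficient `-1`, completed to a
square in either variable. It exchanges the roles of position and mass. -/
theorem radicand_eq {p β s x : ℝ} (hp : 0 < p) (hβ : 0 < β) (hβ1 : β < 1) (hs : 0 ≤ s)
    (hx : 0 ≤ x) : bandHalf p β s ^ 2 - (x - bandCenter p β s) ^ 2
      = dualHalf p β x ^ 2 - (s - dualCenter p β x) ^ 2 := by
  have : 1 - β ≠ 0 := by linarith
  rw [bandHalf_sq hp hβ hs, dualHalf_sq hp hβ hx, bandCenter, dualCenter]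
  field_simp; ring

theorem bandHalf_le_bandCenter {p β s : ℝ} (hp : 0 < p) (hβ : 0 < β) (hβ1 : β < 1) (hs : 0 ≤ s) :
    bandHalf p β s ≤ bandCenter p β s := by
  have h1 : 0 < 1 - β := by linarith
  refine le_of_sq_le_sq ?_ (by unfold bandCenter; positivity)
  rw [bandHalf_sq hp hβ hs, bandCenter, div_pow]
  gcongr
  nlinarith [sq_nonneg (s - β * (s + p))]

theorem dualHalf_le_dualCenter {p β x : ℝ} (hp : 0 < p) (hβ : 0 < β) (hβ1 : β < 1) (hx : 0 ≤ x) :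
    dualHalf p β x ≤ dualCenter p β x := by
  have h1 : 0 < 1 - β := by linarith
  refine le_of_sq_le_sq ?_ (by unfold dualCenter; positivity)
  rw [dualHalf_sq hp hβ hx, dualCenter, div_pow]
  gcongr
  nlinarith [sq_nonneg (x - β * (x + p))]

theorem meixnerDensity_mem (p β x : ℝ) : meixnerDensity p β x ∈ Icc (0 : ℝ) 1 := by
  unfold meixnerDensity
  split_ifs with h
  · have h1 := Real.neg_pi_div_two_le_arcsin ((1 - dualCenter p β x) / dualHalf p β x)
    have h2 := Real.arcsin_le_pi_div_two ((1 - dualCenter p β x) / dualHalf p β x)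
    have hpi := Real.pi_pos
    constructor
    · have : -(1 / 2) ≤ Real.arcsin ((1 - dualCenter p β x) / dualHalf p β x) / Real.pi := by
        rw [le_div_iff₀ hpi]; linarith
      linarith
    · have : Real.arcsin ((1 - dualCenter p β x) / dualHalf p β x) / Real.pi ≤ 1 / 2 := by
        rw [div_le_iff₀ hpi]; linarith
      linarith
  · exact ⟨le_rfl, zero_le_one⟩

theorem continuous_bandCenter (p β : ℝ) : Continuous (bandCenter p β) := by
  unfold bandCenter; fun_prop

theorem continuous_bandHalf (p β : ℝ) : Continuous (bandHalf p β) := by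
  unfold bandHalf; fun_prop

theorem continuous_dualCenter (p β : ℝ) : Continuous (dualCenter p β) := by
  unfold dualCenter; fun_prop

theorem continuous_dualHalf (p β : ℝ) : Continuous (dualHalf p β) := by
  unfold dualHalf; fun_prop

theorem measurable_meixnerDensity (p β : ℝ) : Measurable (meixnerDensity p β) := by
  unfold meixnerDensity
  have h1 := (continuous_dualCenter p β).measurable
  have h2 := (continuous_dualHalf p β).measurable
  exact Measurable.ite measurableSet_Ioi (measurable_const.add
    ((Real.measurable_arcsin.comp ((measurable_const.sub h1).div h2)).div_const _)) measurable_const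

theorem continuousOn_meixnerDensity {p β : ℝ} (hp : 0 < p) (hβ : 0 < β) (hβ1 : β < 1) :
    ContinuousOn (meixnerDensity p β) (Ioi 0) := by
  have h : ContinuousOn (fun x => 1 / 2 +
      Real.arcsin ((1 - dualCenter p β x) / dualHalf p β x) / Real.pi) (Ioi 0) := by
    refine continuousOn_const.add (ContinuousOn.div_const ?_ _)
    refine Real.continuous_arcsin.comp_continuousOn (ContinuousOn.div ?_ ?_ fun x hx =>
      (dualHalf_pos hp hβ hβ1 hx).ne')
    · exact (continuous_const.sub (continuous_dualCenter p β)).continuousOn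
    · exact (continuous_dualHalf p β).continuousOn
  refine h.congr fun x hx => ?_
  rw [meixnerDensity, if_pos (show 0 < x from hx)]

theorem lintegral_mass_eq_density {p β y : ℝ} (hp : 0 < p) (hβ : 0 < β) (hβ1 : β < 1) :
    ∫⁻ s in Ioo 0 1, ENNReal.ofReal ((√(bandHalf p β s ^ 2 - (y - bandCenter p β s) ^ 2))⁻¹)
      = ENNReal.ofReal (Real.pi * meixnerDensity p β y) := by
  have hpi := Real.pi_pos
  rw [meixnerDensity]
  split_ifs with hy
  · have hR := dualHalf_pos hp hβ hβ1 hy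
    have e : Real.arcsin ((0 - dualCenter p β y) / dualHalf p β y) = -(Real.pi / 2) := by
      refine Real.arcsin_of_le_neg_one ?_
      rw [div_le_iff₀ hR]
      linarith [dualHalf_le_dualCenter hp hβ hβ1 hy.le]
    have := lintegral_inv_sqrt hR (dualCenter p β y) (zero_le_one (α := ℝ))
    rw [e] at this
    rw [show Real.pi * (1 / 2 + Real.arcsin ((1 - dualCenter p β y) / dualHalf p β y) / Real.pi)
      = Real.arcsin ((1 - dualCenter p β y) / dualHalf p β y) - -(Real.pi / 2) by
        field_simp; ring, ← this]
    refine setLIntegral_congr_fun measurableSet_Ioo fun s hs => ?_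
    rw [radicand_eq hp hβ hβ1 hs.1.le hy.le]
  · rw [mul_zero, ENNReal.ofReal_zero]
    refine (setLIntegral_congr_fun measurableSet_Ioo (g := fun _ => 0) fun s hs => ?_).trans
      (by simp)
    have h1 := bandHalf_le_bandCenter hp hβ hβ1 hs.1.le
    have h2 := (bandHalf_pos hp hβ hβ1 hs.1).le
    simp only
    rw [Real.sqrt_eq_zero_of_nonpos (by push Not at hy; nlinarith), inv_zero, ENNReal.ofReal_zero]

/-- Tonelli identifies the measure with the given density as the mixture of arcsine laws; in
particular its total mass is `1`. -/
theorem lintegral_meixnerMeasure {p β : ℝ} (hp : 0 < p) (hβ : 0 < β) (hβ1 : β < 1)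
    {F : ℝ → ENNReal} (hF : Measurable F) :
    ∫⁻ y, F y ∂(meixnerMeasure p β) = ENNReal.ofReal (1 / Real.pi) * ∫⁻ s in Ioo 0 1,
      ∫⁻ θ in Ioo 0 Real.pi, F (bandCenter p β s + bandHalf p β s * Real.cos θ) := by
  have hpi := Real.pi_pos
  have hA := (continuous_bandCenter p β).measurable
  have hH := (continuous_bandHalf p β).measurable
  have e1 : ∫⁻ s in Ioo 0 1, ∫⁻ θ in Ioo 0 Real.pi,
      F (bandCenter p β s + bandHalf p β s * Real.cos θ)
      = ∫⁻ s in Ioo 0 1, ∫⁻ y,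
        ENNReal.ofReal ((√(bandHalf p β s ^ 2 - (y - bandCenter p β s) ^ 2))⁻¹) * F y :=
    setLIntegral_congr_fun measurableSet_Ioo fun s hs =>
      lintegral_arcsine_comp (bandHalf_pos hp hβ hβ1 hs.1) _ F
  have hmeas : Measurable (fun q : ℝ × ℝ => ENNReal.ofReal
      ((√(bandHalf p β q.1 ^ 2 - (q.2 - bandCenter p β q.1) ^ 2))⁻¹)) := by
    refine ENNReal.measurable_ofReal.comp (Measurable.inv (Real.continuous_sqrt.measurable.comp ?_))
    exact ((hH.comp measurable_fst).pow_const 2).sub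
      ((measurable_snd.sub (hA.comp measurable_fst)).pow_const 2)
  rw [e1, lintegral_lintegral_swap
    (hmeas.mul (hF.comp measurable_snd)).aemeasurable]
  have e2 : ∀ y, ∫⁻ s in Ioo 0 1,
      ENNReal.ofReal ((√(bandHalf p β s ^ 2 - (y - bandCenter p β s) ^ 2))⁻¹) * F y
      = ENNReal.ofReal (Real.pi * meixnerDensity p β y) * F y := by
    intro y
    have hm : Measurable (fun s => ENNReal.ofReal
      ((√(bandHalf p β s ^ 2 - (y - bandCenter p β s) ^ 2))⁻¹)) :=
      ENNReal.measurable_ofReal.comp (Measurable.inv (Real.continuous_sqrt.measurable.comp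
        ((hH.pow_const 2).sub ((measurable_const.sub hA).pow_const 2))))
    rw [lintegral_mul_const _ hm,
      lintegral_mass_eq_density hp hβ hβ1]
  simp_rw [e2]
  rw [meixnerMeasure, lintegral_withDensity_eq_lintegral_mul _
    (measurable_meixnerDensity p β).ennreal_ofReal hF, ← lintegral_const_mul]
  · refine lintegral_congr fun y => ?_
    rw [Pi.mul_apply, ← mul_assoc, ← ENNReal.ofReal_mul (by positivity)]
    congr 2
    field_simp
  · exact ((measurable_meixnerDensity p β).const_mul _).ennreal_ofReal.mul hF

theorem isProbabilityMeasure_meixner {p β : ℝ} (hp : 0 < p) (hβ : 0 < β) (hβ1 : β < 1) :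
    IsProbabilityMeasure (meixnerMeasure p β) := by
  constructor
  have := lintegral_meixnerMeasure hp hβ hβ1 (F := fun _ => 1) measurable_const
  rw [lintegral_one] at this
  rw [this]
  simp only [lintegral_const, Measure.restrict_apply MeasurableSet.univ, univ_inter, one_mul,
    Real.volume_Ioo, sub_zero]
  rw [ENNReal.ofReal_one, mul_one, ← ENNReal.ofReal_mul (by have := Real.pi_pos; positivity),
    one_div_mul_cancel Real.pi_ne_zero, ENNReal.ofReal_one]

/-- The mixture as a push-forward, a form in which Fubini applies to the signed logarithmic kernel.
-/
theorem meixnerMeasure_eq_map {p β : ℝ} (hp : 0 < p) (hβ : 0 < β) (hβ1 : β < 1) :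
    meixnerMeasure p β = ENNReal.ofReal (1 / Real.pi) •
      ((volume.restrict (Ioo (0 : ℝ) 1)).prod (volume.restrict (Ioo 0 Real.pi))).map
        (fun q : ℝ × ℝ => bandCenter p β q.1 + bandHalf p β q.1 * Real.cos q.2) := by
  have hT : Measurable (fun q : ℝ × ℝ => bandCenter p β q.1 + bandHalf p β q.1 * Real.cos q.2) :=
    (((continuous_bandCenter p β).comp continuous_fst).add
      (((continuous_bandHalf p β).comp continuous_fst).mul
        (Real.continuous_cos.comp continuous_snd))).measurable
  refine Measure.ext fun S hS => ?_
  have h := lintegral_meixnerMeasure hp hβ hβ1 (F := S.indicator 1) (measurable_one.indicator hS)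
  rw [lintegral_indicator_one hS] at h
  rw [h, Measure.smul_apply, smul_eq_mul, ← lintegral_indicator_one hS,
    lintegral_map (measurable_one.indicator hS) hT]
  exact congrArg _ (lintegral_prod _ ((measurable_one.indicator hS).comp hT).aemeasurable).symm

theorem meixnerMeasure_le_volume (p β : ℝ) : meixnerMeasure p β ≤ volume := by
  calc meixnerMeasure p β ≤ volume.withDensity 1 := by
        refine withDensity_mono (ae_of_all _ fun x => ?_)
        exact ENNReal.ofReal_le_one.2 (meixnerDensity_mem p β x).2
    _ = volume := withDensity_one

theorem meixnerMeasure_Iio_zero (p β : ℝ) : meixnerMeasure p β (Iio 0) = 0 := by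
  rw [meixnerMeasure, withDensity_apply _ measurableSet_Iio]
  refine (setLIntegral_congr_fun measurableSet_Iio (g := fun _ => 0) fun x hx => ?_).trans (by simp)
  simp only
  rw [meixnerDensity, if_neg (not_lt.2 (le_of_lt hx)), ENNReal.ofReal_zero]

theorem isAdmissible_meixner {p β : ℝ} (hp : 0 < p) (hβ : 0 < β) (hβ1 : β < 1) :
    IsAdmissible (meixnerMeasure p β) where
  isProbabilityMeasure := isProbabilityMeasure_meixner hp hβ hβ1
  nonneg := meixnerMeasure_Iio_zero p β
  upper_constraint a b _ _ := (meixnerMeasure_le_volume p β _).trans (by rw [Real.volume_Icc])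

theorem logPotential_meixner {p β : ℝ} (hp : 0 < p) (hβ : 0 < β) (hβ1 : β < 1)
    (hm : Integrable (fun y => y) (meixnerMeasure p β)) (x : ℝ) :
    IntervalIntegrable (fun s => Real.log 2 - Real.log (bandHalf p β s)
      - arcoshLog ((x - bandCenter p β s) / bandHalf p β s)) volume 0 1 ∧
    logPotential (meixnerMeasure p β) x = ∫ s in (0 : ℝ)..1, (Real.log 2
      - Real.log (bandHalf p β s) - arcoshLog ((x - bandCenter p β s) / bandHalf p β s)) := by
  have hpi := Real.pi_pos
  have := isProbabilityMeasure_meixner hp hβ hβ1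
  have hT : Measurable (fun q : ℝ × ℝ => bandCenter p β q.1 + bandHalf p β q.1 * Real.cos q.2) :=
    (((continuous_bandCenter p β).comp continuous_fst).add
      (((continuous_bandHalf p β).comp continuous_fst).mul
        (Real.continuous_cos.comp continuous_snd))).measurable
  have hmeas : Measurable (fun y => Real.log (1 / |x - y|)) :=
    measurable_log_one_div_sub.comp (measurable_const.prodMk measurable_id)
  have hi := integrable_log_sub (meixnerMeasure_le_volume p β) hm x
  rw [meixnerMeasure_eq_map hp hβ hβ1, integrable_smul_measure (by simp [hpi]) (by simp),
    integrable_map_measure hmeas.aestronglyMeasurable hT.aemeasurable] at hi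
  have hE : ∀ s ∈ Ioo (0 : ℝ) 1, ∫ θ in Ioo 0 Real.pi,
      Real.log (1 / |x - (bandCenter p β s + bandHalf p β s * Real.cos θ)|)
      = Real.pi * (Real.log 2 - Real.log (bandHalf p β s)
        - arcoshLog ((x - bandCenter p β s) / bandHalf p β s)) := fun s hs =>
    integral_log_arcsine (bandHalf_pos hp hβ hβ1 hs.1) _ _
  constructor
  · have h1 := hi.integral_prod_left
    have h2 : IntegrableOn (fun s => Real.pi * (Real.log 2 - Real.log (bandHalf p β s)
        - arcoshLog ((x - bandCenter p β s) / bandHalf p β s))) (Ioo 0 1) :=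
      (integrableOn_congr_fun hE measurableSet_Ioo).1 h1
    rw [intervalIntegrable_iff_integrableOn_Ioo_of_le zero_le_one]
    have h3 : IntegrableOn (fun s => Real.pi⁻¹ * (Real.pi * (Real.log 2
        - Real.log (bandHalf p β s) - arcoshLog ((x - bandCenter p β s) / bandHalf p β s))))
        (Ioo 0 1) := h2.const_mul _
    refine h3.congr_fun (fun s _ => ?_) measurableSet_Ioo
    exact inv_mul_cancel_left₀ Real.pi_ne_zero _
  · rw [logPotential, meixnerMeasure_eq_map hp hβ hβ1, integral_smul_measure,
      integral_map hT.aemeasurable hmeas.aestronglyMeasurable]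
    refine (congrArg _ (integral_prod _ hi)).trans ?_
    refine (congrArg _ (setIntegral_congr_fun measurableSet_Ioo hE)).trans ?_
    rw [integral_const_mul, intervalIntegral.integral_of_le zero_le_one,
      integral_Ioc_eq_integral_Ioo, ENNReal.toReal_ofReal (by positivity), smul_eq_mul, ← mul_assoc,
      one_div_mul_cancel Real.pi_ne_zero, one_mul]

/-! ### The Euler–Lagrange conditions of the Meixner measure -/

/-- The function is `artanh (D/L)`, since `H = (L + D)(L - D)`. It is applied to three linear forms
`L` (one constant `H`) sharing the same `D = √disc`. -/
theorem hasDerivAt_log_add_sub {L D H : ℝ → ℝ} {L' D' H' s : ℝ} (hL : HasDerivAt L L' s)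
    (hD : HasDerivAt D D' s) (hH : HasDerivAt H H' s) (hLD : 0 < L s + D s) (hH0 : H s ≠ 0)
    (hHeq : H s = L s ^ 2 - D s ^ 2) (hH' : H' = 2 * L s * L' - 2 * D s * D') :
    HasDerivAt (fun s => Real.log (L s + D s) - 1 / 2 * Real.log (H s))
      ((D' * L s - L' * D s) / H s) s := by
  have h1 : HasDerivAt (fun s => Real.log (L s + D s)) ((L' + D') / (L s + D s)) s :=
    (hL.add hD).log hLD.ne'
  refine (h1.sub ((hH.log hH0).const_mul (1 / 2))).congr_deriv ?_
  have e : H s = (L s + D s) * (L s - D s) := by rw [hHeq]; ring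
  have hne : L s - D s ≠ 0 := by
    intro h; rw [e, h, mul_zero] at hH0; exact hH0 rfl
  have hne' := hLD.ne'
  rw [e, hH']
  field_simp
  ring

theorem log_sub_half_log_sq {L H : ℝ} (hH : H = L ^ 2) :
    Real.log L - 1 / 2 * Real.log H = 0 := by
  rw [hH, Real.log_pow]; push_cast; ring

/-- The linear form whose square minus the discriminant is `4 (x+p) (s+p) / (1-β)`. -/
noncomputable def auxForm (p β x s : ℝ) : ℝ := x + s + (2 - β) * p / (1 - β)

/-- The discriminant `(s - c)² - R²`. -/
noncomputable def disc (p β x s : ℝ) : ℝ := (s - dualCenter p β x) ^ 2 - dualHalf p β x ^ 2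

section

variable {p β x : ℝ}

theorem disc_eq_band (hp : 0 < p) (hβ : 0 < β) (hβ1 : β < 1) (hx : 0 < x) {s : ℝ} (hs : 0 ≤ s) :
    disc p β x s = (x - bandCenter p β s) ^ 2 - 4 * (s * β * (s + p)) / (1 - β) ^ 2 := by
  have := radicand_eq hp hβ hβ1 hs hx.le
  rw [← bandHalf_sq hp hβ hs, disc]
  linarith

theorem auxForm_sq (hp : 0 < p) (hβ : 0 < β) (hβ1 : β < 1) (hx : 0 < x) (s : ℝ) :
    4 * (x + p) * (s + p) / (1 - β) = auxForm p β x s ^ 2 - disc p β x s := by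
  have : 1 - β ≠ 0 := by linarith
  rw [disc, dualHalf_sq hp hβ hx.le, dualCenter, auxForm]
  field_simp; ring

theorem disc_nonneg {s : ℝ} (hR : 0 ≤ dualHalf p β x)
    (hs : s ≤ dualCenter p β x - dualHalf p β x) : 0 ≤ disc p β x s := by
  rw [disc, sub_nonneg]
  nlinarith

theorem disc_pos {s : ℝ} (hR : 0 ≤ dualHalf p β x)
    (hs : s < dualCenter p β x - dualHalf p β x) : 0 < disc p β x s := by
  rw [disc, sub_pos]
  nlinarith

theorem disc_pos_of_gt {s : ℝ} (hR : 0 ≤ dualHalf p β x)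
    (hs : dualCenter p β x + dualHalf p β x < s) : 0 < disc p β x s := by
  rw [disc, sub_pos]
  nlinarith

/-- The Green function of the band at mass `s`, as a function of `s`. -/
noncomputable def bandGreen (p β x s : ℝ) : ℝ :=
  arcoshLog ((x - bandCenter p β s) / bandHalf p β s)

theorem bandGreen_nonneg (p β x s : ℝ) : 0 ≤ bandGreen p β x s := arcoshLog_nonneg _

theorem bandGreen_pos (hp : 0 < p) (hβ : 0 < β) (hβ1 : β < 1) (hx : 0 < x) {s : ℝ} (hs : 0 < s)
    (hT : 0 < disc p β x s) : 0 < bandGreen p β x s := by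
  have hh := bandHalf_pos hp hβ hβ1 hs
  refine arcoshLog_pos ?_
  rw [abs_div, abs_of_pos hh, one_lt_div hh]
  refine lt_of_pow_lt_pow_left₀ 2 (abs_nonneg _) ?_
  rw [disc_eq_band hp hβ hβ1 hx hs.le, ← bandHalf_sq hp hβ hs.le] at hT
  rw [sq_abs]; linarith

theorem bandGreen_eq_zero (hp : 0 < p) (hβ : 0 < β) (hβ1 : β < 1) (hx : 0 < x) {s : ℝ}
    (hs : 0 ≤ s) (hs1 : dualCenter p β x - dualHalf p β x ≤ s)
    (hs2 : s ≤ dualCenter p β x + dualHalf p β x) : bandGreen p β x s = 0 := by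
  refine arcoshLog_of_abs_le ?_
  have hT : disc p β x s ≤ 0 := by rw [disc, sub_nonpos]; nlinarith
  rw [disc_eq_band hp hβ hβ1 hx hs, ← bandHalf_sq hp hβ hs] at hT
  rcases hs.eq_or_lt with rfl | hs
  -- At `s = 0` the half-width vanishes, and division by zero gives the argument `0`.
  · simp [bandHalf]
  have hh := bandHalf_pos hp hβ hβ1 hs
  rw [abs_div, abs_of_pos hh, div_le_one hh]
  refine abs_le_of_sq_le_sq ?_ hh.le
  linarith

theorem bandGreen_eq (hp : 0 < p) (hβ : 0 < β) (hβ1 : β < 1) (hx : 0 < x) {s : ℝ} (hs : 0 < s)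
    (hT : 0 ≤ disc p β x s) : bandGreen p β x s
      = Real.log (|x - bandCenter p β s| + √(disc p β x s))
        - 1 / 2 * Real.log (4 * (s * β * (s + p)) / (1 - β) ^ 2) := by
  have hh := bandHalf_pos hp hβ hβ1 hs
  have e0 := disc_eq_band hp hβ hβ1 hx hs.le
  rw [← bandHalf_sq hp hβ hs.le] at e0 ⊢
  have h1 : bandHalf p β s ≤ |x - bandCenter p β s| := by
    refine le_of_sq_le_sq ?_ (abs_nonneg _)
    rw [sq_abs]; linarith
  have h2 : 0 < |x - bandCenter p β s| := hh.trans_le h1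
  have e1 : √(((x - bandCenter p β s) / bandHalf p β s) ^ 2 - 1)
      = √(disc p β x s) / bandHalf p β s := by
    rw [e0, ← Real.sqrt_sq hh.le, ← Real.sqrt_div' _ (by positivity), Real.sqrt_sq hh.le]
    congr 1; field_simp
  rw [bandGreen, arcoshLog, e1, max_eq_right (by rw [abs_div, abs_of_pos hh, one_le_div hh]; exact h1),
    abs_div, abs_of_pos hh, ← add_div, Real.log_div _ hh.ne', Real.log_pow]
  · push_cast; ring
  · have := Real.sqrt_nonneg (disc p β x s); positivity

theorem continuousOn_bandGreen (hp : 0 < p) (hβ : 0 < β) (hβ1 : β < 1) :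
    ContinuousOn (bandGreen p β x) (Ioi 0) := by
  refine continuous_arcoshLog.comp_continuousOn (ContinuousOn.div ?_ ?_ fun s hs =>
    (bandHalf_pos hp hβ hβ1 hs).ne')
  · exact (continuous_const.sub (continuous_bandCenter p β)).continuousOn
  · exact (continuous_bandHalf p β).continuousOn

/-- An antiderivative of the Green function in the mass variable, `ε` being the sign of
`x - bandCenter p β 0`. -/
noncomputable def greenPrimitive (p β x ε s : ℝ) : ℝ :=
  s * (Real.log (ε * (x - bandCenter p β s) + √(disc p β x s))
    - 1 / 2 * Real.log (4 * (s * β * (s + p)) / (1 - β) ^ 2))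
  - ε * (x * (Real.log (dualCenter p β x - s + √(disc p β x s))
      - 1 / 2 * Real.log (dualHalf p β x ^ 2))
    - p * (Real.log (auxForm p β x s + √(disc p β x s))
      - 1 / 2 * Real.log (4 * (x + p) * (s + p) / (1 - β))))

/-- After integrating the Green function by parts, `s` times its derivative is a rational function
of `s` divided by `√disc`; its partial fractions match the other two logarithms of `greenPrimitive`.
-/
theorem greenPrimitive_identity (hp : 0 < p) (hβ : 0 < β) (hβ1 : β < 1) (hx : 0 < x) {s : ℝ}
    (hs : 0 < s) :
    s * (((s - dualCenter p β x) * (x - bandCenter p β s) + (1 + β) / (1 - β) * disc p β x s)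
      / (4 * (s * β * (s + p)) / (1 - β) ^ 2)) + x
    + p * (((s - dualCenter p β x) * auxForm p β x s - disc p β x s)
      / (4 * (x + p) * (s + p) / (1 - β))) = 0 := by
  have h1 : 1 - β ≠ 0 := by linarith
  have h2 : s + p ≠ 0 := by positivity
  have h3 : x + p ≠ 0 := by positivity
  rw [disc, dualHalf_sq hp hβ hx.le, dualCenter, auxForm, bandCenter]
  field_simp
  ring

theorem hasDerivAt_greenPrimitive (hp : 0 < p) (hβ : 0 < β) (hβ1 : β < 1) (hx : 0 < x) {ε s : ℝ}
    (hε : ε ^ 2 = 1) (hs : 0 < s) (hs1 : s < dualCenter p β x - dualHalf p β x)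
    (hL : 0 < ε * (x - bandCenter p β s)) :
    HasDerivAt (greenPrimitive p β x ε)
      (Real.log (ε * (x - bandCenter p β s) + √(disc p β x s))
        - 1 / 2 * Real.log (4 * (s * β * (s + p)) / (1 - β) ^ 2)) s := by
  have h1 : 0 < 1 - β := by linarith
  have hR := dualHalf_pos hp hβ hβ1 hx
  have hT := disc_pos hR.le hs1
  set D := √(disc p β x s) with hD
  have hD0 : 0 < D := Real.sqrt_pos.2 hT
  have hD2 : D ^ 2 = disc p β x s := Real.sq_sqrt hT.le
  have dD : HasDerivAt (fun s => √(disc p β x s)) ((s - dualCenter p β x) / D) s := by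
    have : HasDerivAt (disc p β x) (2 * (s - dualCenter p β x)) s := by
      have := (((hasDerivAt_id s).sub_const (dualCenter p β x)).pow 2).sub_const
        (dualHalf p β x ^ 2)
      refine this.congr_deriv ?_
      simp
    refine (this.sqrt hT.ne').congr_deriv ?_
    rw [← hD]; field_simp
  have dA : HasDerivAt (fun s => ε * (x - bandCenter p β s)) (-(ε * ((1 + β) / (1 - β)))) s := by
    have h : HasDerivAt (bandCenter p β) ((1 + β * 1) / (1 - β)) s :=
      ((hasDerivAt_id s).add (((hasDerivAt_id s).add_const p).const_mul β)).div_const _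
    refine ((h.const_sub x).const_mul ε).congr_deriv ?_
    ring
  have dH1 : HasDerivAt (fun s => 4 * (s * β * (s + p)) / (1 - β) ^ 2)
      (4 * (β * (s + p) + s * β) / (1 - β) ^ 2) s := by
    have h := ((((hasDerivAt_id s).mul_const β).mul ((hasDerivAt_id s).add_const p)).const_mul
      4).div_const ((1 - β) ^ 2)
    refine h.congr_deriv ?_
    simp
  have dC : HasDerivAt (fun s => dualCenter p β x - s) (-1) s :=
    (hasDerivAt_id s).const_sub _
  have dR : HasDerivAt (fun _ : ℝ => dualHalf p β x ^ 2) 0 s := hasDerivAt_const _ _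
  have dM : HasDerivAt (auxForm p β x) 1 s :=
    ((hasDerivAt_id s).const_add x).add_const _
  have dH3 : HasDerivAt (fun s => 4 * (x + p) * (s + p) / (1 - β)) (4 * (x + p) * 1 / (1 - β)) s :=
    (((hasDerivAt_id s).add_const p).const_mul _).div_const _
  have eDD : 2 * D * ((s - dualCenter p β x) / D) = 2 * (s - dualCenter p β x) := by field_simp
  have hCpos : 0 < dualCenter p β x - s := by linarith
  have hMpos : 0 < auxForm p β x s := by
    unfold auxForm
    have : 0 < 2 - β := by linarith
    positivity
  have g1 := hasDerivAt_log_add_sub dA dD dH1 (by positivity) (by positivity) (by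
      rw [mul_pow, hε, Real.sq_sqrt hT.le, disc_eq_band hp hβ hβ1 hx hs.le]; ring) (by
      rw [← hD, eDD, show 2 * (ε * (x - bandCenter p β s)) * -(ε * ((1 + β) / (1 - β)))
        = -2 * ε ^ 2 * ((x - bandCenter p β s) * ((1 + β) / (1 - β))) by ring, hε, bandCenter,
        dualCenter]
      field_simp; ring)
  have g2 := hasDerivAt_log_add_sub dC dD dR (by positivity) (by positivity) (by
      rw [Real.sq_sqrt hT.le, disc]; ring) (by rw [← hD, eDD]; ring)
  have g3 := hasDerivAt_log_add_sub dM dD dH3 (by positivity) (by positivity) (by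
      rw [Real.sq_sqrt hT.le, auxForm_sq hp hβ hβ1 hx]) (by
      rw [← hD, eDD, auxForm, dualCenter]
      field_simp; ring)
  have tot := ((hasDerivAt_id s).mul g1).sub (((g2.const_mul x).sub (g3.const_mul p)).const_mul ε)
  refine tot.congr_deriv ?_
  simp only [id, ← hD]
  have key := greenPrimitive_identity hp hβ hβ1 hx hs
  have e1 : ((s - dualCenter p β x) / D * (ε * (x - bandCenter p β s))
      - -(ε * ((1 + β) / (1 - β))) * D)
      = ε / D * ((s - dualCenter p β x) * (x - bandCenter p β s)
        + (1 + β) / (1 - β) * disc p β x s) := by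
    rw [← hD2]; field_simp; ring
  have e2 : ((s - dualCenter p β x) / D * (dualCenter p β x - s) - -1 * D) / dualHalf p β x ^ 2
      = - (1 / D) := by
    have : dualHalf p β x ^ 2 = (s - dualCenter p β x) ^ 2 - D ^ 2 := by rw [hD2, disc]; ring
    rw [div_eq_iff (by positivity), this]
    field_simp; ring
  have e3 : ((s - dualCenter p β x) / D * auxForm p β x s - 1 * D)
      = 1 / D * ((s - dualCenter p β x) * auxForm p β x s - disc p β x s) := by
    rw [← hD2]; field_simp
  rw [e1, e2, e3, mul_div_assoc, mul_div_assoc]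
  -- The derivatives of the three logarithms have been brought to the common factor `1/D`, so the
  -- algebraic remainder is `ε / D` times the identity.
  linear_combination (ε / D) * key

theorem continuousOn_greenPrimitive (hp : 0 < p) (hβ : 0 < β) (hβ1 : β < 1) (hx : 0 < x) {ε : ℝ}
    (hL : ∀ s ∈ Icc 0 (dualCenter p β x - dualHalf p β x), 0 < ε * (x - bandCenter p β s)) :
    ContinuousOn (greenPrimitive p β x ε) (Icc 0 (dualCenter p β x - dualHalf p β x)) := by
  have h1 : 0 < 1 - β := by linarith
  have hR := dualHalf_pos hp hβ hβ1 hx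
  have cD : Continuous (fun s => √(disc p β x s)) := by unfold disc; fun_prop
  have cA := continuous_bandCenter p β
  have cM : Continuous (auxForm p β x) := by unfold auxForm; fun_prop
  have l1 : ContinuousOn (fun s => Real.log (ε * (x - bandCenter p β s) + √(disc p β x s)))
      (Icc 0 (dualCenter p β x - dualHalf p β x)) :=
    ContinuousOn.log (by fun_prop) fun s hs => by
      have := hL s hs; have := Real.sqrt_nonneg (disc p β x s); positivity
  have l2 : ContinuousOn (fun s => Real.log (dualCenter p β x - s + √(disc p β x s)))
      (Icc 0 (dualCenter p β x - dualHalf p β x)) :=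
    ContinuousOn.log (by fun_prop) fun s hs => by
      have := hs.2; have := Real.sqrt_nonneg (disc p β x s)
      have : 0 < dualCenter p β x - s := by linarith
      positivity
  have l3 : ContinuousOn (fun s => Real.log (auxForm p β x s + √(disc p β x s)))
      (Icc 0 (dualCenter p β x - dualHalf p β x)) :=
    ContinuousOn.log (by fun_prop) fun s hs => by
      have := hs.1; have := Real.sqrt_nonneg (disc p β x s)
      have : 0 < 2 - β := by linarith
      unfold auxForm; positivity
  have l4 : ContinuousOn (fun s => Real.log (4 * (x + p) * (s + p) / (1 - β)))
      (Icc 0 (dualCenter p β x - dualHalf p β x)) :=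
    ContinuousOn.log (by fun_prop) fun s hs => by
      have := hs.1; positivity
  have l5 : ContinuousOn (fun s => s * Real.log (4 * (s * β * (s + p)) / (1 - β) ^ 2))
      (Icc 0 (dualCenter p β x - dualHalf p β x)) := by
    have h : ContinuousOn (fun s => s * Real.log s + s * Real.log (4 * β * (s + p) / (1 - β) ^ 2))
        (Icc 0 (dualCenter p β x - dualHalf p β x)) := by
      refine Real.continuous_mul_log.continuousOn.add (continuousOn_id.mul ?_)
      exact ContinuousOn.log (by fun_prop) fun s hs => by have := hs.1; positivity
    refine h.congr fun s hs => ?_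
    rcases hs.1.eq_or_lt with rfl | h0
    · simp
    · rw [show 4 * (s * β * (s + p)) / (1 - β) ^ 2 = s * (4 * β * (s + p) / (1 - β) ^ 2) by ring,
        Real.log_mul h0.ne' (by positivity)]
      ring
  have e : greenPrimitive p β x ε = fun s =>
      s * Real.log (ε * (x - bandCenter p β s) + √(disc p β x s))
      - 1 / 2 * (s * Real.log (4 * (s * β * (s + p)) / (1 - β) ^ 2))
      - ε * (x * (Real.log (dualCenter p β x - s + √(disc p β x s))
        - 1 / 2 * Real.log (dualHalf p β x ^ 2))
      - p * (Real.log (auxForm p β x s + √(disc p β x s))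
        - 1 / 2 * Real.log (4 * (x + p) * (s + p) / (1 - β)))) := by
    funext s; unfold greenPrimitive; ring
  rw [e]
  exact ((continuousOn_id.mul l1).sub (l5.const_mul _)).sub ((((l2.sub continuousOn_const).const_mul
    x).sub ((l3.sub (l4.const_mul _)).const_mul p)).const_mul ε)

/-- At this mass `disc = 0`, so each of the three functions `artanh (D/L)` vanishes. -/
theorem greenPrimitive_edge (hp : 0 < p) (hβ : 0 < β) (hβ1 : β < 1) (hx : 0 < x) {ε s : ℝ}
    (hε : ε ^ 2 = 1) (hs : 0 ≤ s) (hs1 : s = dualCenter p β x - dualHalf p β x) :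
    greenPrimitive p β x ε s = 0 := by
  have hT : disc p β x s = 0 := by rw [disc, hs1]; ring
  have e1 := disc_eq_band hp hβ hβ1 hx hs
  have e3 := auxForm_sq hp hβ hβ1 hx s
  rw [hT] at e1 e3
  rw [greenPrimitive, hT, Real.sqrt_zero, add_zero, add_zero, add_zero,
    log_sub_half_log_sq (by rw [mul_pow, hε]; linarith),
    log_sub_half_log_sq (by rw [hs1]; ring), log_sub_half_log_sq (by linarith)]
  ring

/-- At mass `0` the band is a point and `disc` is a perfect square, so every logarithm becomes
elementary and the external field appears. -/
theorem greenPrimitive_zero (hp : 0 < p) (hβ : 0 < β) (hβ1 : β < 1) (hx : 0 < x) {ε : ℝ}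
    (hε : ε = 1 ∨ ε = -1) (hL : 0 < ε * (x - bandCenter p β 0)) :
    greenPrimitive p β x ε 0
      = -(meixnerField (p + 1) β x - p * Real.log (1 - β)) / 2 := by
  have h1 : 0 < 1 - β := by linarith
  have h1' := h1.ne'
  have hxp : 0 < x + p := by positivity
  have hD : √(disc p β x 0) = ε * (x - bandCenter p β 0) := by
    rw [disc_eq_band hp hβ hβ1 hx le_rfl]
    rcases hε with rfl | rfl
    · rw [← Real.sqrt_sq hL.le, one_mul]
      congr 1; ring
    · rw [← Real.sqrt_sq hL.le]
      congr 1; ring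
  rw [greenPrimitive, hD, dualHalf_sq hp hβ hx.le, meixnerField_eq hp hβ hx.le, zero_mul, zero_sub,
    sub_zero, zero_add]
  have lR : Real.log (4 * (β * x * (x + p)) / (1 - β) ^ 2)
      = 2 * Real.log 2 + Real.log β + Real.log x + Real.log (x + p) - 2 * Real.log (1 - β) := by
    rw [Real.log_div (by positivity) (by positivity), Real.log_mul (by norm_num) (by positivity),
      Real.log_mul (by positivity) (by positivity), Real.log_mul hβ.ne' hx.ne', Real.log_pow,
      show (4 : ℝ) = 2 ^ 2 by norm_num, Real.log_pow]
    push_cast; ring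
  have lM : Real.log (4 * (x + p) * p / (1 - β))
      = 2 * Real.log 2 + Real.log (x + p) + Real.log p - Real.log (1 - β) := by
    rw [Real.log_div (by positivity) h1', Real.log_mul (by positivity) hp.ne',
      Real.log_mul (by norm_num) hxp.ne', show (4 : ℝ) = 2 ^ 2 by norm_num, Real.log_pow]
    push_cast; ring
  rw [lR, lM]
  rcases hε with rfl | rfl
  · have a1 : dualCenter p β x + 1 * (x - bandCenter p β 0) = 2 * x / (1 - β) := by
      rw [dualCenter, bandCenter]; field_simp; ring
    have a2 : auxForm p β x 0 + 1 * (x - bandCenter p β 0) = 2 * (x + p) := by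
      rw [auxForm, bandCenter]; field_simp; ring
    rw [a1, a2, Real.log_div (by positivity) h1', Real.log_mul two_ne_zero hx.ne',
      Real.log_mul two_ne_zero hxp.ne']
    ring
  · have a1 : dualCenter p β x + -1 * (x - bandCenter p β 0) = 2 * (β * (x + p)) / (1 - β) := by
      rw [dualCenter, bandCenter]; field_simp; ring
    have a2 : auxForm p β x 0 + -1 * (x - bandCenter p β 0) = 2 * p / (1 - β) := by
      rw [auxForm, bandCenter]; field_simp; ring
    rw [a1, a2, Real.log_div (by positivity) h1', Real.log_div (by positivity) h1',
      Real.log_mul two_ne_zero (by positivity), Real.log_mul hβ.ne' hxp.ne',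
      Real.log_mul two_ne_zero hp.ne']
    ring

/-- The band grows out of the point `bandCenter p β 0`. Before it reaches `x`, its centre cannot
pass `x`: at the centre `disc = -h(s)²` would be negative. -/
theorem sign_sub_bandCenter (hp : 0 < p) (hβ : 0 < β) (hβ1 : β < 1) (hx : 0 < x)
    (hne : x ≠ bandCenter p β 0) : ∃ ε : ℝ, (ε = 1 ∨ ε = -1) ∧
      ∀ s ∈ Icc 0 (dualCenter p β x - dualHalf p β x), 0 < ε * (x - bandCenter p β s) := by
  have h1 : 0 < 1 - β := by linarith
  have hmono : ∀ s, bandCenter p β s = bandCenter p β 0 + (1 + β) / (1 - β) * s := by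
    intro s; unfold bandCenter; field_simp; ring
  have hq : 0 < (1 + β) / (1 - β) := by positivity
  rcases lt_or_gt_of_ne hne with h | h
  · refine ⟨-1, Or.inr rfl, fun s hs => ?_⟩
    rw [hmono]
    have := mul_nonneg hq.le hs.1
    linarith
  · refine ⟨1, Or.inl rfl, fun s hs => ?_⟩
    by_contra! hcon
    rw [one_mul, hmono] at hcon
    set s' := (x - bandCenter p β 0) / ((1 + β) / (1 - β)) with hs'
    have e : (1 + β) / (1 - β) * s' = x - bandCenter p β 0 := by rw [hs']; field_simp
    have p1 : 0 < s' := div_pos (by linarith) hq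
    have p2 : s' ≤ s := by
      refine le_of_mul_le_mul_left ?_ hq
      linarith
    have hT := disc_nonneg (dualHalf_pos hp hβ hβ1 hx).le (p2.trans hs.2)
    rw [disc_eq_band hp hβ hβ1 hx p1.le, hmono, e] at hT
    have : 0 < 4 * (s' * β * (s' + p)) / (1 - β) ^ 2 := by positivity
    nlinarith

theorem integral_bandGreen (hp : 0 < p) (hβ : 0 < β) (hβ1 : β < 1) (hx : 0 < x) :
    IntervalIntegrable (bandGreen p β x) volume 0 (dualCenter p β x - dualHalf p β x) ∧
    ∫ s in (0 : ℝ)..(dualCenter p β x - dualHalf p β x), bandGreen p β x s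
      = (meixnerField (p + 1) β x - p * Real.log (1 - β)) / 2 := by
  have h1 : 0 < 1 - β := by linarith
  have hR := dualHalf_pos hp hβ hβ1 hx
  have hle : 0 ≤ dualCenter p β x - dualHalf p β x :=
    sub_nonneg.2 (dualHalf_le_dualCenter hp hβ hβ1 hx.le)
  have hprod : disc p β x 0 = (x - bandCenter p β 0) ^ 2 := by
    rw [disc_eq_band hp hβ hβ1 hx le_rfl]; ring
  -- If `x` is the point where the band is born, the interval of masses is empty and the claim is a
  -- value of the field.
  by_cases hne : x = bandCenter p β 0
  · have e : dualCenter p β x - dualHalf p β x = 0 := by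
      have : disc p β x 0 = 0 := by rw [hprod, ← hne]; ring
      rw [disc] at this
      have h2 : (dualCenter p β x - dualHalf p β x) * (dualCenter p β x + dualHalf p β x) = 0 := by
        linear_combination this
      rcases mul_eq_zero.1 h2 with h | h
      · exact h
      · linarith
    rw [e]
    refine ⟨IntervalIntegrable.refl, ?_⟩
    rw [intervalIntegral.integral_same, meixnerField_eq hp hβ hx.le]
    have e0 : bandCenter p β 0 = β * p / (1 - β) := by rw [bandCenter]; ring
    have e1 : x + p = p / (1 - β) := by rw [hne, e0]; field_simp; ring
    have e2 : Real.log x = Real.log β + Real.log p - Real.log (1 - β) := by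
      rw [hne, e0, Real.log_div (by positivity) h1.ne', Real.log_mul hβ.ne' hp.ne']
    rw [e1, e2, Real.log_div hp.ne' h1.ne']
    ring
  · obtain ⟨ε, hε, hL⟩ := sign_sub_bandCenter hp hβ hβ1 hx hne
    have hε2 : ε ^ 2 = 1 := by rcases hε with rfl | rfl <;> norm_num
    have hcont := continuousOn_greenPrimitive hp hβ hβ1 hx hL
    have hder : ∀ s ∈ Ioo 0 (dualCenter p β x - dualHalf p β x),
        HasDerivAt (greenPrimitive p β x ε) (bandGreen p β x s) s := by
      intro s hs
      have hLs := hL s (Ioo_subset_Icc_self hs)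
      have e : ε * (x - bandCenter p β s) = |x - bandCenter p β s| := by
        rcases hε with rfl | rfl
        · rw [one_mul] at hLs ⊢; rw [abs_of_pos hLs]
        · rw [abs_of_neg (by linarith)]; ring
      rw [bandGreen_eq hp hβ hβ1 hx hs.1 (disc_nonneg hR.le hs.2.le), ← e]
      exact hasDerivAt_greenPrimitive hp hβ hβ1 hx hε2 hs.1 hs.2 hLs
    have hint : IntervalIntegrable (bandGreen p β x) volume 0
        (dualCenter p β x - dualHalf p β x) := by
      rw [intervalIntegrable_iff_integrableOn_Ioc_of_le hle]
      -- The Green function is singular at `s = 0`; integrability follows from its sign and the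
      -- continuity of the antiderivative.
      exact intervalIntegral.integrableOn_deriv_of_nonneg hcont hder
        fun s _ => bandGreen_nonneg _ _ _ _
    refine ⟨hint, ?_⟩
    rw [intervalIntegral.integral_eq_sub_of_hasDerivAt_of_le hle hcont hder hint,
      greenPrimitive_edge hp hβ hβ1 hx hε2 hle rfl,
      greenPrimitive_zero hp hβ hβ1 hx hε (hL 0 ⟨le_rfl, hle⟩)]
    ring

theorem intervalIntegrable_bandGreen (hp : 0 < p) (hβ : 0 < β) (hβ1 : β < 1) (hx : 0 < x) {t : ℝ}
    (ht : 0 ≤ t) : IntervalIntegrable (bandGreen p β x) volume 0 t := by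
  have hR := dualHalf_pos hp hβ hβ1 hx
  have hle : 0 ≤ dualCenter p β x - dualHalf p β x :=
    sub_nonneg.2 (dualHalf_le_dualCenter hp hβ hβ1 hx.le)
  have i1 := (integral_bandGreen hp hβ hβ1 hx).1
  have i2 : IntervalIntegrable (bandGreen p β x) volume (dualCenter p β x - dualHalf p β x)
      (dualCenter p β x + dualHalf p β x) := by
    refine (intervalIntegrable_const (c := (0 : ℝ))).congr fun s hs => ?_
    rw [uIoc_of_le (by linarith)] at hs
    exact (bandGreen_eq_zero hp hβ hβ1 hx (hle.trans hs.1.le) hs.1.le hs.2).symm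
  rcases ht.eq_or_lt with rfl | ht
  · exact IntervalIntegrable.refl
  refine (i1.trans i2).trans (ContinuousOn.intervalIntegrable ?_)
  refine (continuousOn_bandGreen hp hβ hβ1).mono fun s hs => ?_
  exact (lt_min (by linarith) ht).trans_le hs.1

/-- The masses below `c - R` account for the field, so the effective potential is minus the integral
of the Green function from `c - R` to `1`. That function is zero on `[c - R, c + R]` and positive
outside; for `1 < c - R` the integral runs backwards, which flips the sign. -/
theorem eulerLagrange_meixner (hp : 0 < p) (hβ : 0 < β) (hβ1 : β < 1)
    (hm : Integrable (fun y => y) (meixnerMeasure p β)) : ∃ l : ℝ, ∀ x, 0 < x →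
      (dualCenter p β x + dualHalf p β x < 1 →
        logPotential (meixnerMeasure p β) x + meixnerField (p + 1) β x / 2 + l < 0) ∧
      (dualCenter p β x - dualHalf p β x ≤ 1 → 1 ≤ dualCenter p β x + dualHalf p β x →
        logPotential (meixnerMeasure p β) x + meixnerField (p + 1) β x / 2 + l = 0) ∧
      (1 < dualCenter p β x - dualHalf p β x →
        0 < logPotential (meixnerMeasure p β) x + meixnerField (p + 1) β x / 2 + l) := by
  refine ⟨-(∫ s in (0 : ℝ)..1, (Real.log 2 - Real.log (bandHalf p β s)))
    - p * Real.log (1 - β) / 2, fun x hx => ?_⟩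
  have hR := dualHalf_pos hp hβ hβ1 hx
  have hle : 0 ≤ dualCenter p β x - dualHalf p β x :=
    sub_nonneg.2 (dualHalf_le_dualCenter hp hβ hβ1 hx.le)
  obtain ⟨hi, hU⟩ := logPotential_meixner hp hβ hβ1 hm x
  have ig : ∀ {t : ℝ}, 0 ≤ t → IntervalIntegrable (bandGreen p β x) volume 0 t :=
    fun ht => intervalIntegrable_bandGreen hp hβ hβ1 hx ht
  have ig2 : ∀ {t u : ℝ}, 0 ≤ t → 0 ≤ u → IntervalIntegrable (bandGreen p β x) volume t u :=
    fun ht hu => (ig ht).symm.trans (ig hu)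
  have hlog : IntervalIntegrable (fun s => Real.log 2 - Real.log (bandHalf p β s)) volume 0 1 := by
    refine (hi.add (ig zero_le_one)).congr fun s _ => ?_
    simp only [bandGreen]; ring
  have hU' : logPotential (meixnerMeasure p β) x
      = (∫ s in (0 : ℝ)..1, (Real.log 2 - Real.log (bandHalf p β s)))
        - ∫ s in (0 : ℝ)..1, bandGreen p β x s := by
    rw [hU, ← intervalIntegral.integral_sub hlog (ig zero_le_one)]
    rfl
  have hV := (integral_bandGreen hp hβ hβ1 hx).2
  have hadd := intervalIntegral.integral_add_adjacent_intervals (ig hle) (ig2 hle zero_le_one)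
  have htot : logPotential (meixnerMeasure p β) x + meixnerField (p + 1) β x / 2
      + (-(∫ s in (0 : ℝ)..1, (Real.log 2 - Real.log (bandHalf p β s)))
      - p * Real.log (1 - β) / 2)
      = -∫ s in (dualCenter p β x - dualHalf p β x)..1, bandGreen p β x s := by
    rw [hU']; linarith
  rw [htot]
  refine ⟨fun h => ?_, fun h2 h3 => ?_, fun h => ?_⟩
  · have h0 : 0 ≤ dualCenter p β x + dualHalf p β x := by linarith
    rw [← intervalIntegral.integral_add_adjacent_intervals (ig2 hle h0) (ig2 h0 zero_le_one)]
    have a1 : 0 ≤ ∫ s in (dualCenter p β x - dualHalf p β x)..(dualCenter p β x + dualHalf p β x),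
        bandGreen p β x s :=
      intervalIntegral.integral_nonneg (by linarith) fun s _ => bandGreen_nonneg _ _ _ _
    have a2 : 0 < ∫ s in (dualCenter p β x + dualHalf p β x)..1, bandGreen p β x s :=
      intervalIntegral.intervalIntegral_pos_of_pos_on (ig2 h0 zero_le_one) (fun s hs =>
        bandGreen_pos hp hβ hβ1 hx (h0.trans_lt hs.1) (disc_pos_of_gt hR.le hs.1)) h
    linarith
  · rw [neg_eq_zero]
    refine (intervalIntegral.integral_congr (g := fun _ => (0 : ℝ)) fun s hs => ?_).trans (by simp)
    rw [uIcc_of_le h2] at hs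
    exact bandGreen_eq_zero hp hβ hβ1 hx (hle.trans hs.1) hs.1 (hs.2.trans h3)
  · rw [← intervalIntegral.integral_symm]
    exact intervalIntegral.intervalIntegral_pos_of_pos_on (ig2 zero_le_one hle) (fun s hs =>
      bandGreen_pos hp hβ hβ1 hx (one_pos.trans hs.1) (disc_pos hR.le hs.2)) h

end

/-! ### The saturated region, the band and the void -/

/-- Left endpoint of the band. -/
noncomputable def leftEdge (p β : ℝ) : ℝ := (1 - √((p + 1) * β)) ^ 2 / (1 - β)

/-- Right endpoint of the band. -/
noncomputable def rightEdge (p β : ℝ) : ℝ := (1 + √((p + 1) * β)) ^ 2 / (1 - β)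

theorem sq_sqrt_mass {p β : ℝ} (hp : 0 < p) (hβ : 0 < β) :
    √((p + 1) * β) ^ 2 = (p + 1) * β := Real.sq_sqrt (by positivity)

theorem lt_sqrt_mass {p β : ℝ} (hp : 0 < p) (hβ : 0 < β) (hβ1 : β < 1) :
    β < √((p + 1) * β) := by
  refine Real.lt_sqrt_of_sq_lt ?_
  nlinarith [mul_pos hp hβ]

theorem sqrt_mass_lt_one {p β : ℝ} (h : (p + 1) * β < 1) : √((p + 1) * β) < 1 := by
  rw [Real.sqrt_lt' one_pos]; simpa using h

theorem leftEdge_pos {p β : ℝ} (hβ1 : β < 1) (h : (p + 1) * β < 1) : 0 < leftEdge p β := by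
  have h1 : 0 < 1 - β := by linarith
  have h2 : 0 < 1 - √((p + 1) * β) := by linarith [sqrt_mass_lt_one h]
  unfold leftEdge; positivity

theorem rightEdge_sub_leftEdge {p β : ℝ} :
    rightEdge p β - leftEdge p β = 4 * √((p + 1) * β) / (1 - β) := by
  rw [rightEdge, leftEdge]; ring

theorem leftEdge_lt_rightEdge {p β : ℝ} (hp : 0 < p) (hβ : 0 < β) (hβ1 : β < 1) :
    leftEdge p β < rightEdge p β := by
  have h1 : 0 < 1 - β := by linarith
  have h2 : 0 < √((p + 1) * β) := hβ.trans (lt_sqrt_mass hp hβ hβ1)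
  rw [← sub_pos, rightEdge_sub_leftEdge]; positivity

/-- `radicand_eq` at full mass `s = 1`, where the band is `[a, b]`. -/
theorem dualHalf_sq_sub {p β x : ℝ} (hp : 0 < p) (hβ : 0 < β) (hβ1 : β < 1) (hx : 0 ≤ x) :
    dualHalf p β x ^ 2 - (1 - dualCenter p β x) ^ 2
      = (x - leftEdge p β) * (rightEdge p β - x) := by
  have h1 : 1 - β ≠ 0 := by linarith
  have hs := sq_sqrt_mass hp hβ
  rw [← radicand_eq hp hβ hβ1 zero_le_one hx, bandHalf_sq hp hβ zero_le_one, bandCenter, leftEdge,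
    rightEdge]
  generalize √((p + 1) * β) = σ at *
  field_simp
  linear_combination (σ ^ 2 - (p + 1) * β - 4 - 2 * (x * (1 - β) - 1 - (1 + p) * β)) * hs

/-- At both edges `R = |1 - c|`; the sign of `1 - c` separates saturation from void. It is positive
here once `β < √((p+1)β) < 1`, and negative at the right edge. -/
theorem one_sub_dualCenter_leftEdge {p β : ℝ} (hp : 0 < p) (hβ : 0 < β) (hβ1 : β < 1) :
    1 - dualCenter p β (leftEdge p β)
      = 2 * ((1 - √((p + 1) * β)) * (√((p + 1) * β) - β)) / (1 - β) ^ 2 := by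
  have h1 : 1 - β ≠ 0 := by linarith
  have hs := sq_sqrt_mass hp hβ
  rw [dualCenter, leftEdge]
  generalize √((p + 1) * β) = σ at *
  field_simp
  linear_combination (1 - β) * hs

theorem dualCenter_rightEdge_sub_one {p β : ℝ} (hp : 0 < p) (hβ : 0 < β) (hβ1 : β < 1) :
    dualCenter p β (rightEdge p β) - 1
      = 2 * ((1 + √((p + 1) * β)) * (√((p + 1) * β) + β)) / (1 - β) ^ 2 := by
  have h1 : 1 - β ≠ 0 := by linarith
  have hs := sq_sqrt_mass hp hβ
  rw [dualCenter, rightEdge]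
  generalize √((p + 1) * β) = σ at *
  field_simp
  linear_combination (-(1 - β)) * hs

theorem strictMono_dualCenter {p β : ℝ} (hβ : 0 < β) (hβ1 : β < 1) :
    StrictMono (dualCenter p β) := by
  intro x y h
  have h1 : 0 < 1 - β := by linarith
  unfold dualCenter
  gcongr

theorem dualCenter_leftEdge_lt_one {p β : ℝ} (hp : 0 < p) (hβ : 0 < β) (hβ1 : β < 1)
    (h : (p + 1) * β < 1) : dualCenter p β (leftEdge p β) < 1 := by
  have h1 : 0 < 1 - β := by linarith
  have h2 : 0 < 1 - √((p + 1) * β) := by linarith [sqrt_mass_lt_one h]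
  have h3 : 0 < √((p + 1) * β) - β := sub_pos.2 (lt_sqrt_mass hp hβ hβ1)
  rw [← sub_pos, one_sub_dualCenter_leftEdge hp hβ hβ1]
  positivity

theorem one_lt_dualCenter_rightEdge {p β : ℝ} (hp : 0 < p) (hβ : 0 < β) (hβ1 : β < 1) :
    1 < dualCenter p β (rightEdge p β) := by
  have h1 : 0 < 1 - β := by linarith
  rw [← sub_pos, dualCenter_rightEdge_sub_one hp hβ hβ1]
  positivity

theorem dualHalf_leftEdge {p β : ℝ} (hp : 0 < p) (hβ : 0 < β) (hβ1 : β < 1)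
    (h : (p + 1) * β < 1) : dualHalf p β (leftEdge p β)
      = 2 * ((1 - √((p + 1) * β)) * (√((p + 1) * β) - β)) / (1 - β) ^ 2 := by
  have ha := leftEdge_pos hβ1 h
  rw [← one_sub_dualCenter_leftEdge hp hβ hβ1]
  have := dualHalf_sq_sub hp hβ hβ1 ha.le
  rw [sub_self, zero_mul, sub_eq_zero] at this
  exact (sq_eq_sq₀ (dualHalf_pos hp hβ hβ1 ha).le
    (sub_nonneg.2 (dualCenter_leftEdge_lt_one hp hβ hβ1 h).le)).1 this

section
variable {p β x : ℝ}

theorem dualHalf_le_of_le_leftEdge (hp : 0 < p) (hβ : 0 < β) (hβ1 : β < 1)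
    (h : (p + 1) * β < 1) (hx : 0 < x) (hxa : x ≤ leftEdge p β) :
    dualHalf p β x ≤ 1 - dualCenter p β x := by
  have h1 := (strictMono_dualCenter (p := p) hβ hβ1).monotone hxa
  have h2 := dualCenter_leftEdge_lt_one hp hβ hβ1 h
  refine le_of_sq_le_sq ?_ (by linarith)
  nlinarith [dualHalf_sq_sub hp hβ hβ1 hx.le, leftEdge_lt_rightEdge hp hβ hβ1]

theorem dualHalf_lt_of_lt_leftEdge (hp : 0 < p) (hβ : 0 < β) (hβ1 : β < 1)
    (h : (p + 1) * β < 1) (hx : 0 < x) (hxa : x < leftEdge p β) :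
    dualHalf p β x < 1 - dualCenter p β x := by
  have h1 := (strictMono_dualCenter (p := p) hβ hβ1).monotone hxa.le
  have h2 := dualCenter_leftEdge_lt_one hp hβ hβ1 h
  refine lt_of_pow_lt_pow_left₀ 2 (by linarith) ?_
  nlinarith [dualHalf_sq_sub hp hβ hβ1 hx.le, leftEdge_lt_rightEdge hp hβ hβ1]

theorem dualHalf_le_of_rightEdge_le (hp : 0 < p) (hβ : 0 < β) (hβ1 : β < 1)
    (hx : 0 < x) (hxb : rightEdge p β ≤ x) : dualHalf p β x ≤ dualCenter p β x - 1 := by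
  have h1 := (strictMono_dualCenter (p := p) hβ hβ1).monotone hxb
  have h2 := one_lt_dualCenter_rightEdge hp hβ hβ1
  refine le_of_sq_le_sq ?_ (by linarith)
  nlinarith [dualHalf_sq_sub hp hβ hβ1 hx.le, leftEdge_lt_rightEdge hp hβ hβ1]

theorem dualHalf_lt_of_rightEdge_lt (hp : 0 < p) (hβ : 0 < β) (hβ1 : β < 1)
    (hx : 0 < x) (hxb : rightEdge p β < x) : dualHalf p β x < dualCenter p β x - 1 := by
  have h1 := (strictMono_dualCenter (p := p) hβ hβ1).monotone hxb.le
  have h2 := one_lt_dualCenter_rightEdge hp hβ hβ1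
  refine lt_of_pow_lt_pow_left₀ 2 (by linarith) ?_
  nlinarith [dualHalf_sq_sub hp hβ hβ1 hx.le, leftEdge_lt_rightEdge hp hβ hβ1]

theorem abs_one_sub_dualCenter_le (hp : 0 < p) (hβ : 0 < β) (hβ1 : β < 1) (hx : 0 < x)
    (hxa : leftEdge p β ≤ x) (hxb : x ≤ rightEdge p β) :
    |1 - dualCenter p β x| ≤ dualHalf p β x := by
  refine abs_le_of_sq_le_sq ?_ (dualHalf_pos hp hβ hβ1 hx).le
  nlinarith [dualHalf_sq_sub hp hβ hβ1 hx.le]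

theorem abs_one_sub_dualCenter_lt (hp : 0 < p) (hβ : 0 < β) (hβ1 : β < 1) (hx : 0 < x)
    (hxa : leftEdge p β < x) (hxb : x < rightEdge p β) :
    |1 - dualCenter p β x| < dualHalf p β x := by
  refine abs_lt_of_sq_lt_sq ?_ (dualHalf_pos hp hβ hβ1 hx).le
  nlinarith [dualHalf_sq_sub hp hβ hβ1 hx.le]

theorem meixnerDensity_of_le_leftEdge (hp : 0 < p) (hβ : 0 < β) (hβ1 : β < 1)
    (h : (p + 1) * β < 1) (hx : 0 < x) (hxa : x ≤ leftEdge p β) : meixnerDensity p β x = 1 := by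
  have := dualHalf_le_of_le_leftEdge hp hβ hβ1 h hx hxa
  rw [meixnerDensity, if_pos hx, Real.arcsin_of_one_le]
  · have := Real.pi_ne_zero; field_simp; norm_num
  · rwa [one_le_div (dualHalf_pos hp hβ hβ1 hx)]

theorem meixnerDensity_of_rightEdge_le (hp : 0 < p) (hβ : 0 < β) (hβ1 : β < 1)
    (hx : 0 < x) (hxb : rightEdge p β ≤ x) : meixnerDensity p β x = 0 := by
  have := dualHalf_le_of_rightEdge_le hp hβ hβ1 hx hxb
  rw [meixnerDensity, if_pos hx, Real.arcsin_of_le_neg_one]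
  · have := Real.pi_ne_zero; field_simp; norm_num
  · rw [div_le_iff₀ (dualHalf_pos hp hβ hβ1 hx)]; linarith

theorem meixnerDensity_mem_Ioo (hp : 0 < p) (hβ : 0 < β) (hβ1 : β < 1) (hx : 0 < x)
    (hxa : leftEdge p β < x) (hxb : x < rightEdge p β) :
    0 < meixnerDensity p β x ∧ meixnerDensity p β x < 1 := by
  have hR := dualHalf_pos hp hβ hβ1 hx
  obtain ⟨h1, h2⟩ := abs_lt.1 (abs_one_sub_dualCenter_lt hp hβ hβ1 hx hxa hxb)
  have hpi := Real.pi_pos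
  have k1 : -(Real.pi / 2) < Real.arcsin ((1 - dualCenter p β x) / dualHalf p β x) := by
    rw [Real.neg_pi_div_two_lt_arcsin, lt_div_iff₀ hR]; linarith
  have k2 : Real.arcsin ((1 - dualCenter p β x) / dualHalf p β x) < Real.pi / 2 := by
    rw [Real.arcsin_lt_pi_div_two, div_lt_one hR]; exact h2
  rw [meixnerDensity, if_pos hx]
  constructor
  · have : -(1 / 2) < Real.arcsin ((1 - dualCenter p β x) / dualHalf p β x) / Real.pi := by
      rw [lt_div_iff₀ hpi]; linarith
    linarith
  · have : Real.arcsin ((1 - dualCenter p β x) / dualHalf p β x) / Real.pi < 1 / 2 := by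
      rw [div_lt_iff₀ hpi]; linarith
    linarith

theorem meixnerDensity_pos (hp : 0 < p) (hβ : 0 < β) (hβ1 : β < 1) (h : (p + 1) * β < 1)
    (hx : 0 < x) (hxb : x < rightEdge p β) : 0 < meixnerDensity p β x := by
  rcases le_or_gt x (leftEdge p β) with hxa | hxa
  · rw [meixnerDensity_of_le_leftEdge hp hβ hβ1 h hx hxa]; exact one_pos
  · exact (meixnerDensity_mem_Ioo hp hβ hβ1 hx hxa hxb).1

theorem meixnerMeasure_Ioi_rightEdge (hp : 0 < p) (hβ : 0 < β) (hβ1 : β < 1) :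
    meixnerMeasure p β (Ioi (rightEdge p β)) = 0 := by
  have h1 : 0 < 1 - β := by linarith
  have hb : 0 < rightEdge p β := by unfold rightEdge; positivity
  rw [meixnerMeasure, withDensity_apply _ measurableSet_Ioi]
  refine (setLIntegral_congr_fun measurableSet_Ioi (g := fun _ => 0) fun x hx => ?_).trans (by simp)
  have hx' : rightEdge p β < x := hx
  rw [meixnerDensity_of_rightEdge_le hp hβ hβ1 (hb.trans hx') hx'.le, ENNReal.ofReal_zero]

theorem meixnerMeasure_restrict_saturated (hp : 0 < p) (hβ : 0 < β) (hβ1 : β < 1)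
    (h : (p + 1) * β < 1) : (meixnerMeasure p β).restrict (Icc 0 (leftEdge p β))
      = volume.restrict (Icc 0 (leftEdge p β)) := by
  rw [meixnerMeasure, restrict_withDensity measurableSet_Icc]
  refine (withDensity_congr_ae ?_).trans withDensity_one
  filter_upwards [ae_restrict_mem measurableSet_Icc,
    ae_restrict_of_ae (volume.ae_ne (0 : ℝ))] with x hx hx0
  rw [meixnerDensity_of_le_leftEdge hp hβ hβ1 h (lt_of_le_of_ne hx.1 hx0.symm) hx.2,
    ENNReal.ofReal_one, Pi.one_apply]

theorem integrable_id_meixnerMeasure (hp : 0 < p) (hβ : 0 < β) (hβ1 : β < 1) :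
    Integrable (fun y => y) (meixnerMeasure p β) := by
  have := isProbabilityMeasure_meixner hp hβ hβ1
  refine Integrable.of_mem_Icc 0 (rightEdge p β) aemeasurable_id' ?_
  have h1 : ∀ᵐ x ∂meixnerMeasure p β, ¬ x < 0 := by
    rw [ae_iff]; simpa [Iio] using! meixnerMeasure_Iio_zero p β
  have h2 : ∀ᵐ x ∂meixnerMeasure p β, ¬ rightEdge p β < x := by
    rw [ae_iff]; simpa [Ioi] using! meixnerMeasure_Ioi_rightEdge hp hβ hβ1
  filter_upwards [h1, h2] with x hx1 hx2
  exact ⟨not_lt.1 hx1, not_lt.1 hx2⟩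

theorem support_meixnerMeasure (hp : 0 < p) (hβ : 0 < β) (hβ1 : β < 1) (h : (p + 1) * β < 1) :
    (meixnerMeasure p β).support = Icc 0 (rightEdge p β) := by
  have hb : 0 < rightEdge p β := (leftEdge_pos hβ1 h).trans (leftEdge_lt_rightEdge hp hβ hβ1)
  refine Subset.antisymm (fun x hx => ?_) (fun x hx => ?_)
  · by_contra hx'
    rw [Measure.mem_support_iff_forall] at hx
    have := hx _ (isClosed_Icc.isOpen_compl.mem_nhds hx')
    refine this.ne' (measure_mono_null (t := Iio 0 ∪ Ioi (rightEdge p β)) (fun y hy => ?_)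
      (measure_union_null (meixnerMeasure_Iio_zero p β)
        (meixnerMeasure_Ioi_rightEdge hp hβ hβ1)))
    by_contra hc
    simp only [mem_union, mem_Iio, mem_Ioi, not_or, not_lt] at hc
    exact hy ⟨hc.1, hc.2⟩
  · rw [Measure.mem_support_iff_forall]
    intro U hU
    rw [← closure_Ioo hb.ne] at hx
    obtain ⟨O, hOU, hO, hxO⟩ := mem_nhds_iff.1 hU
    have hne : (O ∩ Ioo 0 (rightEdge p β)).Nonempty := mem_closure_iff.1 hx O hO hxO
    refine pos_iff_ne_zero.2 fun h0 => ?_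
    rw [meixnerMeasure, withDensity_apply_eq_zero
      (measurable_meixnerDensity p β).ennreal_ofReal] at h0
    refine (hO.inter isOpen_Ioo).measure_pos volume hne |>.ne' (measure_mono_null ?_ h0)
    intro y hy
    exact ⟨(ENNReal.ofReal_pos.2 (meixnerDensity_pos hp hβ hβ1 h hy.2.1 hy.2.2)).ne', hOU hy.1⟩

end

/-! ### Linear growth of the Meixner field. -/

theorem linearField_meixner {p β : ℝ} (hp : 0 < p) (hβ : 0 < β) (hβ1 : β < 1) :
    LinearField (meixnerField (p + 1) β) := by
  have hc := continuousOn_meixnerField hp hβ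
  have ht := tendsto_meixnerField_div hp hβ
  have hL : 0 < -Real.log β := neg_pos.2 (Real.log_neg hβ hβ1)
  set L := -Real.log β
  obtain ⟨M, hM⟩ := eventually_atTop.1 ((ht.eventually (Ioo_mem_nhds (half_lt_self hL)
    (lt_add_one L))).and (eventually_gt_atTop 0))
  have hM0 : 0 < M := (hM M le_rfl).2
  obtain ⟨K, hK⟩ := isCompact_Icc.exists_bound_of_continuousOn
    (hc.mono (Icc_subset_Ici_self : Icc 0 M ⊆ Ici 0))
  have hK0 : 0 ≤ K := (norm_nonneg _).trans (hK 0 ⟨le_rfl, hM0.le⟩)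
  refine ⟨hc, ⟨L / 2, by positivity, K + L / 2 * M, fun x hx => ?_⟩, ⟨K + L + 1, fun x hx => ?_⟩⟩
  · rcases le_total x M with h | h
    · have h1 := neg_le_of_abs_le (hK x ⟨hx, h⟩)
      have h2 : L / 2 * x ≤ L / 2 * M := by gcongr
      linarith
    · obtain ⟨⟨h1, -⟩, h2⟩ := hM x h
      have h1' := (lt_div_iff₀ h2).1 h1
      have : 0 ≤ L / 2 * M := by positivity
      linarith
  · rcases le_total x M with h | h
    · have h1 : |meixnerField (p + 1) β x| ≤ K := hK x ⟨hx, h⟩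
      nlinarith [mul_nonneg hK0 hx, mul_nonneg hL.le hx]
    · obtain ⟨⟨h1, h1'⟩, h2⟩ := hM x h
      have h3 := (lt_div_iff₀ h2).1 h1
      have h4 := (div_lt_iff₀ h2).1 h1'
      have h5 : 0 ≤ L / 2 * x := by positivity
      rw [abs_of_nonneg (by linarith)]
      nlinarith [mul_nonneg hK0 hx]

/-! ### Square-root behaviour at the endpoints of the band -/

/-- With `t = sin s`, Jordan's inequality gives `|s| ≤ 2|t|`; this turns the cubic error of the sine
in `s` into one in `t`. -/
theorem abs_arcsin_sub_le {t : ℝ} (ht : |t| ≤ 1 / 2) : |Real.arcsin t - t| ≤ 8 * |t| ^ 3 := by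
  obtain ⟨h1, h2⟩ := abs_le.1 ht
  set s := Real.arcsin t with hs
  have hst : Real.sin s = t := Real.sin_arcsin (by linarith) (by linarith)
  have hpi := Real.pi_pos
  have hb : |s| ≤ Real.pi / 2 :=
    abs_le.2 ⟨Real.neg_pi_div_two_le_arcsin t, Real.arcsin_le_pi_div_two t⟩
  have h3 : 2 / Real.pi * |s| ≤ |t| := by rw [← hst]; exact Real.mul_abs_le_abs_sin hb
  have h4 : |s| ≤ 2 * |t| := by
    have : 1 / 2 ≤ 2 / Real.pi := by
      rw [div_le_div_iff₀ two_pos hpi]; linarith [Real.pi_le_four]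
    nlinarith [abs_nonneg s]
  have h5 : |s| ≤ 1 := by linarith
  have h6 := Real.sin_bound h5
  rw [hst] at h6
  have h7 : |s| ^ 5 ≤ |s| ^ 3 := pow_le_pow_of_le_one (abs_nonneg s) h5 (by norm_num)
  have h8 : |s - t| ≤ |t - (s - s ^ 3 / 6)| + |s ^ 3 / 6| := by
    rw [abs_sub_comm t]
    calc |s - t| = |(s - s ^ 3 / 6 - t) + s ^ 3 / 6| := by ring_nf
      _ ≤ _ := abs_add_le _ _
  rw [abs_div, abs_pow, abs_of_pos (by norm_num : (0 : ℝ) < 6)] at h8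
  have h9 : |s| ^ 3 ≤ (2 * |t|) ^ 3 := by gcongr
  nlinarith [pow_nonneg (abs_nonneg s) 3]

theorem arcsin_sub_isBigO :
    (fun t : ℝ => Real.arcsin t - t) =O[𝓝 0] fun t => t ^ 3 := by
  refine IsBigO.of_bound 8 ?_
  filter_upwards [Metric.closedBall_mem_nhds (0 : ℝ) (by norm_num : (0 : ℝ) < 1 / 2)] with t ht
  rw [Real.norm_eq_abs, Real.norm_eq_abs, abs_pow]
  exact abs_arcsin_sub_le (by simpa using ht)

theorem arcsin_sqrt_mul_sub_isBigO {g d : ℝ → ℝ} {e : ℝ} {F : Filter ℝ} (hF : F ≤ 𝓝 e)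
    (hg : DifferentiableAt ℝ g e) (hd : ∀ᶠ x in F, d x = |x - e|) :
    (fun x => Real.arcsin (√(d x) * g x) - g e * √(d x)) =O[F] fun x => √(d x) * d x := by
  have hd0 : Tendsto d F (𝓝 0) := by
    have h : Tendsto (fun x => |x - e|) F (𝓝 |e - e|) :=
      ((continuous_id.sub continuous_const).abs.tendsto e).mono_left hF
    rw [sub_self, abs_zero] at h
    exact h.congr' (hd.mono fun x hx => hx.symm)
  have hge : Tendsto g F (𝓝 (g e)) := hg.continuousAt.tendsto.mono_left hF
  have hw : Tendsto (fun x => √(d x) * g x) F (𝓝 0) := by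
    have := ((Real.continuous_sqrt.tendsto 0).comp hd0).mul hge
    simpa using this
  have h1 : (fun x => Real.arcsin (√(d x) * g x) - √(d x) * g x)
      =O[F] fun x => √(d x) * d x := by
    refine (arcsin_sub_isBigO.comp_tendsto hw).trans ?_
    have h2 : (fun x => √(d x) * d x * g x ^ 3) =O[F] fun x => √(d x) * d x * 1 :=
      (isBigO_refl _ _).mul ((hge.pow 3).isBigO_one ℝ)
    simp only [mul_one] at h2
    refine h2.congr' ?_ EventuallyEq.rfl
    filter_upwards [hd] with x hx
    have : √(d x) ^ 2 = d x := Real.sq_sqrt (hx ▸ abs_nonneg _)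
    rw [Function.comp_apply]
    linear_combination (-(√(d x) * g x ^ 3)) * this
  have h3 : (fun x => √(d x) * (g x - g e)) =O[F] fun x => √(d x) * d x := by
    refine (isBigO_refl _ _).mul ((hg.isBigO_sub.mono hF).trans ?_)
    refine IsBigO.of_bound 1 ?_
    filter_upwards [hd] with x hx
    rw [hx, one_mul, Real.norm_eq_abs, Real.norm_eq_abs, abs_abs]
  refine (h1.add h3).congr_left fun x => ?_
  ring

section
variable {p β x : ℝ}

theorem differentiableAt_dualHalf (hp : 0 < p) (hβ : 0 < β) (hx : 0 < x) :
    DifferentiableAt ℝ (dualHalf p β) x := by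
  unfold dualHalf
  have h : DifferentiableAt ℝ (fun x => β * x * (x + p)) x := by fun_prop
  exact ((h.sqrt (by positivity)).const_mul 2).div_const _

theorem sqrt_one_sub_sq_eq (hp : 0 < p) (hβ : 0 < β) (hβ1 : β < 1) (hx : 0 < x)
    (hxa : leftEdge p β ≤ x) : √(1 - ((1 - dualCenter p β x) / dualHalf p β x) ^ 2)
      = √(x - leftEdge p β) * √(rightEdge p β - x) / dualHalf p β x := by
  have hR := dualHalf_pos hp hβ hβ1 hx
  rw [← Real.sqrt_mul (sub_nonneg.2 hxa), ← dualHalf_sq_sub hp hβ hβ1 hx.le]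
  have e : 1 - ((1 - dualCenter p β x) / dualHalf p β x) ^ 2
      = (dualHalf p β x ^ 2 - (1 - dualCenter p β x) ^ 2) / dualHalf p β x ^ 2 := by field_simp
  rw [e, Real.sqrt_div' _ (sq_nonneg _), Real.sqrt_sq hR.le]

/-- Near the left edge `(1-c)/R` is close to `1`, where `arcsin` is not smooth; passing to the
complementary angle isolates the factor `√(x - a)`, and the rest is differentiable at `a`. -/
theorem one_sub_meixnerDensity_eq_arcsin (hp : 0 < p) (hβ : 0 < β) (hβ1 : β < 1) (hx : 0 < x)
    (hxa : leftEdge p β ≤ x) (hc : dualCenter p β x ≤ 1) :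
    1 - meixnerDensity p β x = 1 / Real.pi *
      Real.arcsin (√(x - leftEdge p β) * (√(rightEdge p β - x) / dualHalf p β x)) := by
  have hR := dualHalf_pos hp hβ hβ1 hx
  rw [← mul_div_assoc, ← sqrt_one_sub_sq_eq hp hβ hβ1 hx hxa, ← Real.arccos_eq_arcsin
    (div_nonneg (sub_nonneg.2 hc) hR.le), Real.arccos, meixnerDensity, if_pos hx]
  have := Real.pi_ne_zero
  field_simp; ring

theorem meixnerDensity_eq_arcsin (hp : 0 < p) (hβ : 0 < β) (hβ1 : β < 1) (hx : 0 < x)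
    (hxa : leftEdge p β ≤ x) (hc : 1 ≤ dualCenter p β x) :
    meixnerDensity p β x = 1 / Real.pi *
      Real.arcsin (√(rightEdge p β - x) * (√(x - leftEdge p β) / dualHalf p β x)) := by
  have hR := dualHalf_pos hp hβ hβ1 hx
  rw [← mul_div_assoc, mul_comm (√(rightEdge p β - x)), ← sqrt_one_sub_sq_eq hp hβ hβ1 hx hxa,
    ← neg_sq, ← Real.arccos_eq_arcsin, Real.arccos, Real.arcsin_neg, meixnerDensity, if_pos hx]
  · have := Real.pi_ne_zero
    field_simp; ring
  · rw [← neg_div]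
    exact div_nonneg (by linarith) hR.le

theorem one_sub_meixnerDensity_isBigO (hp : 0 < p) (hβ : 0 < β) (hβ1 : β < 1)
    (h : (p + 1) * β < 1) :
    (fun x => 1 - meixnerDensity p β x - √(rightEdge p β - leftEdge p β)
        / dualHalf p β (leftEdge p β) / Real.pi * √(x - leftEdge p β))
      =O[𝓝[>] (leftEdge p β)] fun x => √(x - leftEdge p β) * (x - leftEdge p β) := by
  have ha := leftEdge_pos hβ1 h
  have hR := dualHalf_pos hp hβ hβ1 ha
  have hg : DifferentiableAt ℝ (fun x => √(rightEdge p β - x) / dualHalf p β x)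
      (leftEdge p β) :=
    (((differentiableAt_const _).sub differentiableAt_id).sqrt
      (sub_pos.2 (leftEdge_lt_rightEdge hp hβ hβ1)).ne').div
        (differentiableAt_dualHalf hp hβ ha) hR.ne'
  have key := (arcsin_sqrt_mul_sub_isBigO (d := fun x => x - leftEdge p β)
    (nhdsWithin_le_nhds (s := Ioi (leftEdge p β))) hg (by
      filter_upwards [self_mem_nhdsWithin] with x hx
      rw [abs_of_pos (sub_pos.2 hx)])).const_mul_left (1 / Real.pi)
  refine key.congr' ?_ EventuallyEq.rfl
  have hc : ∀ᶠ x in 𝓝[>] (leftEdge p β), dualCenter p β x < 1 :=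
    nhdsWithin_le_nhds ((continuous_dualCenter p β).continuousAt.eventually
      (gt_mem_nhds (dualCenter_leftEdge_lt_one hp hβ hβ1 h)))
  filter_upwards [self_mem_nhdsWithin, hc] with x hx hcx
  have hx' : leftEdge p β < x := hx
  rw [one_sub_meixnerDensity_eq_arcsin hp hβ hβ1 (ha.trans hx') hx'.le hcx.le]
  ring

theorem meixnerDensity_isBigO (hp : 0 < p) (hβ : 0 < β) (hβ1 : β < 1) (h : (p + 1) * β < 1) :
    (fun x => meixnerDensity p β x - √(rightEdge p β - leftEdge p β)
        / dualHalf p β (rightEdge p β) / Real.pi * √(rightEdge p β - x))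
      =O[𝓝[<] (rightEdge p β)] fun x => √(rightEdge p β - x) * (rightEdge p β - x) := by
  have ha := leftEdge_pos hβ1 h
  have hab := leftEdge_lt_rightEdge hp hβ hβ1
  have hb := ha.trans hab
  have hR := dualHalf_pos hp hβ hβ1 hb
  have hg : DifferentiableAt ℝ (fun x => √(x - leftEdge p β) / dualHalf p β x)
      (rightEdge p β) :=
    ((differentiableAt_id.sub (differentiableAt_const _)).sqrt (sub_pos.2 hab).ne').div
      (differentiableAt_dualHalf hp hβ hb) hR.ne'
  have key := (arcsin_sqrt_mul_sub_isBigO (d := fun x => rightEdge p β - x)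
    (nhdsWithin_le_nhds (s := Iio (rightEdge p β))) hg (by
      filter_upwards [self_mem_nhdsWithin] with x hx
      rw [abs_sub_comm, abs_of_pos (sub_pos.2 hx)])).const_mul_left (1 / Real.pi)
  refine key.congr' ?_ EventuallyEq.rfl
  have hc : ∀ᶠ x in 𝓝[<] (rightEdge p β), 1 < dualCenter p β x :=
    nhdsWithin_le_nhds ((continuous_dualCenter p β).continuousAt.eventually
      (lt_mem_nhds (one_lt_dualCenter_rightEdge hp hβ hβ1)))
  filter_upwards [hc, nhdsWithin_le_nhds (lt_mem_nhds hab)] with x hcx hx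
  rw [meixnerDensity_eq_arcsin hp hβ hβ1 (ha.trans hx) hx.le hcx.le]
  ring

end

/-! ### The scaling constant, and assembly of the equilibrium statement. -/

theorem scalingConstant_inv {p β : ℝ} (hp : 0 < p) (hβ : 0 < β) (hβ1 : β < 1)
    (h : (p + 1) * β < 1) :
    (√(rightEdge p β - leftEdge p β) / dualHalf p β (leftEdge p β)) ^ (2 / 3 : ℝ)
      = (scalingConstant (p + 1) β)⁻¹ := by
  have h1 : 0 < 1 - β := by linarith
  have hν : 0 < p + 1 := by linarith
  have hs1 := sqrt_mass_lt_one h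
  have hsβ := lt_sqrt_mass hp hβ hβ1
  have hlog : Real.log √((p + 1) * β) = (Real.log (p + 1) + Real.log β) / 2 := by
    rw [Real.log_sqrt (by positivity), Real.log_mul hν.ne' hβ.ne']
  have hdiv : √((p + 1) / β) = √((p + 1) * β) / β := by
    rw [eq_div_iff hβ.ne']
    nth_rw 2 [← Real.sqrt_sq hβ.le]
    rw [← Real.sqrt_mul (by positivity)]
    congr 1; field_simp
  rw [dualHalf_leftEdge hp hβ hβ1 h, rightEdge_sub_leftEdge, scalingConstant, hdiv]
  set σ := √((p + 1) * β)
  have hσ : 0 < σ := hβ.trans hsβ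
  have k1 : 0 < 1 - σ := by linarith
  have k2 : 0 < σ - β := by linarith
  have k3 : σ / β - 1 = (σ - β) / β := by field_simp
  rw [k3]
  have hK : 0 < (1 - σ) * (σ - β) := by positivity
  rw [show (1 - σ) * ((σ - β) / β) = (1 - σ) * (σ - β) / β by ring]
  generalize (1 - σ) * (σ - β) = K at hK ⊢
  -- Both sides are positive monomials in `2`, `β`, `p + 1`, `1 - β` and `K` with rational
  -- exponents, so after taking logarithms the claim is linear.
  refine Real.log_injOn_pos (mem_Ioi.2 (Real.rpow_pos_of_pos ?_ _)) (mem_Ioi.2 (inv_pos.2 ?_)) ?_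
  · have := Real.sqrt_pos.2 (show 0 < 4 * σ / (1 - β) by positivity); positivity
  · positivity
  rw [Real.log_inv, Real.log_rpow (by positivity), Real.log_div (by positivity) (by positivity),
    Real.log_sqrt (by positivity), Real.log_div (by positivity) h1.ne',
    Real.log_mul (by norm_num) hσ.ne', Real.log_div (by positivity) (by positivity),
    Real.log_mul two_ne_zero hK.ne', Real.log_pow, Real.log_mul (by positivity) (by positivity),
    Real.log_div (by positivity) h1.ne', Real.log_mul (by positivity) (by positivity),
    Real.log_rpow hβ, Real.log_rpow hν, Real.log_rpow (by positivity),
    Real.log_div hK.ne' hβ.ne', hlog, show (4 : ℝ) = 2 ^ 2 by norm_num, Real.log_pow]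
  push_cast; ring

theorem exists_equilibrium_meixner {p β : ℝ} (hp : 0 < p) (hβ : 0 < β) (hβ1 : β < 1)
    (h : (p + 1) * β < 1) :
    IsConstrainedEquilibrium (meixnerField (p + 1) β) (meixnerMeasure p β) ∧
    EquilibriumAssumption (meixnerField (p + 1) β) (meixnerMeasure p β) (meixnerDensity p β)
      (leftEdge p β) (rightEdge p β)
      (√(rightEdge p β - leftEdge p β) / dualHalf p β (leftEdge p β)) := by
  have ha := leftEdge_pos hβ1 h
  have hab := leftEdge_lt_rightEdge hp hβ hβ1
  have hb := ha.trans hab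
  have hs : 0 < √(rightEdge p β - leftEdge p β) := Real.sqrt_pos.2 (sub_pos.2 hab)
  have hm := integrable_id_meixnerMeasure hp hβ hβ1
  have := isProbabilityMeasure_meixner hp hβ hβ1
  obtain ⟨l, hl⟩ := eulerLagrange_meixner hp hβ hβ1 hm
  have e1 : ∀ x, 0 < x → x < leftEdge p β →
      logPotential (meixnerMeasure p β) x + meixnerField (p + 1) β x / 2 + l < 0 :=
    fun x hx hxa => (hl x hx).1 (by linarith [dualHalf_lt_of_lt_leftEdge hp hβ hβ1 h hx hxa])
  have e2 : ∀ x, leftEdge p β ≤ x → x ≤ rightEdge p β →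
      logPotential (meixnerMeasure p β) x + meixnerField (p + 1) β x / 2 + l = 0 := by
    intro x hxa hxb
    have hx := ha.trans_le hxa
    obtain ⟨h1, h2⟩ := abs_le.1 (abs_one_sub_dualCenter_le hp hβ hβ1 hx hxa hxb)
    exact (hl x hx).2.1 (by linarith) (by linarith)
  have e3 : ∀ x, rightEdge p β < x →
      0 < logPotential (meixnerMeasure p β) x + meixnerField (p + 1) β x / 2 + l :=
    fun x hxb => (hl x (hb.trans hxb)).2.2
      (by linarith [dualHalf_lt_of_rightEdge_lt hp hβ hβ1 (hb.trans hxb) hxb])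
  refine ⟨isConstrainedEquilibrium_of_eulerLagrange (linearField_meixner hp hβ hβ1)
    (isAdmissible_meixner hp hβ hβ1) (meixnerMeasure_Ioi_rightEdge hp hβ hβ1) hab
    (meixnerMeasure_restrict_saturated hp hβ hβ1 h) e1 e2 e3, ?_⟩
  exact {
    a_pos := ha
    a_lt_b := hab
    density_measurable := measurable_meixnerDensity p β
    density_mem := meixnerDensity_mem p β
    density_continuous := continuousOn_meixnerDensity hp hβ hβ1
    density := rfl
    support_eq := support_meixnerMeasure hp hβ hβ1 h
    saturated := meixnerMeasure_restrict_saturated hp hβ hβ1 h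
    band := fun x hx => meixnerDensity_mem_Ioo hp hβ hβ1 (ha.trans hx.1) hx.1 hx.2
    right_edge := ⟨_, div_pos hs (dualHalf_pos hp hβ hβ1 hb), meixnerDensity_isBigO hp hβ hβ1 h⟩
    c₀_pos := div_pos hs (dualHalf_pos hp hβ hβ1 ha)
    left_edge := one_sub_meixnerDensity_isBigO hp hβ hβ1 h
    potential_integrable := fun x _ => integrable_log_sub (meixnerMeasure_le_volume p β) hm x
    euler_lagrange := ⟨l, e1, e2, e3⟩ }

end Meixner

theorem mainTheorem8 (q u ν β : ℝ) (hq₀ : 0 < q) (hq₁ : q < 1)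
    (hu : q ^ (-(1 / 2) : ℝ) < u) (hν₁ : 1 < ν) (hν₂ : ν < u * q ^ (1 / 2 : ℝ))
    (hβ : β = q ^ (-(1 / 2) : ℝ) * u⁻¹) :
    β ∈ Ioo (0 : ℝ) 1 ∧
    Meixner.WeightAssumption
      (fun N => Meixner.meixnerWeight ((ν - 1) * N) β) (Meixner.meixnerField ν β) ∧
    ∃ (μ : Measure ℝ) (ρ : ℝ → ℝ) (c₀ : ℝ),
      Meixner.IsConstrainedEquilibrium (Meixner.meixnerField ν β) μ ∧
      Meixner.EquilibriumAssumption (Meixner.meixnerField ν β) μ ρ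
        ((1 - √(ν * β)) ^ 2 / (1 - β)) ((1 + √(ν * β)) ^ 2 / (1 - β)) c₀ ∧
      c₀ ^ (2 / 3 : ℝ) = (Meixner.scalingConstant ν β)⁻¹ := by
  have hqp : 0 < q ^ (-(1 / 2) : ℝ) := Real.rpow_pos_of_pos hq₀ _
  have hu0 : 0 < u := hqp.trans hu
  have hβ0 : 0 < β := by rw [hβ]; positivity
  have hβ1 : β < 1 := by rw [hβ, ← div_eq_mul_inv, div_lt_one hu0]; exact hu
  -- The upper bound on `ν` is exactly `ν < 1/β`, the condition under which a saturated region
  -- exists.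
  have hνβ : ν * β < 1 := by
    have e : u * q ^ (1 / 2 : ℝ) * β = 1 := by
      rw [hβ, Real.rpow_neg hq₀.le]
      have := (Real.rpow_pos_of_pos hq₀ (1 / 2)).ne'
      field_simp
    rw [← e]
    exact mul_lt_mul_of_pos_right hν₂ hβ0
  obtain ⟨p, rfl⟩ : ∃ p, ν = p + 1 := ⟨ν - 1, by ring⟩
  have hp : 0 < p := by linarith
  obtain ⟨h1, h2⟩ := Meixner.exists_equilibrium_meixner hp hβ0 hβ1 hνβ
  refine ⟨⟨hβ0, hβ1⟩, ?_, _, _, _, h1, h2, Meixner.scalingConstant_inv hp hβ0 hβ1 hνβ⟩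
  simpa only [add_sub_cancel_right] using Meixner.weightAssumption_meixner hp hβ0 hβ1
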